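/- A weighted oriented graph $D=(G,\mathcal O,w)$ is a finite simple graph $G$ with an orientation $\mathcal O$ of its edges and weights $w:V(G)\to\{1,2,3,\dots\}$; $(x,y)\in E(D)$ denotes an edge directed from $x$ to $y$. Throughout, every source $x$ (a vertex with no in-neighbour) has $w(x)=1$. Put $V^+=\{x: w(x)>1\}$, $N_D^+(x)=\{y:(x,y)\in E(D)\}$, $N_D^+(A)=\bigcup_{x\in A}N_D^+(x)$; a sink is a vertex with $N_D^+(x)=\emptyset$. For a field $K$, $I(D)$ is the ideal of $K[x: x\in V(G)]$ generated by the monomials $x\,y^{w(y)}$ with $(x,y)\in E(D)$; an ideal is unmixed if all its associated primes have the same height. A subgraph of $D$ is given by sets of vertices and oriented edges of $D$, with the weights of $D$; "cycle" and "degree" refer to the underlying undirected graph. A *root oriented tree* with parent $v$ is a subgraph $T$ of $D$ without cycles, with $v\in V(T)$, such that each $x\in V(T)\setminus\{v\}$ is reached from $v$ by an oriented path in $T$, and each $x\in V(T)$ with $w(x)=1$ satisfies either $\deg_T(x)=1$ and $x\ne v$, or $V(T)=\{v\}$ and $x=v$. A *unicycle oriented subgraph* is a subgraph $B$ of $D$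 with exactly one cycle $C$, such that $C$ is an oriented cycle, each $y\in V(B)\setminus V(C)$ is reached by an oriented path in $B$ from a vertex of $C$, and each $x\in V(B)$ with $w(x)=1$ has $\deg_B(x)=1$. A *$\star$-semi-forest* is a subgraph $H$ of $D$ which is a union of root oriented trees $T_1,\dots,T_r$ with parents $v_1,\dots,v_r$ and unicycle oriented subgraphs $B_1,\dots,B_s$ ($r,s\ge 0$) whose vertex sets are pairwise disjoint, such that there are (not necessarily distinct) vertices $w_1,\dots,w_r\in V(D)\setminus V(H)$, with $w_i$ adjacent to $v_i$ in $G$, and disjoint sets $W_1,W_2$ with $W_1\cup W_2=\{w_1,\dots,w_r\}$ for which: $W_1$ is a stable set; $W_2\subseteq V^+$; $(w_i,v_i)\in E(D)$ whenever $w_i\in W_2$; and $N_D^+(W_2\cup\tilde H)\cap W_1=\emptyset$, where $\tilde H=\{x\in V(H):\deg_H(x)\ge2\}\cup\{v_i:\deg_H(v_i)=1\}$. It is a *generating* $\star$-semi-forest of a subgraph $S$ of $D$ if $V(H)=V(S)$. A *simplex* of $D$ is an induced subgraph $D[N_G[x]]$ on the closed neighbourhood $N_G[x]$ of a vertex $x$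 such that $G[N_G[x]]$ is complete. Let $C_7$ be the cycle of length 7 and let $T_{10}$ be the graph with vertices $v,a_i,b_i,c_i$ ($1\le i\le3$) and edges $va_i,\ a_ib_i,\ b_ic_i$ ($1\le i\le 3$), $c_1c_2,\ c_2c_3,\ c_1c_3$. **Theorem.** Let $D=(G,\mathcal O,w)$ be a weighted oriented graph with $G$ connected and without (not necessarily induced) cycles of length $4$ or $5$, in which every source has weight $1$, and let $K$ be a field. Then $I(D)\subseteq K[x:x\in V(G)]$ is unmixed if and only if one of the following holds: (a) $G$ is isomorphic to $C_7$ or to $T_{10}$, and every vertex of $V^+$ is a sink; (b) every vertex lies in exactly one simplex of $D$, and no simplex of $D$ has a generating $\star$-semi-forest. -/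

import Mathlib

universe u v

/-- A weighted oriented graph `(G, O, w)` on the vertex set `V`: a simple graph `graph`, an
orientation of it (`arc x y` says that `(x, y)` is an oriented edge; each edge of the graph gets
exactly one direction), and a weight function with values in the positive integers. -/
structure WeightedOrientedGraph (V : Type u) where
  graph : SimpleGraph V
  arc : V → V → Prop
  adj_iff : ∀ x y, graph.Adj x y ↔ arc x y ∨ arc y x
  arc_asymm : ∀ x y, arc x y → ¬ arc y x
  weight : V → ℕ
  weight_pos : ∀ x, 0 < weight x

namespace WeightedOrientedGraph

variable {V : Type u} (D : WeightedOrientedGraph V)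

/-- The set `V⁺` of vertices of weight greater than one. -/
def vPlus : Set V := {x | 1 < D.weight x}

/-- The out-neighbourhood of a vertex. -/
def outNbhd (x : V) : Set V := {y | D.arc x y}

/-- The in-neighbourhood of a vertex. -/
def inNbhd (x : V) : Set V := {y | D.arc y x}

/-- The out-neighbourhood of a set of vertices. -/
def outNbhdSet (A : Set V) : Set V := {y | ∃ x ∈ A, y ∈ D.outNbhd x}

def IsSink (x : V) : Prop := D.outNbhd x = ∅

def IsSource (x : V) : Prop := D.inNbhd x = ∅

/-- The edge ideal `I(D) = (x_i x_j ^ w(x_j) | (x_i, x_j) ∈ E(D))` in the polynomial ring over `K`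
whose variables are the vertices. -/
noncomputable def edgeIdeal (K : Type v) [Field K] : Ideal (MvPolynomial V K) :=
  Ideal.span {f | ∃ x y, D.arc x y ∧ f = MvPolynomial.X x * MvPolynomial.X y ^ D.weight y}

/-- A weighted oriented subgraph of `D`; its weights are those of `D`, so only its vertices and
oriented edges are recorded. -/
@[ext]
structure Subgraph where
  verts : Set V
  arc : V → V → Prop
  arc_sub : ∀ x y, arc x y → D.arc x y
  fst_mem : ∀ x y, arc x y → x ∈ verts
  snd_mem : ∀ x y, arc x y → y ∈ verts

namespace Subgraph

variable {D}

/-- The underlying simple graph of a subgraph. The vertices of `D` outside the subgraph are kept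
as isolated vertices, which affects neither walks between vertices of `H`, cycles, nor degrees. -/
def graph (H : D.Subgraph) : SimpleGraph V where
  Adj x y := H.arc x y ∨ H.arc y x
  symm := ⟨fun _ _ h => h.symm⟩
  loopless := ⟨fun x h => D.arc_asymm x x (H.arc_sub x x (h.elim id id))
    (H.arc_sub x x (h.elim id id))⟩

/-- The degree of a vertex in a subgraph. -/
noncomputable def deg (H : D.Subgraph) (x : V) : ℕ := (H.graph.neighborSet x).ncard

/-- A walk in `H` is oriented if each of its steps follows the orientation. -/
def IsOrientedWalk (H : D.Subgraph) {x y : V} (p : H.graph.Walk x y) : Prop :=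
  ∀ d ∈ p.darts, H.arc d.fst d.snd

/-- There is an oriented path in `H` from `x` to `y`. -/
def HasOrientedPath (H : D.Subgraph) (x y : V) : Prop :=
  ∃ p : H.graph.Walk x y, p.IsPath ∧ H.IsOrientedWalk p

/-- The union of a family of subgraphs. -/
def iUnion {ι : Type*} (F : ι → D.Subgraph) : D.Subgraph where
  verts := ⋃ i, (F i).verts
  arc x y := ∃ i, (F i).arc x y
  arc_sub := fun x y ⟨i, h⟩ => (F i).arc_sub x y h
  fst_mem := fun x y ⟨i, h⟩ => Set.mem_iUnion.2 ⟨i, (F i).fst_mem x y h⟩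
  snd_mem := fun x y ⟨i, h⟩ => Set.mem_iUnion.2 ⟨i, (F i).snd_mem x y h⟩

/-- A unicycle oriented subgraph: it has exactly one cycle `c`, this cycle is oriented (the walk
`c` traverses it in the direction of its arcs), every other vertex is reached from the cycle by an
oriented path, and every vertex of weight one has degree one. -/
def IsUnicycle (B : D.Subgraph) : Prop :=
  (∃ (z : V) (c : B.graph.Walk z z), c.IsCycle ∧
    (∀ (z' : V) (c' : B.graph.Walk z' z'), c'.IsCycle → c'.toSubgraph = c.toSubgraph) ∧
    B.IsOrientedWalk c ∧
    ∀ y ∈ B.verts, y ∉ c.support → ∃ x ∈ c.support, B.HasOrientedPath x y) ∧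
  ∀ x ∈ B.verts, D.weight x = 1 → B.deg x = 1

/-- A root oriented tree (ROT) with parent `v`. -/
def IsRootOrientedTree (T : D.Subgraph) (v : V) : Prop :=
  v ∈ T.verts ∧ T.graph.IsAcyclic ∧
  (∀ x ∈ T.verts, x ≠ v → T.HasOrientedPath v x) ∧
  ∀ x ∈ T.verts, D.weight x = 1 → (T.deg x = 1 ∧ x ≠ v) ∨ (T.verts = {v} ∧ x = v)

/-- The set `H̃` of a star-semi-forest `H` whose root oriented trees have the parents `p i`. -/
def tilde (H : D.Subgraph) {r : ℕ} (p : Fin r → V) : Set V :=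
  {x | x ∈ H.verts ∧ 2 ≤ H.deg x} ∪ {x | ∃ i, x = p i ∧ H.deg (p i) = 1}

/-- `H` is a `⋆`-semi-forest of `D`: the vertex-disjoint union of root oriented trees `T i` with
parents `p i` and unicycle oriented subgraphs `B j`, with vertices `w i` outside `H` adjacent to
the parents, and a partition `W₁`, `W₂` of the set of all `w i`. -/
def IsStarSemiForest (H : D.Subgraph) : Prop :=
  ∃ (r s : ℕ) (T : Fin r → D.Subgraph) (p : Fin r → V) (B : Fin s → D.Subgraph),
    (∀ i, (T i).IsRootOrientedTree (p i)) ∧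
    (∀ j, (B j).IsUnicycle) ∧
    H = iUnion (Sum.elim T B) ∧
    (∀ k l, k ≠ l → Disjoint (Sum.elim T B k).verts (Sum.elim T B l).verts) ∧
    ∃ w : Fin r → V,
      (∀ i, w i ∉ H.verts ∧ D.graph.Adj (w i) (p i)) ∧
      ∃ W₁ W₂ : Set V,
        W₁ ∪ W₂ = Set.range w ∧ Disjoint W₁ W₂ ∧
        D.graph.IsIndepSet W₁ ∧
        W₂ ⊆ D.vPlus ∧
        (∀ i, w i ∈ W₂ → D.arc (w i) (p i)) ∧
        D.outNbhdSet (W₂ ∪ H.tilde p) ∩ W₁ = ∅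

/-- `K` has a generating `⋆`-semi-forest. -/
def HasGeneratingStarSemiForest (K : D.Subgraph) : Prop :=
  ∃ H : D.Subgraph, H.IsStarSemiForest ∧ K.verts = H.verts

end Subgraph

/-- The weighted oriented subgraph of `D` induced by a set of vertices. -/
def induce (A : Set V) : D.Subgraph where
  verts := A
  arc x y := D.arc x y ∧ x ∈ A ∧ y ∈ A
  arc_sub := fun _ _ h => h.1
  fst_mem := fun _ _ h => h.2.1
  snd_mem := fun _ _ h => h.2.2

/-- The closed neighbourhood of a vertex. -/
def closedNbhd (x : V) : Set V := insert x (D.graph.neighborSet x)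

/-- A vertex is simplicial if its closed neighbourhood induces a complete graph. -/
def IsSimplicial (x : V) : Prop := D.graph.IsClique (D.closedNbhd x)

/-- The simplexes of `D` are the subgraphs induced by closed neighbourhoods of simplicial
vertices. -/
def IsSimplex (K : D.Subgraph) : Prop :=
  ∃ x, D.IsSimplicial x ∧ K = D.induce (D.closedNbhd x)

end WeightedOrientedGraph

/-- An ideal is unmixed if all its associated primes have the same height. -/
def IsUnmixedIdeal {R : Type u} [CommRing R] (I : Ideal R) : Prop :=
  ∀ P ∈ associatedPrimes R (R ⧸ I), ∀ Q ∈ associatedPrimes R (R ⧸ I), P.height = Q.height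

/-- The graph has no cycle of length `n`, induced or not. -/
def SimpleGraph.HasNoCycle {V : Type u} (G : SimpleGraph V) (n : ℕ) : Prop :=
  ∀ (x : V) (c : G.Walk x x), c.IsCycle → c.length ≠ n

/-- The graph `T₁₀`. The vertex `v` is `0`, the vertices `a₁, a₂, a₃` are `1, 2, 3`,
the vertices `b₁, b₂, b₃` are `4, 5, 6`, and the vertices `c₁, c₂, c₃` of the triangle
are `7, 8, 9`. -/
def graphT10 : SimpleGraph (Fin 10) :=
  SimpleGraph.fromEdgeSet
    {s(0, 1), s(0, 2), s(0, 3), s(1, 4), s(2, 5), s(3, 6), s(4, 7), s(5, 8), s(6, 9),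
      s(7, 8), s(8, 9), s(7, 9)}

/-! The associated primes of `I(D)` are the ideals generated by the strong covers of `D`: the vertex
covers `C` such that each vertex of `C` with all its neighbours in `C` has an in-neighbour in `V⁺`
with all its out-neighbours in `C` (`mem_associatedPrimes_edgeIdeal_iff`). The height of such a
prime is the size of the cover, so unmixedness says that all strong covers are equally large.
Complements of maximal stable sets are strong covers; hence this means that `G` is well-covered and
that no strong cover has a complement that fails to be maximal stable (`strongCovers_ncard_eq_iff`).

The shape of `G` is a theorem of Finbow, Hartnell and Nowakowski (`WellCovered.inSimplex_or_iso`).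
Its engine is an exchange: for an induced path `x - y - p`, no stable set away from `y` dominates
the neighbours of `x` and `p` outside `N[y]`, since `y` could then be traded for `x` and `p`.
Without 4- and 5-cycles, second neighbours chosen one by one hardly ever conflict, so the exchange
forces adjacencies (`exists_dominated`). The theorem follows by induction, deleting a closed
neighbourhood `N[v]`.

On `C₇` and `T₁₀`, a vertex of `V⁺` that is not a sink yields a strong cover containing some closed
neighbourhood `N[x]`, hence one with non-maximal complement. If instead the simplexes partition the
vertices, a stable set meets each of them at most once, so strong covers are equally large exactly
when none contains a simplex. Finally, a set lies in a strong cover exactly when it is the vertex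
set of a `⋆`-semi-forest (`hasGeneratingStarSemiForest_iff`): choosing for each vertex of the set a
witness that the cover is strong gives a functional graph, whose components are root oriented trees
and unicycles; conversely a semi-forest carries such witnesses. -/

namespace SimpleGraph

/-! ### Maximal stable sets and the exchange property of well-covered graphs -/

variable {V : Type u} (G : SimpleGraph V)

/-- `A` is a maximal stable set. -/
def IsMaxStable (A : Set V) : Prop :=
  (∀ a ∈ A, ∀ b ∈ A, ¬ G.Adj a b) ∧ ∀ x ∉ A, ∃ a ∈ A, G.Adj x a

/-- All maximal stable sets have the same cardinality. -/
def WellCovered : Prop :=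
  ∀ A B : Set V, G.IsMaxStable A → G.IsMaxStable B → A.ncard = B.ncard

/-- No cycle of length four, in terms of vertices. -/
def FourCycleFree : Prop :=
  ∀ a b c d, G.Adj a b → G.Adj b c → G.Adj c d → G.Adj d a → a ≠ c → b ≠ d → False

/-- No cycle of length five, in terms of vertices. -/
def FiveCycleFree : Prop :=
  ∀ a b c d e, G.Adj a b → G.Adj b c → G.Adj c d → G.Adj d e → G.Adj e a →
    a ≠ c → a ≠ d → b ≠ d → b ≠ e → c ≠ e → False

variable {G}

theorem HasNoCycle.fourCycleFree (h : G.HasNoCycle 4) : G.FourCycleFree := by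
  intro a b c d hab hbc hcd hda hac hbd
  refine h a (.cons hab (.cons hbc (.cons hcd (.cons hda .nil)))) ?_ rfl
  have := hab.ne; have := hbc.ne; have := hcd.ne; have := hda.ne
  simp only [Walk.isCycle_def, Walk.isTrail_def, Walk.edges_cons, Walk.edges_nil,
    Walk.support_cons, Walk.support_nil]
  simp
  grind

theorem HasNoCycle.fiveCycleFree (h : G.HasNoCycle 5) : G.FiveCycleFree := by
  intro a b c d e hab hbc hcd hde hea hac had hbd hbe hce
  refine h a (.cons hab (.cons hbc (.cons hcd (.cons hde (.cons hea .nil))))) ?_ rfl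
  have := hab.ne; have := hbc.ne; have := hcd.ne; have := hde.ne; have := hea.ne
  simp only [Walk.isCycle_def, Walk.isTrail_def, Walk.edges_cons, Walk.edges_nil,
    Walk.support_cons, Walk.support_nil]
  simp
  grind

/-- Maximality is relative to `U` because some strong covers are complements of stable sets that
must avoid prescribed out-neighbourhoods. -/
theorem exists_maximal_stable_within [Finite V] (G : SimpleGraph V) {A U : Set V} (hAU : A ⊆ U)
    (hA : ∀ a ∈ A, ∀ b ∈ A, ¬ G.Adj a b) :
    ∃ B, A ⊆ B ∧ B ⊆ U ∧ (∀ a ∈ B, ∀ b ∈ B, ¬ G.Adj a b) ∧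
      ∀ x ∈ U, x ∉ B → ∃ b ∈ B, G.Adj x b := by
  obtain ⟨B, hB⟩ := Set.Finite.exists_maximal
    (s := {B : Set V | A ⊆ B ∧ B ⊆ U ∧ ∀ a ∈ B, ∀ b ∈ B, ¬ G.Adj a b}) (Set.toFinite _)
    ⟨A, subset_rfl, hAU, hA⟩
  refine ⟨B, hB.prop.1, hB.prop.2.1, hB.prop.2.2, fun x hxU hxB => ?_⟩
  by_contra! hx
  have hle : insert x B ⊆ B := by
    refine hB.le_of_ge ⟨hB.prop.1.trans (Set.subset_insert _ _),
      Set.insert_subset hxU hB.prop.2.1, ?_⟩ (Set.subset_insert _ _)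
    rintro a (rfl | ha) b (rfl | hb)
    · exact G.irrefl
    · exact hx b hb
    · exact fun h => hx a ha h.symm
    · exact hB.prop.2.2 a ha b hb
  exact hxB (hle (Set.mem_insert _ _))

theorem exists_isMaxStable_superset [Finite V] {A : Set V}
    (hA : ∀ a ∈ A, ∀ b ∈ A, ¬ G.Adj a b) : ∃ B, A ⊆ B ∧ G.IsMaxStable B := by
  obtain ⟨B, hAB, -, hB, hB'⟩ := G.exists_maximal_stable_within (Set.subset_univ A) hA
  exact ⟨B, hAB, hB, fun x hx => hB' x (Set.mem_univ x) hx⟩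

theorem WellCovered.ncard_le [Finite V] (hG : G.WellCovered) {A B : Set V}
    (hA : ∀ a ∈ A, ∀ b ∈ A, ¬ G.Adj a b) (hB : G.IsMaxStable B) : A.ncard ≤ B.ncard := by
  obtain ⟨M, hAM, hM⟩ := exists_isMaxStable_superset hA
  rw [← hG M B hM hB]
  exact Set.ncard_le_ncard hAM (Set.toFinite _)

/-- In a well-covered graph one cannot exchange a vertex of a maximal stable set for two. -/
theorem WellCovered.no_exchange [Finite V] (hG : G.WellCovered) {M : Set V} (hM : G.IsMaxStable M)
    {x y p : V} (hy : y ∈ M) (hx : x ∉ M) (hp : p ∉ M) (hxp : x ≠ p) (hnxp : ¬ G.Adj x p)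
    (hMx : ∀ m ∈ M, m ≠ y → ¬ G.Adj m x) (hMp : ∀ m ∈ M, m ≠ y → ¬ G.Adj m p) : False := by
  have hind : ∀ a ∈ insert x (insert p (M \ {y})), ∀ b ∈ insert x (insert p (M \ {y})),
      ¬ G.Adj a b := by
    have h1 := hM.1
    intro a ha b hb
    simp only [Set.mem_insert_iff, Set.mem_sdiff, Set.mem_singleton_iff] at ha hb
    have := G.irrefl (v := a)
    have := G.adj_comm a b
    have := G.adj_comm x p
    grind
  have := hG.ncard_le hind hM
  rw [Set.ncard_insert_of_notMem (by simp [hxp, hx]) (Set.toFinite _),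
    Set.ncard_insert_of_notMem (by simp [hp]) (Set.toFinite _),
    Set.ncard_sdiff_singleton_of_mem hy] at this
  have := (Set.ncard_pos (Set.toFinite M)).2 ⟨y, hy⟩
  omega

/-- For an induced path `x - y - p` in a well-covered graph, no stable set outside the
neighbourhood of `y` dominates the neighbours of `x` and of `p` outside the closed neighbourhood
of `y`. -/
theorem WellCovered.no_dominating [Finite V] (hG : G.WellCovered) {x y p : V} (hxy : G.Adj x y)
    (hyp : G.Adj y p) (hxp : x ≠ p) (hnxp : ¬ G.Adj x p) {J : Set V}
    (hJ : ∀ a ∈ J, ∀ b ∈ J, ¬ G.Adj a b) (hJy : ∀ j ∈ J, ¬ G.Adj y j)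
    (hx : ∀ z, G.Adj x z → z ≠ y → ¬ G.Adj y z → ∃ j ∈ J, G.Adj z j)
    (hp : ∀ z, G.Adj p z → z ≠ y → ¬ G.Adj y z → ∃ j ∈ J, G.Adj z j) : False := by
  obtain ⟨M, hJM, hM⟩ := exists_isMaxStable_superset (G := G) (A := insert y J) (by
    rintro a (rfl | ha) b (rfl | hb)
    · exact G.irrefl
    · exact hJy b hb
    · exact fun h => hJy a ha h.symm
    · exact hJ a ha b hb)
  have hy : y ∈ M := hJM (Set.mem_insert _ _)
  have hJM' : ∀ j ∈ J, j ∈ M := fun j hj => hJM (Set.mem_insert_of_mem _ hj)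
  refine hG.no_exchange hM hy (fun h => hM.1 _ h _ hy hxy) (fun h => hM.1 _ hy _ h hyp) hxp hnxp
    (fun m hm hmy hmx => ?_) (fun m hm hmy hmp => ?_)
  · obtain ⟨j, hj, h⟩ := hx m hmx.symm hmy (hM.1 _ hy _ hm)
    exact hM.1 _ hm _ (hJM' j hj) h
  · obtain ⟨j, hj, h⟩ := hp m hmp.symm hmy (hM.1 _ hy _ hm)
    exact hM.1 _ hm _ (hJM' j hj) h

end SimpleGraph

/-! ### Primes generated by variables, and associated primes of monomial ideals -/

namespace MvPolynomial

variable {σ : Type u} {K : Type v} [Field K]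

theorem sub_mem_span_X_image (C : Set σ) [DecidablePred (· ∈ C)] (p : MvPolynomial σ K) :
    p - aeval (fun i => if i ∈ C then (0 : MvPolynomial σ K) else X i) p ∈
      Ideal.span (X '' C : Set (MvPolynomial σ K)) := by
  induction p using MvPolynomial.induction_on with
  | C a => simp
  | add p q hp hq =>
    rw [map_add, add_sub_add_comm]
    exact Ideal.add_mem _ hp hq
  | mul_X p i hp =>
    rw [map_mul, aeval_X]
    split_ifs with hi
    · rw [mul_zero, sub_zero]
      exact Ideal.mul_mem_left _ _ (Ideal.subset_span ⟨i, hi, rfl⟩)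
    · rw [← sub_mul]
      exact Ideal.mul_mem_right _ _ hp

/-- It is the kernel of the substitution that kills the variables in `C`. -/
theorem isPrime_span_X_image (C : Set σ) :
    (Ideal.span (X '' C : Set (MvPolynomial σ K))).IsPrime := by
  classical
  let φ := aeval (R := K) (fun i => if i ∈ C then (0 : MvPolynomial σ K) else X i)
  have hker : Ideal.span (X '' C : Set (MvPolynomial σ K)) = RingHom.ker φ.toRingHom := by
    refine le_antisymm (Ideal.span_le.2 ?_) fun p hp => ?_
    · rintro _ ⟨i, hi, rfl⟩
      simp [φ, hi, RingHom.mem_ker]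
    · have h := sub_mem_span_X_image (K := K) C p
      have hp' : φ p = 0 := hp
      rwa [show aeval (fun i => if i ∈ C then (0 : MvPolynomial σ K) else X i) p = 0 from hp',
        sub_zero] at h
  rw [hker]
  exact RingHom.ker_isPrime _

theorem X_mem_span_X_image {C : Set σ} {i : σ} :
    (X i : MvPolynomial σ K) ∈ Ideal.span (X '' C : Set (MvPolynomial σ K)) ↔ i ∈ C := by
  rw [mem_ideal_span_X_image]
  refine ⟨fun h => ?_, fun h m hm => ⟨i, h, ?_⟩⟩
  · obtain ⟨j, hj, hne⟩ := h (Finsupp.single i 1) (by simp)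
    by_cases hij : i = j
    · exact hij ▸ hj
    · simp [hij] at hne
  · rw [support_X, Finset.mem_singleton] at hm
    simp [hm]

/-- Dropping variables one at a time gives a chain of primes, hence the lower bound; the upper bound
is Krull's height theorem. -/
theorem height_span_X_image [Finite σ] (C : Set σ) :
    (Ideal.span (X '' C : Set (MvPolynomial σ K))).height = C.ncard := by
  have hlow : ∀ C : Set σ, ∀ n : ℕ, C.ncard = n →
      (n : ℕ∞) ≤ (Ideal.span (X '' C : Set (MvPolynomial σ K))).height := by
    intro C n
    induction n generalizing C with
    | zero => simp
    | succ n ih =>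
      intro hC
      obtain ⟨i, hi⟩ : C.Nonempty := by
        rw [← Set.ncard_pos (Set.toFinite C)]; omega
      have hn : (C \ {i}).ncard = n := by
        rw [Set.ncard_sdiff_singleton_of_mem hi, hC]; rfl
      have := isPrime_span_X_image (K := K) C
      have := isPrime_span_X_image (K := K) (C \ {i})
      have hlt : Ideal.span (X '' (C \ {i}) : Set (MvPolynomial σ K)) < Ideal.span (X '' C) := by
        refine lt_of_le_of_ne (Ideal.span_mono (Set.image_mono Set.sdiff_subset)) fun h => ?_
        have := (X_mem_span_X_image (K := K) (C := C \ {i})).1 (h ▸ X_mem_span_X_image.2 hi)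
        simp at this
      push_cast
      exact (add_le_add_left (ih _ hn) 1).trans (Ideal.height_add_one_le_of_lt_of_isPrime hlt)
  refine le_antisymm ?_ (hlow C _ rfl)
  refine (Ideal.height_le_spanFinrank _ (isPrime_span_X_image C).ne_top).trans ?_
  exact_mod_cast (Submodule.spanFinrank_span_le_ncard_of_finite (Set.toFinite _)).trans
    (Set.ncard_image_le (Set.toFinite _))

theorem card_support_monomial_mul_le (d : σ →₀ ℕ) (p : MvPolynomial σ K) :
    (monomial d 1 * p).support.card ≤ p.support.card := by
  classical
  refine (Finset.card_le_card (support_mul _ _)).trans ?_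
  refine (Finset.card_le_card (Finset.add_subset_add_right support_monomial_subset)).trans ?_
  rw [Finset.singleton_add]
  exact Finset.card_image_le

theorem monomial_one_mem_iff_of_isPrime {P : Ideal (MvPolynomial σ K)} (hP : P.IsPrime)
    (m : σ →₀ ℕ) : monomial m (1 : K) ∈ P ↔ ∃ i, m i ≠ 0 ∧ X i ∈ P := by
  rw [monomial_eq, C_1, one_mul, Finsupp.prod, hP.prod_mem_iff]
  constructor
  · rintro ⟨i, hi, h⟩
    exact ⟨i, Finsupp.mem_support_iff.1 hi, hP.mem_of_pow_mem _ h⟩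
  · rintro ⟨i, hi, h⟩
    exact ⟨i, Finsupp.mem_support_iff.2 hi, Ideal.pow_mem_of_mem _ h _ (Nat.pos_of_ne_zero hi)⟩

/-- A prime ideal which is the annihilator of a polynomial modulo a monomial ideal is generated by
variables and is the annihilator of a monomial. -/
theorem exists_eq_span_X_image_of_colon [Finite σ] {I : Ideal (MvPolynomial σ K)}
    {S : Set (σ →₀ ℕ)} (hI : ∀ f, f ∈ I ↔ ∀ m ∈ f.support, m ∈ S)
    {P : Ideal (MvPolynomial σ K)} (hP : P.IsPrime) (hPf : ∃ f, ∀ g, g ∈ P ↔ g * f ∈ I) :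
    ∃ (C : Set σ) (a : σ →₀ ℕ), P = Ideal.span (X '' C) ∧
      ∀ m : σ →₀ ℕ, (∃ i ∈ C, m i ≠ 0) ↔ m + a ∈ S := by
  classical
  have hup : ∀ m ∈ S, ∀ n, n + m ∈ S := by
    intro m hm n
    have h1 : monomial m (1 : K) ∈ I := (hI _).2 (by simpa using hm)
    have h2 := (hI _).1 (I.mul_mem_left (monomial n 1) h1)
    rw [monomial_mul] at h2
    exact h2 _ (by simp)
  -- Among all polynomials with colon ideal `P`, one with the fewest terms is taken.
  obtain ⟨f, hf, hmin⟩ : ∃ f, (∀ g, g ∈ P ↔ g * f ∈ I) ∧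
      ∀ f', (∀ g, g ∈ P ↔ g * f' ∈ I) → f.support.card ≤ f'.support.card := by
    obtain ⟨f, hf, hf'⟩ := exists_minimalFor_of_wellFoundedLT
      (fun f => ∀ g, g ∈ P ↔ g * f ∈ I) (fun f : MvPolynomial σ K => f.support.card) hPf
    exact ⟨f, hf, fun f' h => (le_total _ _).elim id (hf' h)⟩
  have hf0 : f ≠ 0 := by
    rintro rfl
    exact hP.ne_top ((Ideal.eq_top_iff_one _).2 ((hf 1).2 (by simp)))
  -- Any linear order on the variables will do; it only serves to define leading terms.
  let _ : LinearOrder σ := linearOrderOfSTO (WellOrderingRel (α := σ))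
  let mo : MonomialOrder σ := MonomialOrder.lex
  have hlead : ∀ g ∈ P, g ≠ 0 → monomial (mo.degree g) (1 : K) ∈ P := by
    intro g hg hg0
    by_contra hnot
    have hS : mo.degree g + mo.degree f ∈ S := by
      refine (hI _).1 ((hf g).1 hg) _ ?_
      rw [mem_support_iff, MonomialOrder.coeff_mul_of_degree_add]
      exact mul_ne_zero (mo.leadingCoeff_ne_zero_iff.2 hg0) (mo.leadingCoeff_ne_zero_iff.2 hf0)
    have hI' : monomial (mo.degree g) (1 : K) * mo.leadingTerm f ∈ I := by
      rw [MonomialOrder.leadingTerm, monomial_mul, hI]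
      intro m hm
      rw [Finset.mem_singleton.1 (support_monomial_subset hm)]
      exact hS
    -- The monomial lies outside the prime `P` and sends the leading term of `f` into `I`. Hence
    -- this product has the same colon ideal as `f`, with fewer terms.
    have hle := hmin (monomial (mo.degree g) 1 * (f - mo.leadingTerm f)) fun h => by
      have : h * (monomial (mo.degree g) 1 * (f - mo.leadingTerm f)) =
          (h * monomial (mo.degree g) 1) * f -
            h * (monomial (mo.degree g) 1 * mo.leadingTerm f) := by ring
      rw [this, Submodule.sub_mem_iff_left _ (I.mul_mem_left h hI'), ← hf]
      exact ⟨fun hh => P.mul_mem_right _ hh, fun hh => (hP.mem_or_mem hh).resolve_right hnot⟩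
    have h2 := hle.trans (card_support_monomial_mul_le _ _)
    have h3 : (f - mo.leadingTerm f).support ⊆ f.support.erase (mo.degree f) := by
      intro m hm
      rw [mem_support_iff, coeff_sub, MonomialOrder.leadingTerm, coeff_monomial] at hm
      rw [Finset.mem_erase, mem_support_iff]
      split_ifs at hm with hmd
      · subst hmd
        exact absurd (sub_self _) hm
      · exact ⟨Ne.symm hmd, by simpa using hm⟩
    have h4 := Finset.card_le_card h3
    rw [Finset.card_erase_of_mem (mo.degree_mem_support hf0)] at h4
    have := Finset.card_pos.2 ⟨_, mo.degree_mem_support hf0⟩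
    omega
  have hmono : ∀ n, ∀ g ∈ P, g.support.card = n → ∀ m ∈ g.support, monomial m (1 : K) ∈ P := by
    intro n
    induction n with
    | zero =>
      intro g _ hn m hm
      rw [Finset.card_eq_zero] at hn
      simp [hn] at hm
    | succ n ih =>
      intro g hg hn m hm
      have hg0 : g ≠ 0 := by rintro rfl; simp at hn
      have hl := hlead g hg hg0
      by_cases hmd : m = mo.degree g
      · exact hmd ▸ hl
      have hlt : mo.leadingTerm g ∈ P := by
        have : mo.leadingTerm g = C (mo.leadingCoeff g) * monomial (mo.degree g) 1 := by
          rw [C_mul_monomial, mul_one]; rfl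
        rw [this]
        exact P.mul_mem_left _ hl
      have hs : (g - mo.leadingTerm g).support = g.support.erase (mo.degree g) := by
        ext k
        rw [mem_support_iff, coeff_sub, MonomialOrder.leadingTerm, coeff_monomial,
          Finset.mem_erase, mem_support_iff]
        split_ifs with hk
        · subst hk
          simp [MonomialOrder.leadingCoeff]
        · simp [Ne.symm hk]
      refine ih _ (P.sub_mem hg hlt) ?_ m ?_
      · rw [hs, Finset.card_erase_of_mem (mo.degree_mem_support hg0), hn]; rfl
      · rw [hs]
        exact Finset.mem_erase.2 ⟨hmd, hm⟩
  have hPC : P = Ideal.span (X '' {i | (X i : MvPolynomial σ K) ∈ P}) := by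
    refine le_antisymm (fun g hg => mem_ideal_span_X_image.2 fun m hm => ?_) (Ideal.span_le.2 ?_)
    · obtain ⟨i, hi, h⟩ := (monomial_one_mem_iff_of_isPrime hP m).1 (hmono _ g hg rfl m hm)
      exact ⟨i, h, hi⟩
    · rintro _ ⟨i, hi, rfl⟩
      exact hi
  -- Otherwise each term of `f` is sent into `I` by some monomial outside `P`. The product of these
  -- monomials sends all of `f` into `I`, yet lies outside the prime `P`.
  obtain ⟨a, ha⟩ : ∃ a ∈ f.support, ∀ m, m + a ∈ S → monomial m (1 : K) ∈ P := by
    by_contra! hcon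
    choose! b hb using hcon
    have hprod : ∏ a ∈ f.support, monomial (b a) (1 : K) ∉ P := by
      rw [hP.prod_mem_iff]
      rintro ⟨a, ha, h⟩
      exact (hb a ha).2 h
    refine hprod ((hf _).2 ((hI _).2 fun m hm => ?_))
    obtain ⟨c, hc, a, ha, rfl⟩ := Finset.mem_add.1 (support_mul _ _ hm)
    rw [← monomial_sum_one] at hc
    rw [Finset.mem_singleton.1 (support_monomial_subset hc),
      ← Finset.sum_erase_add _ _ ha, add_assoc]
    exact hup _ (hb a ha).1 _
  refine ⟨_, a, hPC, fun m => ?_⟩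
  have := monomial_one_mem_iff_of_isPrime hP m
  constructor
  · rintro ⟨i, hi, hm⟩
    refine (hI _).1 ((hf _).1 (this.2 ⟨i, hm, hi⟩)) _ ?_
    rw [mem_support_iff, coeff_monomial_mul, one_mul]
    exact mem_support_iff.1 ha.1
  · intro h
    obtain ⟨i, hi, h⟩ := this.1 (ha.2 m h)
    exact ⟨i, h, hi⟩

end MvPolynomial

/-! ### Associated primes of the edge ideal as strong covers -/

namespace WeightedOrientedGraph

variable {V : Type u} (D : WeightedOrientedGraph V)

/-- A strong vertex cover: a vertex cover `C` such that every vertex of `C` all of whose neighbours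
lie in `C` has an in-neighbour of weight greater than one with all its out-neighbours in `C`. -/
def IsStrongCover (C : Set V) : Prop :=
  (∀ x y, D.arc x y → x ∈ C ∨ y ∈ C) ∧
    ∀ x ∈ C, (∀ y, D.graph.Adj x y → y ∈ C) →
      ∃ y, D.arc y x ∧ y ∈ D.vPlus ∧ ∀ z, D.arc y z → z ∈ C

/-- The exponents of the monomials in the edge ideal. -/
def edgeExponents : Set (V →₀ ℕ) := {m | ∃ x y, D.arc x y ∧ 1 ≤ m x ∧ D.weight y ≤ m y}

variable {D}

theorem adj_of_arc {x y : V} (h : D.arc x y) : D.graph.Adj x y := (D.adj_iff x y).2 (Or.inl h)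

theorem adj_of_arc' {x y : V} (h : D.arc x y) : D.graph.Adj y x := (adj_of_arc h).symm

theorem ne_of_arc {x y : V} (h : D.arc x y) : x ≠ y := (adj_of_arc h).ne

open MvPolynomial in
theorem mem_edgeIdeal_iff (K : Type v) [Field K] (f : MvPolynomial V K) :
    f ∈ D.edgeIdeal K ↔ ∀ m ∈ f.support, m ∈ D.edgeExponents := by
  classical
  have h : D.edgeIdeal K = Ideal.span ((fun s => monomial s (1 : K)) ''
      {m | ∃ x y, D.arc x y ∧ m = Finsupp.single x 1 + Finsupp.single y (D.weight y)}) := by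
    rw [edgeIdeal]
    congr 1
    ext f
    constructor
    · rintro ⟨x, y, hxy, rfl⟩
      exact ⟨_, ⟨x, y, hxy, rfl⟩, by simp [X, monomial_pow, monomial_mul]⟩
    · rintro ⟨_, ⟨x, y, hxy, rfl⟩, rfl⟩
      exact ⟨x, y, hxy, by simp [X, monomial_pow, monomial_mul]⟩
  rw [h, mem_ideal_span_monomial_image]
  refine forall₂_congr fun m _ => ⟨?_, ?_⟩
  · rintro ⟨_, ⟨x, y, hxy, rfl⟩, hle⟩
    have h1 := hle x
    have h2 := hle y
    have := ne_of_arc hxy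
    simp [this, this.symm] at h1 h2
    exact ⟨x, y, hxy, h1, h2⟩
  · rintro ⟨x, y, hxy, h1, h2⟩
    refine ⟨_, ⟨x, y, hxy, rfl⟩, fun z => ?_⟩
    have := ne_of_arc hxy
    by_cases hzx : z = x
    · subst hzx
      simpa [Finsupp.single_apply, this, this.symm] using h1
    · by_cases hzy : z = y
      · subst hzy
        simpa [Finsupp.single_apply, this, this.symm] using h2
      · simp [Ne.symm hzx, Ne.symm hzy]

/-- Variables outside `C` may be multiplied in freely without entering the ideal, so a vertex with
positive exponent has all its out-neighbours in `C`. Vertices of `C` have exponents below their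
weights. If `x` and its neighbours lie in `C`, the generator reached on multiplying by `x` must
therefore come from an arc into `x`, and its tail is the in-neighbour sought. -/
theorem isStrongCover_of_exponent {C : Set V} {a : V →₀ ℕ}
    (h : ∀ m : V →₀ ℕ, (∃ i ∈ C, m i ≠ 0) ↔ m + a ∈ D.edgeExponents) : D.IsStrongCover C := by
  classical
  have ha : a ∉ D.edgeExponents := by
    have := (h 0).not
    simpa using this
  have hout : ∀ x y, D.arc x y → x ∉ C → y ∉ C → False := by
    intro x y hxy hx hy
    obtain ⟨i, hi, hne⟩ := (h (Finsupp.single x 1 + Finsupp.single y (D.weight y))).2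
      ⟨x, y, hxy, by simp; omega, by simp; omega⟩
    have h1 : x ≠ i := fun h => hx (h ▸ hi)
    have h2 : y ≠ i := fun h => hy (h ▸ hi)
    simp [h1, h2] at hne
  have hL1 : ∀ x y, D.arc x y → y ∉ C → a x = 0 := by
    intro x y hxy hy
    by_contra hax
    obtain ⟨i, hi, hne⟩ := (h (Finsupp.single y (D.weight y))).2
      ⟨x, y, hxy, by simp; omega, by simp⟩
    have h2 : y ≠ i := fun h => hy (h ▸ hi)
    simp [h2] at hne
  have hsat : ∀ x ∈ C, ¬ D.weight x ≤ a x := by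
    intro x hx hle
    obtain ⟨y, z, hyz, h1, h2⟩ := (h (Finsupp.single x 1)).1 ⟨x, hx, by simp⟩
    have := D.weight_pos x
    refine ha ⟨y, z, hyz, ?_, ?_⟩
    · by_cases hxy : x = y
      · subst hxy; omega
      · simpa [hxy] using h1
    · by_cases hxz : x = z
      · subst hxz; omega
      · simpa [hxz] using h2
  refine ⟨fun x y hxy => ?_, fun x hx hN => ?_⟩
  · by_contra! hcon
    exact hout x y hxy hcon.1 hcon.2
  · obtain ⟨y, z, hyz, h1, h2⟩ := (h (Finsupp.single x 1)).1 ⟨x, hx, by simp⟩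
    have hne := ne_of_arc hyz
    by_cases hxy : x = y
    · subst hxy
      have hz : z ∈ C := hN z (adj_of_arc hyz)
      have : D.weight z ≤ a z := by simpa [hne] using h2
      exact absurd this (hsat z hz)
    · by_cases hxz : x = z
      · subst hxz
        have hy : y ∈ C := hN y (adj_of_arc' hyz)
        have hay : 1 ≤ a y := by simpa [hxy] using h1
        have := hsat y hy
        refine ⟨y, hyz, ?_, fun t ht => ?_⟩
        · show 1 < D.weight y
          omega
        · by_contra htC
          have := hL1 y t ht htC
          omega
      · exact absurd ⟨y, z, hyz, by simpa [hxy] using h1, by simpa [hxz] using h2⟩ ha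

theorem IsStrongCover.exists_exponent [Finite V] {C : Set V} (hC : D.IsStrongCover C) :
    ∃ a : V →₀ ℕ, ∀ m : V →₀ ℕ, (∃ i ∈ C, m i ≠ 0) ↔ m + a ∈ D.edgeExponents := by
  classical
  -- Off `C` the full weight is used, so a vertex of `C` with an out-neighbour off `C` must get
  -- exponent zero. The other vertices of `C` stop one short of their weights.
  let a : V →₀ ℕ := Finsupp.equivFunOnFinite.symm fun x =>
    if x ∉ C then D.weight x else if ∃ y, D.arc x y ∧ y ∉ C then 0 else D.weight x - 1
  have ha : ∀ x, a x =
    if x ∉ C then D.weight x else if ∃ y, D.arc x y ∧ y ∉ C then 0 else D.weight x - 1 :=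
    fun x => rfl
  refine ⟨a, fun m => ⟨?_, ?_⟩⟩
  · rintro ⟨x, hx, hm⟩
    by_cases h1 : ∃ y, D.arc x y ∧ y ∉ C
    · obtain ⟨y, hxy, hy⟩ := h1
      refine ⟨x, y, hxy, ?_, ?_⟩
      · rw [Finsupp.add_apply]; omega
      · rw [Finsupp.add_apply, ha y, if_pos hy]; omega
    · have hax : a x = D.weight x - 1 := by rw [ha, if_neg (by simpa using hx), if_neg h1]
      obtain ⟨y, hyx, hay⟩ : ∃ y, D.arc y x ∧ 1 ≤ a y := by
        by_cases h2 : ∃ y, D.arc y x ∧ y ∉ C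
        · obtain ⟨y, hyx, hy⟩ := h2
          have := D.weight_pos y
          exact ⟨y, hyx, by rw [ha, if_pos hy]; omega⟩
        · have hN : ∀ y, D.graph.Adj x y → y ∈ C := by
            intro y hxy
            by_contra hy
            rcases (D.adj_iff x y).1 hxy with h | h
            · exact h1 ⟨y, h, hy⟩
            · exact h2 ⟨y, h, hy⟩
          obtain ⟨y, hyx, hw, hy⟩ := hC.2 x hx hN
          have hw' : 1 < D.weight y := hw
          refine ⟨y, hyx, ?_⟩
          rw [ha, if_neg (by simpa using hN y (adj_of_arc' hyx)), if_neg]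
          · omega
          · rintro ⟨z, hz, hzC⟩
            exact hzC (hy z hz)
      refine ⟨y, x, hyx, ?_, ?_⟩
      · rw [Finsupp.add_apply]; omega
      · rw [Finsupp.add_apply, hax]; omega
  · rintro ⟨x, y, hxy, h1, h2⟩
    by_contra! hm
    rw [Finsupp.add_apply] at h1 h2
    have hwy := D.weight_pos y
    have hy : y ∉ C := by
      intro hy
      rw [hm y hy, ha y, if_neg (by simpa using hy)] at h2
      split_ifs at h2 <;> omega
    have hx : x ∈ C := (hC.1 x y hxy).resolve_right hy
    rw [hm x hx, ha x, if_neg (by simpa using hx), if_pos ⟨y, hxy, hy⟩] at h1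
    omega

open MvPolynomial in
theorem mem_associatedPrimes_edgeIdeal_iff [Finite V] (K : Type v) [Field K]
    (P : Ideal (MvPolynomial V K)) :
    P ∈ associatedPrimes (MvPolynomial V K) (MvPolynomial V K ⧸ D.edgeIdeal K) ↔
      ∃ C, D.IsStrongCover C ∧ P = Ideal.span (X '' C) := by
  rw [AssociatedPrimes.mem_iff, isAssociatedPrime_iff]
  have hcolon : ∀ f g : MvPolynomial V K,
      g ∈ (⊥ : Submodule (MvPolynomial V K) (MvPolynomial V K ⧸ D.edgeIdeal K)).colon
        {Ideal.Quotient.mk _ f} ↔ g * f ∈ D.edgeIdeal K := by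
    intro f g
    rw [Submodule.mem_colon_singleton, Submodule.mem_bot, ← Ideal.Quotient.eq_zero_iff_mem]
    rfl
  constructor
  · rintro ⟨hP, x, hx⟩
    obtain ⟨f, rfl⟩ := Ideal.Quotient.mk_surjective x
    obtain ⟨C, a, hPC, ha⟩ := exists_eq_span_X_image_of_colon (mem_edgeIdeal_iff K) hP
      ⟨f, fun g => by rw [hx]; exact hcolon f g⟩
    exact ⟨C, isStrongCover_of_exponent ha, hPC⟩
  · rintro ⟨C, hC, rfl⟩
    obtain ⟨a, ha⟩ := hC.exists_exponent
    refine ⟨isPrime_span_X_image C, Ideal.Quotient.mk _ (monomial a 1), ?_⟩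
    ext g
    rw [hcolon, mem_ideal_span_X_image, mem_edgeIdeal_iff]
    constructor
    · intro h m hm
      obtain ⟨c, hc, rfl⟩ : ∃ c ∈ g.support, c + a = m := by
        rw [mem_support_iff, coeff_mul_monomial', mul_one] at hm
        split_ifs at hm with hle
        · exact ⟨m - a, mem_support_iff.2 hm, tsub_add_cancel_of_le hle⟩
        · exact absurd rfl hm
      exact (ha c).1 (h c hc)
    · intro h m hm
      refine (ha m).2 (h _ ?_)
      rw [mem_support_iff, coeff_mul_monomial, mul_one]
      exact mem_support_iff.1 hm

theorem isUnmixedIdeal_edgeIdeal_iff [Finite V] (K : Type v) [Field K] :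
    IsUnmixedIdeal (D.edgeIdeal K) ↔
      ∀ C C', D.IsStrongCover C → D.IsStrongCover C' → C.ncard = C'.ncard := by
  have hh := MvPolynomial.height_span_X_image (σ := V) (K := K)
  constructor
  · intro h C C' hC hC'
    have := h _ ((mem_associatedPrimes_edgeIdeal_iff K _).2 ⟨C, hC, rfl⟩) _
      ((mem_associatedPrimes_edgeIdeal_iff K _).2 ⟨C', hC', rfl⟩)
    rw [hh, hh] at this
    exact_mod_cast this
  · intro h P hP Q hQ
    obtain ⟨C, hC, rfl⟩ := (mem_associatedPrimes_edgeIdeal_iff K _).1 hP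
    obtain ⟨C', hC', rfl⟩ := (mem_associatedPrimes_edgeIdeal_iff K _).1 hQ
    rw [hh, hh, h C C' hC hC']

end WeightedOrientedGraph

/-! ### Forced vertices at the end of an induced path -/

namespace SimpleGraph

variable {V : Type u} {G : SimpleGraph V}

/-- Every neighbour of a vertex `x` has a neighbour outside the closed neighbourhood of `x`. -/
def HasOuterNeighbors (G : SimpleGraph V) : Prop :=
  ∀ x y, G.Adj x y → ∃ z, G.Adj y z ∧ z ≠ x ∧ ¬ G.Adj x z

/-- Otherwise every `q` that misses all chosen `s z` has an outer neighbour `r q` missing them too.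
All these `s z` and `r q` form a stable set away from `y`, because a further adjacency would close a
4- or 5-cycle; this contradicts `no_dominating`. -/
theorem WellCovered.exists_dominated [Finite V] (hG : G.WellCovered) (h4 : G.FourCycleFree)
    (h5 : G.FiveCycleFree) {x y p : V} (hxy : G.Adj x y) (hyp : G.Adj y p) (hxp : x ≠ p)
    (hnxp : ¬ G.Adj x p) (s : V → V)
    (hs : ∀ z, G.Adj x z → z ≠ y → ¬ G.Adj y z → G.Adj z (s z) ∧ s z ≠ x ∧ ¬ G.Adj x (s z)) :
    ∃ q, G.Adj p q ∧ q ≠ y ∧ ¬ G.Adj y q ∧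
      (∀ z, G.Adj x z → z ≠ y → ¬ G.Adj y z → ¬ G.Adj q (s z)) ∧
      ∀ r, G.Adj q r → r ≠ p → ¬ G.Adj p r →
        ∃ z, G.Adj x z ∧ z ≠ y ∧ ¬ G.Adj y z ∧ G.Adj r (s z) := by
  by_contra! hcon
  have hc : ∀ q, G.Adj p q → q ≠ y → ¬ G.Adj y q →
      (∀ z, G.Adj x z → z ≠ y → ¬ G.Adj y z → ¬ G.Adj q (s z)) → ∃ r, G.Adj q r ∧ r ≠ p ∧
        ¬ G.Adj p r ∧ ∀ z, G.Adj x z → z ≠ y → ¬ G.Adj y z → ¬ G.Adj r (s z) := hcon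
  choose! r hr using hc
  have hsym : ∀ a b, G.Adj a b → G.Adj b a := fun a b h => h.symm
  have hne : ∀ a b, G.Adj a b → a ≠ b := fun a b h => h.ne
  let Z : Set V := {z | G.Adj x z ∧ z ≠ y ∧ ¬ G.Adj y z}
  let Q : Set V := {q | G.Adj p q ∧ q ≠ y ∧ ¬ G.Adj y q ∧
    ∀ z, G.Adj x z → z ≠ y → ¬ G.Adj y z → ¬ G.Adj q (s z)}
  refine hG.no_dominating hxy hyp hxp hnxp (J := s '' Z ∪ r '' Q) ?_ ?_ ?_ ?_
  · rintro _ (⟨z, ⟨hz1, hz2, hz3⟩, rfl⟩ | ⟨q, ⟨hq1, hq2, hq3, hq4⟩, rfl⟩) _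
      (⟨z', ⟨hz1', hz2', hz3'⟩, rfl⟩ | ⟨q', ⟨hq1', hq2', hq3', hq4'⟩, rfl⟩) hadj
    · by_cases h : z = z'
      · subst h; exact G.irrefl hadj
      · have := hs z hz1 hz2 hz3
        have := hs z' hz1' hz2' hz3'
        by_cases h1 : s z = z'
        · grind
        · by_cases h2 : s z' = z
          · grind
          · exact h5 x z (s z) (s z') z' hz1 (by grind) hadj (by grind) (by grind) (by grind)
              (by grind) (by grind) h (by grind)
    · exact (hr q' hq1' hq2' hq3' hq4').2.2.2 z hz1 hz2 hz3 hadj.symm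
    · exact (hr q hq1 hq2 hq3 hq4).2.2.2 z' hz1' hz2' hz3' hadj
    · by_cases h : q = q'
      · subst h; exact G.irrefl hadj
      · have := hr q hq1 hq2 hq3 hq4
        have := hr q' hq1' hq2' hq3' hq4'
        by_cases h1 : r q = q'
        · grind
        · by_cases h2 : r q' = q
          · grind
          · exact h5 p q (r q) (r q') q' hq1 (by grind) hadj (by grind) (by grind) (by grind)
              (by grind) (by grind) h (by grind)
  · rintro _ (⟨z, ⟨hz1, hz2, hz3⟩, rfl⟩ | ⟨q, ⟨hq1, hq2, hq3, hq4⟩, rfl⟩) hadj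
    · have := hs z hz1 hz2 hz3
      exact h4 x z (s z) y hz1 this.1 hadj.symm hxy.symm this.2.1.symm hz2
    · have := hr q hq1 hq2 hq3 hq4
      exact h4 p q (r q) y hq1 this.1 hadj.symm hyp this.2.1.symm hq2
  · intro z h1 h2 h3
    exact ⟨s z, Or.inl ⟨z, ⟨h1, h2, h3⟩, rfl⟩, (hs z h1 h2 h3).1⟩
  · intro q h1 h2 h3
    by_cases h : ∀ z, G.Adj x z → z ≠ y → ¬ G.Adj y z → ¬ G.Adj q (s z)
    · exact ⟨r q, Or.inr ⟨q, ⟨h1, h2, h3, h⟩, rfl⟩, (hr q h1 h2 h3 h).1⟩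
    · push Not at h
      obtain ⟨z, hz1, hz2, hz3, hz⟩ := h
      exact ⟨s z, Or.inl ⟨z, ⟨hz1, hz2, hz3⟩, rfl⟩, hz⟩

section

variable [Finite V] (hG : G.WellCovered) (h4 : G.FourCycleFree) (h5 : G.FiveCycleFree)
  (hN : G.HasOuterNeighbors)
include hG h4 h5 hN

/-- The usual form of the forcing argument: with a single `z`, the vertex `r` lies in the
neighbourhood of the one chosen `s`, which is known in the applications. -/
theorem WellCovered.exists_dominated_one {x y p z s : V} (hxy : G.Adj x y) (hyp : G.Adj y p)
    (hxp : x ≠ p) (hnxp : ¬ G.Adj x p)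
    (hZ : ∀ z', G.Adj x z' → z' ≠ y → ¬ G.Adj y z' → z' = z)
    (hxz : G.Adj x z) (hzy : z ≠ y) (hyz : ¬ G.Adj y z) (hzs : G.Adj z s) (hsx : s ≠ x)
    (hxs : ¬ G.Adj x s) :
    ∃ q, G.Adj p q ∧ q ≠ y ∧ ¬ G.Adj y q ∧ ¬ G.Adj q s ∧
      (∀ r, G.Adj q r → r ≠ p → ¬ G.Adj p r → G.Adj r s) ∧
      ∃ r, G.Adj q r ∧ r ≠ p ∧ ¬ G.Adj p r ∧ G.Adj r s := by
  obtain ⟨q, h1, h2, h3, h4, h5⟩ := hG.exists_dominated h4 h5 hxy hyp hxp hnxp (fun _ => s)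
    (fun z' h1 h2 h3 => by rw [hZ z' h1 h2 h3]; exact ⟨hzs, hsx, hxs⟩)
  have h6 : ∀ r, G.Adj q r → r ≠ p → ¬ G.Adj p r → G.Adj r s := fun r a b c =>
    (h5 r a b c).choose_spec.2.2.2
  obtain ⟨r, a, b, c⟩ := hN p q h1
  exact ⟨q, h1, h2, h3, h4 z hxz hzy hyz, h6, r, a, b, c, h6 r a b c⟩

theorem WellCovered.exists_dominated_two {x y p z₁ z₂ s₁ s₂ : V} (hxy : G.Adj x y)
    (hyp : G.Adj y p) (hxp : x ≠ p) (hnxp : ¬ G.Adj x p)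
    (hZ : ∀ z', G.Adj x z' → z' ≠ y → z' = z₁ ∨ z' = z₂) (hz : z₁ ≠ z₂)
    (h₁ : G.Adj x z₁ ∧ z₁ ≠ y ∧ ¬ G.Adj y z₁ ∧ G.Adj z₁ s₁ ∧ s₁ ≠ x ∧ ¬ G.Adj x s₁)
    (h₂ : G.Adj x z₂ ∧ z₂ ≠ y ∧ ¬ G.Adj y z₂ ∧ G.Adj z₂ s₂ ∧ s₂ ≠ x ∧ ¬ G.Adj x s₂) :
    ∃ q, G.Adj p q ∧ q ≠ y ∧ ¬ G.Adj y q ∧ ¬ G.Adj q s₁ ∧ ¬ G.Adj q s₂ ∧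
      (∀ r, G.Adj q r → r ≠ p → ¬ G.Adj p r → G.Adj r s₁ ∨ G.Adj r s₂) ∧
      ∃ r, G.Adj q r ∧ r ≠ p ∧ ¬ G.Adj p r ∧ (G.Adj r s₁ ∨ G.Adj r s₂) := by
  classical
  obtain ⟨q, a1, a2, a3, a4, a5⟩ := hG.exists_dominated h4 h5 hxy hyp hxp hnxp
    (fun z => if z = z₁ then s₁ else s₂) (fun z' b1 b2 _ => by
      rcases hZ z' b1 b2 with rfl | rfl
      · simpa using h₁.2.2.2
      · simpa [hz.symm] using h₂.2.2.2)
  have h6 : ∀ r, G.Adj q r → r ≠ p → ¬ G.Adj p r → G.Adj r s₁ ∨ G.Adj r s₂ := fun r a b c => by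
    obtain ⟨z, -, -, -, h⟩ := a5 r a b c
    split_ifs at h
    · exact Or.inl h
    · exact Or.inr h
  obtain ⟨r, a, b, c⟩ := hN p q a1
  refine ⟨q, a1, a2, a3, ?_, ?_, h6, r, a, b, c, h6 r a b c⟩
  · simpa using a4 z₁ h₁.1 h₁.2.1 h₁.2.2.1
  · simpa [hz.symm] using a4 z₂ h₂.1 h₂.2.1 h₂.2.2.1

end

end SimpleGraph

/-! ### A component `T₁₀` of `G - N[v]` has no edge to `N(v)`; "attached" means adjacent to a vertex
of `N(v)` -/

namespace SimpleGraph

variable {V : Type u} {G : SimpleGraph V}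

theorem _root_.Fin.exists_ne_ne_three : ∀ i j : Fin 3, ∃ k, k ≠ i ∧ k ≠ j := by decide

theorem _root_.Fin.exists_others_three :
    ∀ i : Fin 3, ∃ j k, i ≠ j ∧ i ≠ k ∧ j ≠ k ∧ ∀ l, l = i ∨ l = j ∨ l = k := by decide

theorem _root_.Fin.eq_or_three :
    ∀ i j k : Fin 3, i ≠ j ∧ i ≠ k ∧ j ≠ k → ∀ l, l = i ∨ l = j ∨ l = k := by decide

/-- The vertices `t`, `a i`, `b i`, `c i` form a copy of `T₁₀` which is a union of connected
components of the graph obtained from `G` by deleting the closed neighbourhood of `v`. -/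
structure IsT10Outside (G : SimpleGraph V) (v t : V) (a b c : Fin 3 → V) : Prop where
  adj_ta : ∀ i, G.Adj t (a i)
  adj_ab : ∀ i, G.Adj (a i) (b i)
  adj_bc : ∀ i, G.Adj (b i) (c i)
  adj_cc : ∀ i j, i ≠ j → G.Adj (c i) (c j)
  nbr_t : ∀ u, G.Adj t u → (∃ i, u = a i) ∨ G.Adj v u
  nbr_a : ∀ i u, G.Adj (a i) u → u = t ∨ u = b i ∨ G.Adj v u
  nbr_b : ∀ i u, G.Adj (b i) u → u = a i ∨ u = c i ∨ G.Adj v u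
  nbr_c : ∀ i u, G.Adj (c i) u → u = b i ∨ (∃ j, j ≠ i ∧ u = c j) ∨ G.Adj v u
  not_t : ¬ G.Adj v t ∧ t ≠ v
  not_a : ∀ i, ¬ G.Adj v (a i) ∧ a i ≠ v
  not_b : ∀ i, ¬ G.Adj v (b i) ∧ b i ≠ v
  not_c : ∀ i, ¬ G.Adj v (c i) ∧ c i ≠ v
  inj_a : ∀ i j, a i = a j → i = j
  inj_b : ∀ i j, b i = b j → i = j
  inj_c : ∀ i j, c i = c j → i = j
  ne_tb : ∀ i, t ≠ b i
  ne_tc : ∀ i, t ≠ c i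
  ne_ab : ∀ i j, a i ≠ b j
  ne_ac : ∀ i j, a i ≠ c j
  ne_bc : ∀ i j, b i ≠ c j

/-- Two neighbours of `v` with a common neighbour other than `v` coincide. -/
theorem FourCycleFree.parent_unique (h4 : G.FourCycleFree) {v u y y' : V} (hu : u ≠ v)
    (hy : G.Adj v y) (hy' : G.Adj v y') (h : G.Adj u y) (h' : G.Adj u y') : y = y' := by
  by_contra hne
  exact h4 v y u y' hy h.symm h' hy'.symm hu.symm hne

/-- Adjacent vertices at distance two from `v` have the same neighbour in the neighbourhood of
`v`. -/
theorem FiveCycleFree.parent_unique (h5 : G.FiveCycleFree) {v u u' y y' : V} (hu : u ≠ v)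
    (hu' : u' ≠ v) (hvu : ¬ G.Adj v u) (hvu' : ¬ G.Adj v u') (huu : G.Adj u u')
    (hy : G.Adj v y) (hy' : G.Adj v y') (h : G.Adj u y) (h' : G.Adj u' y') : y = y' := by
  by_contra hne
  exact h5 v y u u' y' hy h.symm huu h' hy'.symm hu.symm hu'.symm (fun h => hvu' (h ▸ hy)) hne
    (fun h => hvu (h ▸ hy'))

namespace IsT10Outside

variable {v t : V} {a b c : Fin 3 → V} (H : G.IsT10Outside v t a b c)
include H

/-- The two attachments would coincide and close a 4-cycle with the third vertex of the triangle. -/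
theorem not_two_c (h4 : G.FourCycleFree) (h5 : G.FiveCycleFree) {i j : Fin 3} (hij : i ≠ j)
    {y y' : V} (hy : G.Adj v y) (hy' : G.Adj v y') (h : G.Adj (c i) y) (h' : G.Adj (c j) y') :
    False := by
  have : y = y' := h5.parent_unique (H.not_c i).2 (H.not_c j).2 (H.not_c i).1 (H.not_c j).1
    (H.adj_cc i j hij) hy hy' h h'
  subst this
  obtain ⟨k, hk, hk'⟩ : ∃ k : Fin 3, k ≠ i ∧ k ≠ j := Fin.exists_ne_ne_three i j
  refine h4 y (c i) (c k) (c j) h.symm (H.adj_cc _ _ hk.symm) (H.adj_cc _ _ hk') h' ?_ ?_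
  · rintro rfl
    exact (H.not_c k).1 hy
  · exact fun h => hij (H.inj_c _ _ h)

variable [Finite V] (hG : G.WellCovered) (h4 : G.FourCycleFree) (h5 : G.FiveCycleFree)
  (hN : G.HasOuterNeighbors)
include hG h4 h5 hN

/-- The forcing argument for the path `a i - t - y` with `b i` and `c i`: the vertex `r` is a
neighbour of `c i`, and short cycles exclude all other possibilities. -/
theorem attached_c_of_attached_t {y : V} (hvy : G.Adj v y) (hty : G.Adj t y) {i : Fin 3}
    (hi : ∀ u, G.Adj v u → ¬ G.Adj (a i) u) :
    (∃ r, G.Adj v r ∧ G.Adj (c i) r ∧ ¬ G.Adj y r) ∨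
      ∃ j, j ≠ i ∧ ∃ q, G.Adj v q ∧ G.Adj y q ∧ G.Adj (c j) q := by
  obtain ⟨q, hyq, hqt, htq, hqc, -, r, hqr, hry, hyr, hrc⟩ :=
    hG.exists_dominated_one h4 h5 hN (x := a i) (y := t) (p := y) (z := b i) (s := c i)
    (H.adj_ta i).symm hty (fun h => (H.not_a i).1 (h ▸ hvy)) (hi y hvy)
    (fun z hz hzt _ => by
      rcases H.nbr_a i z hz with h | h | h
      · exact absurd h hzt
      · exact h
      · exact absurd hz (hi z h))
    (H.adj_ab i) (H.ne_tb i).symm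
    (fun h => by
      rcases H.nbr_t _ h with ⟨j, h⟩ | h
      · exact H.ne_ab _ _ h.symm
      · exact (H.not_b i).1 h)
    (H.adj_bc i) (H.ne_ac i i).symm
    (fun h => by
      rcases H.nbr_a _ _ h with h | h | h
      · exact H.ne_tc _ h.symm
      · exact H.ne_bc _ _ h.symm
      · exact (H.not_c i).1 h)
  rcases H.nbr_c i r hrc.symm with rfl | ⟨j, hj, rfl⟩ | hvr
  · exfalso
    exact h5 y t (a i) (b i) q hty.symm (H.adj_ta i) (H.adj_ab i) hqr.symm hyq.symm
      (fun h => (H.not_a i).1 (h ▸ hvy)) (fun h => (H.not_b i).1 (h ▸ hvy)) (H.ne_tb i) hqt.symm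
      (fun h => hi y hvy (h ▸ hyq.symm))
  · rcases H.nbr_c j q hqr.symm with rfl | ⟨l, hl, rfl⟩ | hvq
    · exfalso
      exact h4 y t (a j) (b j) hty.symm (H.adj_ta j) (H.adj_ab j) hyq.symm
        (fun h => (H.not_a j).1 (h ▸ hvy)) (H.ne_tb j)
    · exfalso
      exact h5 y t (a l) (b l) (c l) hty.symm (H.adj_ta l) (H.adj_ab l) (H.adj_bc l) hyq.symm
        (fun h => (H.not_a l).1 (h ▸ hvy)) (fun h => (H.not_b l).1 (h ▸ hvy)) (H.ne_tb l)
        (H.ne_tc l) (H.ne_ac l l)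
    · exact Or.inr ⟨j, hj, q, hvq, hyq, hqr.symm⟩
  · exact Or.inl ⟨r, hvr, hrc.symm, hyr⟩

/-- Since only one `c` can be attached, the alternatives for `i` and `j` agree only if `c k` is
attached to a neighbour of `y`. An attached `a k` then closes a 5-cycle, and an unattached one
contradicts the alternatives for `k`. -/
theorem not_attached_t_of_not_attached {y : V} (hvy : G.Adj v y) (hty : G.Adj t y) {i j k : Fin 3}
    (hijk : i ≠ j ∧ i ≠ k ∧ j ≠ k) (hi : ∀ u, G.Adj v u → ¬ G.Adj (a i) u)
    (hj : ∀ u, G.Adj v u → ¬ G.Adj (a j) u) : False := by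
  have hc := fun l m hlm y y' => H.not_two_c h4 h5 (i := l) (j := m) hlm (y := y) (y' := y')
  have hp := fun l y y' => h4.parent_unique (H.not_c l).2 (y := y) (y' := y')
  have hall := Fin.eq_or_three i j k hijk
  have hA := fun l => H.attached_c_of_attached_t hG h4 h5 hN hvy hty (i := l)
  have key : ∃ q, G.Adj v q ∧ G.Adj y q ∧ G.Adj (c k) q := by
    rcases hA i hi with ⟨r, h1, h2, h3⟩ | ⟨l, hl, q, h1, h2, h3⟩ <;>
    rcases hA j hj with ⟨r', h1', h2', h3'⟩ | ⟨l', hl', q', h1', h2', h3'⟩ <;> grind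
  obtain ⟨q, h1, h2, h3⟩ := key
  by_cases hk : ∃ u, G.Adj v u ∧ G.Adj (a k) u
  · obtain ⟨u, hu, hku⟩ := hk
    have : y = u := h5.parent_unique H.not_t.2 (H.not_a k).2 H.not_t.1 (H.not_a k).1 (H.adj_ta k)
      hvy hu hty hku
    subst this
    exact h5 y (a k) (b k) (c k) q hku.symm (H.adj_ab k) (H.adj_bc k) h3 h2.symm
      (fun h => (H.not_b k).1 (h ▸ hvy)) (fun h => (H.not_c k).1 (h ▸ hvy)) (H.ne_ac k k)
      (fun h => (H.not_a k).1 (h ▸ h1)) (fun h => (H.not_b k).1 (h ▸ h1))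
  · rcases hA k (fun u h1 h2 => hk ⟨u, h1, h2⟩) with ⟨r, h1', h2', h3'⟩ | ⟨l, hl, q', h1', h2', h3'⟩
      <;> grind

/-- Two attached `a`'s would both be attached to `y`, giving a 4-cycle with `t`; so at least two are
unattached. -/
theorem not_attached_t {y : V} (hvy : G.Adj v y) : ¬ G.Adj t y := by
  intro hty
  have hone : ∀ i j, i ≠ j → ∀ u u', G.Adj v u → G.Adj v u' → G.Adj (a i) u → G.Adj (a j) u' →
      False := by
    intro i j hij u u' hu hu' hiu hju
    have h1 : y = u := h5.parent_unique H.not_t.2 (H.not_a i).2 H.not_t.1 (H.not_a i).1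
      (H.adj_ta i) hvy hu hty hiu
    have h2 : y = u' := h5.parent_unique H.not_t.2 (H.not_a j).2 H.not_t.1 (H.not_a j).1
      (H.adj_ta j) hvy hu' hty hju
    subst h1 h2
    exact h4 t (a i) y (a j) (H.adj_ta i) hiu hju.symm (H.adj_ta j).symm hty.ne
      (fun h => hij (H.inj_a _ _ h))
  have key := fun i j k => H.not_attached_t_of_not_attached hG h4 h5 hN hvy hty
    (i := i) (j := j) (k := k)
  by_cases h0 : ∃ u, G.Adj v u ∧ G.Adj (a 0) u
  · obtain ⟨u, hu, h0⟩ := h0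
    exact key 1 2 0 (by decide) (fun u' hu' h => hone 0 1 (by decide) u u' hu hu' h0 h)
      (fun u' hu' h => hone 0 2 (by decide) u u' hu hu' h0 h)
  · by_cases h1 : ∃ u, G.Adj v u ∧ G.Adj (a 1) u
    · obtain ⟨u, hu, h1⟩ := h1
      exact key 0 2 1 (by decide) (fun u' hu' h => h0 ⟨u', hu', h⟩)
        (fun u' hu' h => hone 1 2 (by decide) u u' hu hu' h1 h)
    · exact key 0 1 2 (by decide) (fun u' hu' h => h0 ⟨u', hu', h⟩)
        (fun u' hu' h => h1 ⟨u', hu', h⟩)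

/-- On the path `c j - c i - y` with `b j` and `a j`, the forced vertex `q` can only be `v` itself.
-/
theorem attached_a_of_attached_c {y : V} {i j : Fin 3} (hij : i ≠ j) (hvy : G.Adj v y)
    (hiy : G.Adj (c i) y) :
    (∃ r, G.Adj v r ∧ r ≠ y ∧ ¬ G.Adj y r) ∧
      ∀ r, G.Adj v r → r ≠ y → ¬ G.Adj y r → G.Adj (a j) r := by
  have ht := fun u hu => H.not_attached_t hG h4 h5 hN (y := u) hu
  have hcj : ∀ l, l ≠ i → ∀ u, G.Adj v u → ¬ G.Adj (c l) u := fun l hl u hu h =>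
    H.not_two_c h4 h5 hl.symm hvy hu hiy h
  obtain ⟨q, hyq, hqc, hcq, hqa, hall, r, hqr, hry, hyr, hra⟩ :=
    hG.exists_dominated_one h4 h5 hN (x := c j) (y := c i) (p := y) (z := b j) (s := a j)
    (H.adj_cc j i hij.symm) hiy (fun h => (H.not_c j).1 (h ▸ hvy)) (hcj j hij.symm y hvy)
    (fun z hz hzc hcz => by
      rcases H.nbr_c j z hz with h | ⟨l, hl, rfl⟩ | h
      · exact h
      · by_cases hli : l = i
        · exact absurd (hli ▸ rfl) hzc
        · exact absurd (H.adj_cc i l (Ne.symm hli)) hcz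
      · exact absurd hz (hcj j hij.symm z h))
    (H.adj_bc j).symm (H.ne_bc j i)
    (fun h => by
      rcases H.nbr_b _ _ h.symm with h | h | h
      · exact H.ne_ac _ _ h.symm
      · exact hij (H.inj_c _ _ h)
      · exact (H.not_c i).1 h)
    (H.adj_ab j).symm (H.ne_ac j j)
    (fun h => by
      rcases H.nbr_a _ _ h.symm with h | h | h
      · exact H.ne_tc _ h.symm
      · exact H.ne_bc _ _ h.symm
      · exact (H.not_c j).1 h)
  have hqv : q = v := by
    rcases H.nbr_a j r hra.symm with rfl | rfl | hvr
    · exfalso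
      rcases H.nbr_t q hqr.symm with ⟨l, rfl⟩ | h
      · by_cases hl : l = i
        · subst hl
          exact h4 y (c l) (b l) (a l) hiy.symm (H.adj_bc l).symm (H.adj_ab l).symm hyq.symm
            (fun h => (H.not_b l).1 (h ▸ hvy)) (H.ne_ac l l).symm
        · exact h5 y (c i) (c l) (b l) (a l) hiy.symm (H.adj_cc i l (Ne.symm hl))
            (H.adj_bc l).symm (H.adj_ab l).symm hyq.symm (fun h => (H.not_c l).1 (h ▸ hvy))
            (fun h => (H.not_b l).1 (h ▸ hvy)) (H.ne_bc l i).symm (H.ne_ac l i).symm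
            (H.ne_ac l l).symm
      · exact ht q h hqr.symm
    · exfalso
      exact h5 y (c i) (c j) (b j) q hiy.symm (H.adj_cc i j hij) (H.adj_bc j).symm hqr.symm
        hyq.symm (fun h => (H.not_c j).1 (h ▸ hvy)) (fun h => (H.not_b j).1 (h ▸ hvy))
        (H.ne_bc j i).symm hqc.symm (fun h => hcj j hij.symm y hvy (h ▸ hyq.symm))
    · by_contra hqv
      exact hry (h4.parent_unique hqv hvr hvy hqr hyq.symm)
  subst hqv
  exact ⟨⟨r, hqr, hry, hyr⟩, fun r h1 h2 h3 => (hall r h1 h2 h3).symm⟩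

theorem not_attached_c {y : V} (i : Fin 3) (hvy : G.Adj v y) : ¬ G.Adj (c i) y := by
  intro hiy
  obtain ⟨j, k, hij, hik, hjk, -⟩ := Fin.exists_others_three i
  obtain ⟨⟨r, h1, h2, h3⟩, hj⟩ := H.attached_a_of_attached_c hG h4 h5 hN hij hvy hiy
  obtain ⟨-, hk⟩ := H.attached_a_of_attached_c hG h4 h5 hN hik hvy hiy
  exact h4 t (a j) r (a k) (H.adj_ta j) (hj r h1 h2 h3) (hk r h1 h2 h3).symm (H.adj_ta k).symm
    (fun h => H.not_t.1 (h ▸ h1)) (fun h => hjk (H.inj_a _ _ h))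

/-- The path is `a i - t - a j` with `b i` and `y`. The candidate `q = b j` would make `c j`
adjacent to `y`, so `q` lies in `N(v)`. -/
theorem attached_a_of_attached_b {y : V} {i j : Fin 3} (hij : i ≠ j) (hvy : G.Adj v y)
    (hiy : G.Adj (b i) y) (hi : ∀ u, G.Adj v u → ¬ G.Adj (a i) u) :
    ∃ q, G.Adj v q ∧ G.Adj (a j) q ∧ ¬ G.Adj q y := by
  have ht := fun u hu => H.not_attached_t hG h4 h5 hN (y := u) hu
  have hc := fun l u hu => H.not_attached_c hG h4 h5 hN (y := u) l hu
  obtain ⟨q, haq, hqt, htq, hqy, hall, -⟩ :=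
    hG.exists_dominated_one h4 h5 hN (x := a i) (y := t) (p := a j) (z := b i) (s := y)
    (H.adj_ta i).symm (H.adj_ta j) (fun h => hij (H.inj_a _ _ h))
    (fun h => by
      rcases H.nbr_a i _ h with h | h | h
      · exact (H.adj_ta j).ne h.symm
      · exact H.ne_ab _ _ h
      · exact (H.not_a j).1 h)
    (fun z hz hzt _ => by
      rcases H.nbr_a i z hz with h | h | h
      · exact absurd h hzt
      · exact h
      · exact absurd hz (hi z h))
    (H.adj_ab i) (H.ne_tb i).symm
    (fun h => by
      rcases H.nbr_t _ h with ⟨j, h⟩ | h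
      · exact H.ne_ab _ _ h.symm
      · exact (H.not_b i).1 h)
    hiy (fun h => (H.not_a i).1 (h ▸ hvy)) (hi y hvy)
  rcases H.nbr_a j q haq with h | rfl | h
  · exact absurd h hqt
  · refine absurd (hall (c j) (H.adj_bc j) (H.ne_ac j j).symm fun h => ?_) (hc j y hvy)
    rcases H.nbr_a _ _ h with h | h | h
    · exact H.ne_tc _ h.symm
    · exact H.ne_bc _ _ h.symm
    · exact (H.not_c j).1 h
  · exact ⟨q, h, haq, hqy⟩

/-- Otherwise both other `a`'s are attached away from `y`. The path `a i - b i - y` with `t` and `a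
j` gives `q = v`, so `a j` is adjacent to the attachment of `a k`: a 4-cycle with `t`. -/
theorem exists_attached_a_of_attached_b {y : V} {i : Fin 3} (hvy : G.Adj v y)
    (hiy : G.Adj (b i) y) : ∃ u, G.Adj v u ∧ G.Adj (a i) u := by
  by_contra! hi
  have ht := fun u hu => H.not_attached_t hG h4 h5 hN (y := u) hu
  have hc := fun l u hu => H.not_attached_c hG h4 h5 hN (y := u) l hu
  obtain ⟨j, k, hij, hik, hjk, -⟩ := Fin.exists_others_three i
  have hnay : ∀ l, ¬ G.Adj (a l) y := by
    intro l hl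
    by_cases hli : l = i
    · subst hli; exact hi y hvy hl
    · exact h5 y (b i) (a i) t (a l) hiy.symm (H.adj_ab i).symm (H.adj_ta i).symm (H.adj_ta l)
        hl (fun h => (H.not_a i).1 (h ▸ hvy)) (fun h => H.not_t.1 (h ▸ hvy)) (H.ne_tb i).symm
        (H.ne_ab l i).symm (fun h => hli (H.inj_a _ _ h.symm))
  obtain ⟨yj, hvj, haj, hjy⟩ := H.attached_a_of_attached_b hG h4 h5 hN hij hvy hiy hi
  obtain ⟨yk, hvk, hak, hky⟩ := H.attached_a_of_attached_b hG h4 h5 hN hik hvy hiy hi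
  obtain ⟨q, hyq, hqb, hbq, hqa, hall, r, hqr, hry, hyr, hra⟩ :=
    hG.exists_dominated_one h4 h5 hN (x := a i) (y := b i) (p := y) (z := t) (s := a j)
    (H.adj_ab i) hiy (fun h => (H.not_a i).1 (h ▸ hvy)) (hi y hvy)
    (fun z hz hzb _ => by
      rcases H.nbr_a i z hz with h | h | h
      · exact h
      · exact absurd h hzb
      · exact absurd hz (hi z h))
    (H.adj_ta i).symm (H.ne_tb i)
    (fun h => by
      rcases H.nbr_t _ h.symm with ⟨j, h⟩ | h
      · exact H.ne_ab _ _ h.symm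
      · exact (H.not_b i).1 h)
    (H.adj_ta j) (fun h => hij (H.inj_a _ _ h.symm))
    (fun h => by
      rcases H.nbr_a i _ h with h | h | h
      · exact (H.adj_ta j).ne h.symm
      · exact H.ne_ab _ _ h
      · exact (H.not_a j).1 h)
  have hqv : q = v := by
    rcases H.nbr_a j r hra.symm with rfl | rfl | hvr
    · exfalso
      rcases H.nbr_t q hqr.symm with ⟨l, rfl⟩ | h
      · exact hnay l hyq.symm
      · exact ht q h hqr.symm
    · exfalso
      rcases H.nbr_b j q hqr.symm with rfl | rfl | h
      · exact hnay j hyq.symm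
      · exact hc j y hvy hyq.symm
      · have : yj = q := h5.parent_unique (H.not_a j).2 (H.not_b j).2 (H.not_a j).1 (H.not_b j).1
          (H.adj_ab j) hvj h haj hqr.symm
        exact hjy (this ▸ hyq.symm)
    · by_contra hqv
      exact hry (h4.parent_unique hqv hvr hvy hqr hyq.symm)
  subst hqv
  have := hall yk hvk (fun h => hnay k (h ▸ hak)) (fun h => hky h.symm)
  exact h4 t (a j) yk (a k) (H.adj_ta j) this.symm hak.symm (H.adj_ta k).symm
    (fun h => H.not_t.1 (h ▸ hvk)) (fun h => hjk (H.inj_a _ _ h))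

/-- The path is `t - a j - b j`, with `y` chosen for `a i` and `b k` for `a k`. The candidate `q = c
j` fails because its neighbour `c i` is adjacent to neither choice; one in `N(v)` would also be
adjacent to `a j`. -/
theorem not_attached_b_of_attached_a {y : V} {i j k : Fin 3} (hijk : i ≠ j ∧ i ≠ k ∧ j ≠ k)
    (hvy : G.Adj v y) (hiy : G.Adj (a i) y) {r : V} (hvr : G.Adj v r) : ¬ G.Adj (b j) r := by
  intro hjr
  have hall := Fin.eq_or_three i j k hijk
  obtain ⟨hij, hik, hjk⟩ := hijk
  have ht := fun u hu => H.not_attached_t hG h4 h5 hN (y := u) hu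
  have hc := fun l u hu => H.not_attached_c hG h4 h5 hN (y := u) l hu
  obtain ⟨u, hvu, hju⟩ := H.exists_attached_a_of_attached_b hG h4 h5 hN hvr hjr
  have : u = r := h5.parent_unique (H.not_a j).2 (H.not_b j).2 (H.not_a j).1 (H.not_b j).1
    (H.adj_ab j) hvu hvr hju hjr
  subst this
  have htb : ∀ l, ¬ G.Adj t (b l) := fun l h => by
    rcases H.nbr_t _ h with ⟨m, h⟩ | h
    · exact H.ne_ab _ _ h.symm
    · exact (H.not_b l).1 h
  have haa : ∀ l m, ¬ G.Adj (a l) (a m) := fun l m h => by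
    rcases H.nbr_a l _ h with h | h | h
    · exact (H.adj_ta m).ne h.symm
    · exact H.ne_ab _ _ h
    · exact (H.not_a m).1 h
  obtain ⟨q, hbq, hqa, haq, hqy, hqb, hdom, -⟩ :=
    hG.exists_dominated_two h4 h5 hN (x := t) (y := a j) (p := b j) (z₁ := a i) (z₂ := a k)
    (s₁ := y) (s₂ := b k) (H.adj_ta j) (H.adj_ab j) (H.ne_tb j) (htb j)
    (fun z hz hza => by
      rcases H.nbr_t z hz with ⟨l, rfl⟩ | h
      · rcases hall l with rfl | rfl | rfl
        · exact Or.inl rfl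
        · exact absurd rfl hza
        · exact Or.inr rfl
      · exact absurd hz (ht z h))
    (fun h => hik (H.inj_a _ _ h))
    ⟨H.adj_ta i, fun h => hij (H.inj_a _ _ h), haa j i, hiy, fun h => H.not_t.1 (h ▸ hvy),
      ht y hvy⟩
    ⟨H.adj_ta k, fun h => hjk (H.inj_a _ _ h.symm), haa j k, H.adj_ab k, (H.ne_tb k).symm, htb k⟩
  rcases H.nbr_b j q hbq with h | rfl | h
  · exact hqa h
  · have hbc : ∀ l m, G.Adj (b l) (c m) → l = m := fun l m h => by
      rcases H.nbr_b l _ h with h | h | h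
      · exact absurd h.symm (H.ne_ac _ _)
      · exact (H.inj_c _ _ h).symm
      · exact absurd h (H.not_c m).1
    rcases hdom (c i) (H.adj_cc j i hij.symm) (H.ne_bc j i).symm
      (fun h => hij (hbc _ _ h).symm) with h | h
    · exact hc i y hvy h
    · exact hik (hbc _ _ h.symm).symm
  · exact haq (h5.parent_unique (H.not_a j).2 (H.not_b j).2 (H.not_a j).1 (H.not_b j).1
      (H.adj_ab j) hvu h hju hbq ▸ hju)

/-- On the path `t - a i - y` the choices `b j` and `b k` are unattached, so `r` is a neighbouring
`a` or `c`. The first closes a 5-cycle; the second attaches a `b` or a `c`. -/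
theorem not_attached_a {y : V} (i : Fin 3) (hvy : G.Adj v y) : ¬ G.Adj (a i) y := by
  intro hiy
  have ht := fun u hu => H.not_attached_t hG h4 h5 hN (y := u) hu
  have hc := fun l u hu => H.not_attached_c hG h4 h5 hN (y := u) l hu
  obtain ⟨j, k, hij, hik, hjk, hall⟩ := Fin.exists_others_three i
  have hbj := fun r => H.not_attached_b_of_attached_a hG h4 h5 hN ⟨hij, hik, hjk⟩ hvy hiy (r := r)
  have hbk := fun r =>
    H.not_attached_b_of_attached_a hG h4 h5 hN ⟨hik, hij, hjk.symm⟩ hvy hiy (r := r)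
  have htb : ∀ l, ¬ G.Adj t (b l) := fun l h => by
    rcases H.nbr_t _ h with ⟨m, h⟩ | h
    · exact H.ne_ab _ _ h.symm
    · exact (H.not_b l).1 h
  have haa : ∀ l m, ¬ G.Adj (a l) (a m) := fun l m h => by
    rcases H.nbr_a l _ h with h | h | h
    · exact (H.adj_ta m).ne h.symm
    · exact H.ne_ab _ _ h
    · exact (H.not_a m).1 h
  obtain ⟨q, hyq, hqa, haq, hqbj, hqbk, -, r, hqr, hry, hyr, hr⟩ :=
    hG.exists_dominated_two h4 h5 hN (x := t) (y := a i) (p := y) (z₁ := a j) (z₂ := a k)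
    (s₁ := b j) (s₂ := b k) (H.adj_ta i) hiy (fun h => H.not_t.1 (h ▸ hvy)) (ht y hvy)
    (fun z hz hza => by
      rcases H.nbr_t z hz with ⟨l, rfl⟩ | h
      · rcases hall l with rfl | rfl | rfl
        · exact absurd rfl hza
        · exact Or.inl rfl
        · exact Or.inr rfl
      · exact absurd hz (ht z h))
    (fun h => hjk (H.inj_a _ _ h))
    ⟨H.adj_ta j, fun h => hij (H.inj_a _ _ h.symm), haa i j, H.adj_ab j, (H.ne_tb j).symm, htb j⟩
    ⟨H.adj_ta k, fun h => hik (H.inj_a _ _ h.symm), haa i k, H.adj_ab k, (H.ne_tb k).symm, htb k⟩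
  have key : ∀ l, l ≠ i → (∀ r, G.Adj v r → ¬ G.Adj (b l) r) → G.Adj r (b l) → False := by
    intro l hli hbl hrl
    rcases H.nbr_b l r hrl.symm with rfl | rfl | h
    · exact h5 y (a i) t (a l) q hiy.symm (H.adj_ta i).symm (H.adj_ta l) hqr.symm hyq.symm
        (fun h => H.not_t.1 (h ▸ hvy)) (fun h => (H.not_a l).1 (h ▸ hvy))
        (fun h => hli (H.inj_a _ _ h.symm)) hqa.symm (fun h => ht y hvy (h ▸ hyq.symm))
    · rcases H.nbr_c l q hqr.symm with rfl | ⟨m, -, rfl⟩ | h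
      · exact hbl y hvy hyq.symm
      · exact hc m y hvy hyq.symm
      · exact hc l q h hqr.symm
    · exact hbl r h hrl.symm
  rcases hr with h | h
  · exact key j hij.symm hbj h
  · exact key k hik.symm hbk h

theorem not_attached_b {y : V} (i : Fin 3) (hvy : G.Adj v y) : ¬ G.Adj (b i) y := by
  intro hiy
  obtain ⟨u, hu, h⟩ := H.exists_attached_a_of_attached_b hG h4 h5 hN hvy hiy
  exact H.not_attached_a hG h4 h5 hN i hu h

end IsT10Outside

end SimpleGraph

/-! ### A component `C₇` of `G - N[v]` that extends to `T₁₀` -/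

namespace SimpleGraph

variable {V : Type u} {G : SimpleGraph V}

/-- `f` embeds `H` as a union of connected components of `G`. -/
def IsComponentCopy {n : ℕ} (H : SimpleGraph (Fin n)) (G : SimpleGraph V) (f : Fin n → V) : Prop :=
  Function.Injective f ∧ ∀ i u, G.Adj (f i) u ↔ ∃ j, H.Adj i j ∧ u = f j

/-- All neighbours of `w` but one are pairwise adjacent. -/
def IsAlmostSimplicial (G : SimpleGraph V) (w : V) : Prop :=
  ∃ y, G.Adj w y ∧ ∀ a b, G.Adj w a → G.Adj w b → a ≠ y → b ≠ y → a ≠ b → G.Adj a b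

/-- The vertices `x i` form a copy of `C₇` which is a union of connected components of the graph
obtained from `G` by deleting the closed neighbourhood of `v`. -/
structure IsC7Outside (G : SimpleGraph V) (v : V) (x : Fin 7 → V) : Prop where
  adj : ∀ i j, j = i + 1 → G.Adj (x i) (x j)
  nbr : ∀ i j k, j = i + 1 → k = i - 1 → ∀ u, G.Adj (x i) u → u = x j ∨ u = x k ∨ G.Adj v u
  not_adj : ∀ i, ¬ G.Adj v (x i)
  ne : ∀ i, x i ≠ v
  inj : Function.Injective x

theorem _root_.Fin.neg_eq_neg_add_one_seven :
    ∀ i j : Fin 7, j = i + 1 → -i = -j + 1 ∧ -j = -i - 1 := by decide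

theorem _root_.Fin.neg_sub_one_seven : ∀ i k : Fin 7, k = i - 1 → -k = -i + 1 := by decide

namespace IsC7Outside

variable {v : V} {x : Fin 7 → V} (H : G.IsC7Outside v x)
include H

/-- Transfers each argument on one side of `x 0` to the other side. -/
theorem reflect : G.IsC7Outside v (fun i => x (-i)) where
  adj i j h := (H.adj (-j) (-i) (Fin.neg_eq_neg_add_one_seven i j h).1).symm
  nbr i j k hj hk u h := by
    have := H.nbr (-i) (-k) (-j) (Fin.neg_sub_one_seven i k hk) (Fin.neg_eq_neg_add_one_seven i j hj).2 u h
    tauto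
  not_adj i := H.not_adj _
  ne i := H.ne _
  inj i j h := neg_injective (H.inj h)

theorem nonadj {i j : Fin 7} (h1 : j ≠ i + 1) (h2 : j ≠ i - 1) : ¬ G.Adj (x i) (x j) := by
  intro h
  rcases H.nbr i _ _ rfl rfl _ h with h | h | h
  · exact h1 (H.inj h)
  · exact h2 (H.inj h)
  · exact H.not_adj _ h

theorem attached_only_zero (h4 : G.FourCycleFree) (h5 : G.FiveCycleFree) {y : V}
    (hvy : G.Adj v y) (h0 : G.Adj (x 0) y) (h1 : ¬ G.Adj (x 1) y) (h6 : ¬ G.Adj (x 6) y) {i : Fin 7}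
    (hi : i ≠ 0) : ¬ G.Adj (x i) y := by
  have hn : ∀ i, x i ≠ y := fun i h => H.not_adj i (h ▸ hvy)
  have e : ∀ i j, j = i + 1 → G.Adj (x i) (x j) := H.adj
  have hne : ∀ {i j}, i ≠ j → x i ≠ x j := fun h => H.inj.ne h
  have h2 : ¬ G.Adj (x 2) y := fun h =>
    h4 (x 0) (x 1) (x 2) y (e _ _ rfl) (e _ _ rfl) h h0.symm (hne (by decide)) (hn 1)
  have h5' : ¬ G.Adj (x 5) y := fun h =>
    h4 (x 0) (x 6) (x 5) y (e 6 0 rfl).symm (e 5 6 rfl).symm h h0.symm (hne (by decide)) (hn 6)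
  have h3 : ¬ G.Adj (x 3) y := fun h =>
    h5 (x 0) (x 1) (x 2) (x 3) y (e _ _ rfl) (e _ _ rfl) (e _ _ rfl) h h0.symm
      (hne (by decide)) (hne (by decide)) (hne (by decide)) (hn 1) (hn 2)
  have h4' : ¬ G.Adj (x 4) y := fun h =>
    h5 (x 0) (x 6) (x 5) (x 4) y (e 6 0 rfl).symm (e 5 6 rfl).symm (e 4 5 rfl).symm h h0.symm
      (hne (by decide)) (hne (by decide)) (hne (by decide)) (hn 6) (hn 5)
  fin_cases i
  · exact absurd rfl hi
  · exact h1
  · exact h2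
  · exact h3
  · exact h4'
  · exact h5'
  · exact h6

theorem not_attached_one (h5 : G.FiveCycleFree) {y : V} (hvy : G.Adj v y) (h0 : G.Adj (x 0) y)
    (h1 : ¬ G.Adj (x 1) y) {u : V} (hu : G.Adj v u) : ¬ G.Adj (x 1) u := fun h =>
  h1 (h5.parent_unique (H.ne 0) (H.ne 1) (H.not_adj 0) (H.not_adj 1) (H.adj 0 1 rfl) hvy hu h0 h ▸ h)

variable [Finite V] (hG : G.WellCovered) (h4 : G.FourCycleFree) (h5 : G.FiveCycleFree)
  (hN : G.HasOuterNeighbors)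
include hG h4 h5 hN

/-- The path is `x 1 - x 0 - y` with `x 2` and `x 3`. The vertex `r`, a neighbour of `x 3`, is `x 4`
in the first alternative; in the second it lies in `N(v)` and `q = v`. -/
theorem attached_three_or_four {y : V} (hvy : G.Adj v y) (h0 : G.Adj (x 0) y)
    (h1 : ¬ G.Adj (x 1) y) (h6 : ¬ G.Adj (x 6) y) :
    (∃ q, G.Adj v q ∧ G.Adj y q ∧ G.Adj (x 4) q ∧
        ∀ r, G.Adj q r → r ≠ y → ¬ G.Adj y r → G.Adj r (x 3)) ∨
      ∃ r, G.Adj v r ∧ G.Adj (x 3) r ∧ r ≠ y ∧ ¬ G.Adj y r ∧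
        ∀ r', G.Adj v r' → r' ≠ y → ¬ G.Adj y r' → G.Adj r' (x 3) := by
  have hn : ∀ i, x i ≠ y := fun i h => H.not_adj i (h ▸ hvy)
  have hy : ∀ i, i ≠ 0 → ¬ G.Adj (x i) y := fun i hi => H.attached_only_zero h4 h5 hvy h0 h1 h6 hi
  obtain ⟨q, hyq, hq0, h0q, hq3, hall, r, hqr, hry, hyr, hr3⟩ :=
    hG.exists_dominated_one h4 h5 hN (x := x 1) (y := x 0) (p := y) (z := x 2) (s := x 3)
    (H.adj 0 1 rfl).symm h0 (hn 1) h1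
    (fun z hz hz0 _ => by
      rcases H.nbr 1 2 0 rfl rfl z hz with h | h | h
      · exact h
      · exact absurd h hz0
      · exact absurd hz (H.not_attached_one h5 hvy h0 h1 h))
    (H.adj 1 2 rfl) (H.inj.ne (by decide)) (H.nonadj (by decide) (by decide)) (H.adj 2 3 rfl)
    (H.inj.ne (by decide)) (H.nonadj (by decide) (by decide))
  rcases H.nbr 3 4 2 rfl rfl r hr3.symm with rfl | rfl | hvr
  · rcases H.nbr 4 5 3 rfl rfl q hqr.symm with rfl | rfl | hvq
    · exact absurd hyq.symm (hy 5 (by decide))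
    · exact absurd hyq.symm (hy 3 (by decide))
    · exact Or.inl ⟨q, hvq, hyq, hqr.symm, hall⟩
  · exfalso
    exact h5 y (x 0) (x 1) (x 2) q h0.symm (H.adj 0 1 rfl) (H.adj 1 2 rfl) hqr.symm hyq.symm
      (hn 1).symm (hn 2).symm (H.inj.ne (by decide)) hq0.symm (fun h => h1 (h ▸ hyq.symm))
  · have hqv : q = v := by
      by_contra hqv
      exact hry (h4.parent_unique hqv hvr hvy hqr hyq.symm)
    subst hqv
    exact Or.inr ⟨r, hvr, hr3.symm, hry, hyr, hall⟩

/-- The alternatives for the two directions around the cycle are compatible only when both are the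
second; the two attachments coincide because `x 3` and `x 4` are adjacent. -/
theorem exists_attached_three_four {y : V} (hvy : G.Adj v y) (h0 : G.Adj (x 0) y)
    (h1 : ¬ G.Adj (x 1) y) (h6 : ¬ G.Adj (x 6) y) :
    ∃ z, G.Adj v z ∧ G.Adj (x 3) z ∧ G.Adj (x 4) z ∧ z ≠ y ∧ ¬ G.Adj y z ∧
      ∀ r, G.Adj v r → r ≠ y → ¬ G.Adj y r → r = z := by
  have hy : ∀ i, i ≠ 0 → ¬ G.Adj (x i) y := fun i hi => H.attached_only_zero h4 h5 hvy h0 h1 h6 hi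
  have hp : ∀ {q q'}, G.Adj v q → G.Adj v q' → G.Adj (x 3) q → G.Adj (x 4) q' → q = q' :=
    h5.parent_unique (H.ne 3) (H.ne 4) (H.not_adj 3) (H.not_adj 4) (H.adj 3 4 rfl)
  have hA := H.attached_three_or_four hG h4 h5 hN hvy h0 h1 h6
  have hB := H.reflect.attached_three_or_four hG h4 h5 hN hvy h0 h6 h1
  change (∃ q, G.Adj v q ∧ G.Adj y q ∧ G.Adj (x 3) q ∧
        ∀ r, G.Adj q r → r ≠ y → ¬ G.Adj y r → G.Adj r (x 4)) ∨
      ∃ r, G.Adj v r ∧ G.Adj (x 4) r ∧ r ≠ y ∧ ¬ G.Adj y r ∧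
        ∀ r', G.Adj v r' → r' ≠ y → ¬ G.Adj y r' → G.Adj r' (x 4) at hB
  rcases hA with ⟨q, a1, a2, a3, a4⟩ | ⟨r, a1, a2, a3, a4, a5⟩ <;>
  rcases hB with ⟨q', b1, b2, b3, b4⟩ | ⟨r', b1, b2, b3, b4, b5⟩
  · obtain rfl := hp b1 a1 b3 a3
    exact absurd (a4 (x 3) b3.symm (fun h => H.not_adj 3 (h ▸ hvy))
      (fun h => hy 3 (by decide) h.symm)) G.irrefl
  · exact absurd (h4.parent_unique (H.ne 4) a1 b1 a3 b2 ▸ a2) b4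
  · exact absurd (h4.parent_unique (H.ne 3) b1 a1 b3 a2 ▸ b2) a4
  · obtain rfl := hp a1 b1 a2 b2
    exact ⟨r, a1, a2, b2, a3, a4, fun r' c1 c2 c3 =>
      h4.parent_unique (H.ne 3) c1 a1 (a5 r' c1 c2 c3).symm a2⟩

/-- A copy of `C₇` outside the closed neighbourhood of `v` extends to a component `T₁₀`. -/
theorem exists_nbr_eq {y : V} (hvy : G.Adj v y) (h0 : G.Adj (x 0) y)
    (h1 : ¬ G.Adj (x 1) y) (h6 : ¬ G.Adj (x 6) y) :
    ∃ z, z ≠ y ∧ z ≠ v ∧ y ≠ v ∧ (∀ i, x i ≠ y) ∧ (∀ i, x i ≠ z) ∧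
      (∀ u, G.Adj (x 0) u ↔ u = x 1 ∨ u = x 6 ∨ u = y) ∧
      (∀ u, G.Adj (x 1) u ↔ u = x 0 ∨ u = x 2) ∧
      (∀ u, G.Adj (x 2) u ↔ u = x 1 ∨ u = x 3) ∧
      (∀ u, G.Adj (x 3) u ↔ u = x 2 ∨ u = x 4 ∨ u = z) ∧
      (∀ u, G.Adj (x 4) u ↔ u = x 5 ∨ u = x 3 ∨ u = z) ∧
      (∀ u, G.Adj (x 5) u ↔ u = x 6 ∨ u = x 4) ∧
      (∀ u, G.Adj (x 6) u ↔ u = x 0 ∨ u = x 5) ∧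
      (∀ u, G.Adj y u ↔ u = x 0 ∨ u = v) ∧
      (∀ u, G.Adj v u ↔ u = y ∨ u = z) ∧
      (∀ u, G.Adj z u ↔ u = v ∨ u = x 3 ∨ u = x 4) := by
  obtain ⟨z, hvz, h3z, h4z, hzy, hyz, huniq⟩ :=
    H.exists_attached_three_four hG h4 h5 hN hvy h0 h1 h6
  have hn : ∀ i, x i ≠ y := fun i h => H.not_adj i (h ▸ hvy)
  have hnz : ∀ i, x i ≠ z := fun i h => H.not_adj i (h ▸ hvz)
  have hy : ∀ i, i ≠ 0 → ¬ G.Adj (x i) y := fun i hi => H.attached_only_zero h4 h5 hvy h0 h1 h6 hi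
  have hu1 : ∀ u, G.Adj v u → ¬ G.Adj (x 1) u := fun u => H.not_attached_one h5 hvy h0 h1
  have hu6 : ∀ u, G.Adj v u → ¬ G.Adj (x 6) u := fun u =>
    H.reflect.not_attached_one h5 hvy h0 h6
  have hu2 : ∀ u, G.Adj v u → ¬ G.Adj (x 2) u := fun u hu h => by
    obtain rfl := h5.parent_unique (H.ne 2) (H.ne 3) (H.not_adj 2) (H.not_adj 3) (H.adj 2 3 rfl)
      hu hvz h h3z
    exact h4 (x 2) (x 3) (x 4) u (H.adj 2 3 rfl) (H.adj 3 4 rfl) h4z h.symm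
      (H.inj.ne (by decide)) (hnz 3)
  have hu5 : ∀ u, G.Adj v u → ¬ G.Adj (x 5) u := fun u hu h => by
    obtain rfl := h5.parent_unique (H.ne 4) (H.ne 5) (H.not_adj 4) (H.not_adj 5) (H.adj 4 5 rfl)
      hvz hu h4z h
    exact h4 (x 5) (x 4) (x 3) z (H.adj 4 5 rfl).symm (H.adj 3 4 rfl).symm h3z h.symm
      (H.inj.ne (by decide)) (hnz 4)
  have hu0 : ∀ u, G.Adj v u → G.Adj (x 0) u → u = y := fun u hu h =>
    h4.parent_unique (H.ne 0) hu hvy h h0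
  have hu3 : ∀ u, G.Adj v u → G.Adj (x 3) u → u = z := fun u hu h =>
    h4.parent_unique (H.ne 3) hu hvz h h3z
  have hu4 : ∀ u, G.Adj v u → G.Adj (x 4) u → u = z := fun u hu h =>
    h4.parent_unique (H.ne 4) hu hvz h h4z
  have n0 : ∀ u, G.Adj (x 0) u ↔ u = x 1 ∨ u = x 6 ∨ u = y := fun u => by
    refine ⟨fun h => ?_, ?_⟩
    · rcases H.nbr 0 1 6 rfl rfl u h with h' | h' | h'
      · exact Or.inl h'
      · exact Or.inr (Or.inl h')
      · exact Or.inr (Or.inr (hu0 u h' h))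
    · rintro (rfl | rfl | rfl)
      exacts [H.adj 0 1 rfl, (H.adj 6 0 rfl).symm, h0]
  have n1 : ∀ u, G.Adj (x 1) u ↔ u = x 0 ∨ u = x 2 := fun u => by
    refine ⟨fun h => ?_, ?_⟩
    · rcases H.nbr 1 2 0 rfl rfl u h with h' | h' | h'
      · exact Or.inr h'
      · exact Or.inl h'
      · exact absurd h (hu1 u h')
    · rintro (rfl | rfl)
      exacts [(H.adj 0 1 rfl).symm, H.adj 1 2 rfl]
  have n2 : ∀ u, G.Adj (x 2) u ↔ u = x 1 ∨ u = x 3 := fun u => by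
    refine ⟨fun h => ?_, ?_⟩
    · rcases H.nbr 2 3 1 rfl rfl u h with h' | h' | h'
      · exact Or.inr h'
      · exact Or.inl h'
      · exact absurd h (hu2 u h')
    · rintro (rfl | rfl)
      exacts [(H.adj 1 2 rfl).symm, H.adj 2 3 rfl]
  have n3 : ∀ u, G.Adj (x 3) u ↔ u = x 2 ∨ u = x 4 ∨ u = z := fun u => by
    refine ⟨fun h => ?_, ?_⟩
    · rcases H.nbr 3 4 2 rfl rfl u h with h' | h' | h'
      · exact Or.inr (Or.inl h')
      · exact Or.inl h'
      · exact Or.inr (Or.inr (hu3 u h' h))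
    · rintro (rfl | rfl | rfl)
      exacts [(H.adj 2 3 rfl).symm, H.adj 3 4 rfl, h3z]
  have n4 : ∀ u, G.Adj (x 4) u ↔ u = x 5 ∨ u = x 3 ∨ u = z := fun u => by
    refine ⟨fun h => ?_, ?_⟩
    · rcases H.nbr 4 5 3 rfl rfl u h with h' | h' | h'
      · exact Or.inl h'
      · exact Or.inr (Or.inl h')
      · exact Or.inr (Or.inr (hu4 u h' h))
    · rintro (rfl | rfl | rfl)
      exacts [H.adj 4 5 rfl, (H.adj 3 4 rfl).symm, h4z]
  have n5 : ∀ u, G.Adj (x 5) u ↔ u = x 6 ∨ u = x 4 := fun u => by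
    refine ⟨fun h => ?_, ?_⟩
    · rcases H.nbr 5 6 4 rfl rfl u h with h' | h' | h'
      · exact Or.inl h'
      · exact Or.inr h'
      · exact absurd h (hu5 u h')
    · rintro (rfl | rfl)
      exacts [H.adj 5 6 rfl, (H.adj 4 5 rfl).symm]
  have n6 : ∀ u, G.Adj (x 6) u ↔ u = x 0 ∨ u = x 5 := fun u => by
    refine ⟨fun h => ?_, ?_⟩
    · rcases H.nbr 6 0 5 rfl rfl u h with h' | h' | h'
      · exact Or.inl h'
      · exact Or.inr h'
      · exact absurd h (hu6 u h')
    · rintro (rfl | rfl)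
      exacts [H.adj 6 0 rfl, (H.adj 5 6 rfl).symm]
  have h0z : ¬ G.Adj (x 0) z := fun h => hzy (hu0 z hvz h)
  have nv : ∀ u, G.Adj v u ↔ u = y ∨ u = z := by
    -- The forcing argument now runs from the triangle side; it yields `r = y` and `q = v`, hence
    -- controls every neighbour of `v`.
    obtain ⟨q, hzq, hq3, h3q, hq0, hall, r, hqr, hrz, hzr, hr0⟩ :=
      hG.exists_dominated_one h4 h5 hN (x := x 2) (y := x 3) (p := z) (z := x 1) (s := x 0)
      (H.adj 2 3 rfl) h3z (hnz 2) (hu2 z hvz) (fun a ha h _ => ((n2 a).1 ha).resolve_right h)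
      (H.adj 1 2 rfl).symm (H.inj.ne (by decide)) (H.nonadj (by decide) (by decide))
      (H.adj 0 1 rfl).symm (H.inj.ne (by decide)) (H.nonadj (by decide) (by decide))
    have hry : r = y := by
      rcases (n0 r).1 hr0.symm with rfl | rfl | h
      · exfalso
        rcases (n1 q).1 hqr.symm with rfl | rfl
        · exact h0z hzq.symm
        · exact hu2 z hvz hzq.symm
      · exfalso
        rcases (n6 q).1 hqr.symm with rfl | rfl
        · exact h0z hzq.symm
        · exact hu5 z hvz hzq.symm
      · exact h
    subst hry
    have hqv : q = v := by
      by_contra hqv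
      exact hzy (h4.parent_unique hqv hvz hvy hzq.symm hqr)
    subst hqv
    intro u
    refine ⟨fun h => ?_, ?_⟩
    · by_contra! hu
      by_cases hyu : G.Adj r u
      · have hzu : ¬ G.Adj z u := fun h' =>
          h4 q r u z hvy hyu h'.symm hvz.symm h.ne hzy.symm
        exact hu.1 (hu0 u h (hall u h hu.2 hzu).symm)
      · exact hu.2 (huniq u h hu.1 hyu)
    · rintro (rfl | rfl)
      exacts [hvy, hvz]
  have ny : ∀ e, G.Adj y e ↔ e = x 0 ∨ e = v := fun e => by
    refine ⟨fun hye => ?_, ?_⟩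
    · by_contra! he
      have hve : ¬ G.Adj v e := fun h => by
        rcases (nv e).1 h with rfl | rfl
        · exact G.irrefl hye
        · exact hyz hye
      -- A further neighbour `e` of `y` would give an induced path `v - y - e`; every candidate for
      -- `r` near `x 3` is excluded. The same scheme bounds the neighbours of `z` below.
      obtain ⟨q, heq, hqy, hyq, hq3, -, r, hqr, hre, her, hr3⟩ :=
        hG.exists_dominated_one h4 h5 hN (x := v) (y := y) (p := e) (z := z) (s := x 3)
        hvy hye he.2.symm hve (fun a ha h _ => ((nv a).1 ha).resolve_left h) hvz hzy hyz h3z.symm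
        (H.ne 3) (H.not_adj 3)
      have hxe : ∀ i, i ≠ 0 → e ≠ x i := fun i hi h => hy i hi (h ▸ hye.symm)
      have hez : e ≠ z := fun h => hyz (h ▸ hye)
      have hey : e ≠ y := hye.ne'
      rcases (n3 r).1 hr3.symm with rfl | rfl | rfl
      · rcases (n2 q).1 hqr.symm with rfl | rfl
        · rcases (n1 e).1 heq.symm with h | h
          · exact he.1 h
          · exact hxe _ (by decide) h
        · rcases (n3 e).1 heq.symm with h | h | h
          · exact hxe _ (by decide) h
          · exact hxe _ (by decide) h
          · exact hez h
      · rcases (n4 q).1 hqr.symm with rfl | rfl | rfl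
        · rcases (n5 e).1 heq.symm with h | h
          · exact hxe _ (by decide) h
          · exact hxe _ (by decide) h
        · rcases (n3 e).1 heq.symm with h | h | h
          · exact hxe _ (by decide) h
          · exact hxe _ (by decide) h
          · exact hez h
        · exact h4 v y e q hvy hye heq hvz.symm he.2.symm hzy.symm
      · exact h5 y v r q e hvy.symm hvz hqr.symm heq.symm hye.symm hzy.symm hqy.symm
          (fun h => hve (h ▸ heq.symm)) he.2.symm hre
    · rintro (rfl | rfl)
      exacts [h0.symm, hvy.symm]
  refine ⟨z, hzy, hvz.ne', hvy.ne', hn, hnz, n0, n1, n2, n3, n4, n5, n6, ny, nv, fun e => ?_⟩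
  · refine ⟨fun hze => ?_, ?_⟩
    · by_contra! he
      have hve : ¬ G.Adj v e := fun h => by
        rcases (nv e).1 h with rfl | rfl
        · exact hyz hze.symm
        · exact G.irrefl hze
      obtain ⟨q, heq, hqz, hzq, hq0, -, r, hqr, hre, her, hr0⟩ :=
        hG.exists_dominated_one h4 h5 hN (x := v) (y := z) (p := e) (z := y) (s := x 0)
        hvz hze he.1.symm hve (fun a ha h _ => ((nv a).1 ha).resolve_right h) hvy hzy.symm
        (fun h => hyz h.symm) h0.symm (H.ne 0) (H.not_adj 0)
      have e0 : ¬ G.Adj e (x 0) := fun h => by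
        rcases (n0 e).1 h.symm with rfl | rfl | rfl
        · exact hu1 z hvz hze.symm
        · exact hu6 z hvz hze.symm
        · exact hyz hze.symm
      rcases (n0 r).1 hr0.symm with rfl | rfl | rfl
      · rcases (n1 q).1 hqr.symm with rfl | rfl
        · exact e0 heq
        · rcases (n2 e).1 heq.symm with rfl | rfl
          · exact hu1 z hvz hze.symm
          · exact he.2.1 rfl
      · rcases (n6 q).1 hqr.symm with rfl | rfl
        · exact e0 heq
        · rcases (n5 e).1 heq.symm with rfl | rfl
          · exact hu6 z hvz hze.symm
          · exact he.2.2 rfl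
      · rcases (ny q).1 hqr.symm with rfl | rfl
        · exact e0 heq
        · exact hve heq.symm
    · rintro (rfl | rfl | rfl)
      exacts [hvz.symm, h3z.symm, h4z.symm]

end IsC7Outside

end SimpleGraph

/-! ### If all vertices are almost simplicial, the graph consists of seven-cycles -/

namespace SimpleGraph

variable {V : Type u} {G : SimpleGraph V}

theorem isComponentCopy_cycleGraph_seven {x : Fin 7 → V} (hinj : Function.Injective x)
    (hadj : ∀ i, G.Adj (x i) (x (i + 1)))
    (hnbr : ∀ i u, G.Adj (x i) u → u = x (i + 1) ∨ u = x (i - 1)) :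
    IsComponentCopy (cycleGraph 7) G x := by
  refine ⟨hinj, fun i u => ⟨fun h => ?_, ?_⟩⟩
  · have : ∀ i : Fin 7, (cycleGraph 7).Adj i (i + 1) ∧ (cycleGraph 7).Adj i (i - 1) := by decide
    have := this i
    rcases hnbr i u h with h | h
    · exact ⟨i + 1, this.1, h⟩
    · exact ⟨i - 1, this.2, h⟩
  · rintro ⟨j, hij, rfl⟩
    have : ∀ i j : Fin 7, (cycleGraph 7).Adj i j → j = i + 1 ∨ i = j + 1 := by decide
    rcases this i j hij with rfl | rfl
    · exact hadj i
    · exact (hadj j).symm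

theorem IsAlmostSimplicial.adj_of_three {w a b c : V} (hw : G.IsAlmostSimplicial w)
    (ha : G.Adj w a) (hb : G.Adj w b) (hc : G.Adj w c) (hab : a ≠ b) (hac : a ≠ c) (hbc : b ≠ c) :
    G.Adj a b ∨ G.Adj a c ∨ G.Adj b c := by
  obtain ⟨e, -, he⟩ := hw
  by_cases hea : a = e
  · subst hea
    exact Or.inr (Or.inr (he b c hb hc hab.symm hac.symm hbc))
  · by_cases heb : b = e
    · subst heb
      exact Or.inr (Or.inl (he a c ha hc hab hbc.symm hac))
    · exact Or.inl (he a b ha hb hea heb hab)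

/-- An outer neighbour of `u` is adjacent to neither `w₁` nor `w₂`, so it is the exceptional one.
Any other neighbour would be adjacent to both and close a 4-cycle. -/
theorem IsAlmostSimplicial.nbr_of_triangle (h4 : G.FourCycleFree) (hN : G.HasOuterNeighbors) {u w₁ w₂ : V} (hu : G.IsAlmostSimplicial u)
    (h1 : G.Adj u w₁) (h2 : G.Adj u w₂) (h12 : G.Adj w₁ w₂) :
    ∃ y, G.Adj u y ∧ y ≠ w₁ ∧ y ≠ w₂ ∧ ¬ G.Adj y w₁ ∧ ¬ G.Adj y w₂ ∧
      ∀ z, G.Adj u z → z = y ∨ z = w₁ ∨ z = w₂ := by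
  obtain ⟨y, huy, hy1, hny1⟩ := hN w₁ u h1.symm
  have hy2 : y ≠ w₂ := fun h => hny1 (h ▸ h12)
  have hny2 : ¬ G.Adj y w₂ := fun h => h4 w₁ u y w₂ h1.symm huy h h12.symm hy1.symm h2.ne
  refine ⟨y, huy, hy1, hy2, fun h => hny1 h.symm, hny2, fun z hz => ?_⟩
  by_contra! hcon
  obtain ⟨e, -, he⟩ := hu
  have hey : e = y := by
    by_contra hey
    by_cases h : e = w₁
    · subst h
      exact hny2 (he y w₂ huy h2 (Ne.symm hey) h12.ne' hy2)
    · exact hny1 (he y w₁ huy h1 (Ne.symm hey) (Ne.symm h) hy1).symm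
  subst hey
  exact h4 z w₁ u w₂ (he z w₁ hz h1 hcon.1 hy1.symm hcon.2.1) h1.symm h2
    (he z w₂ hz h2 hcon.1 hy2.symm hcon.2.2).symm hz.ne' h12.ne

theorem IsAlmostSimplicial.nbr_of_no_common (hN : G.HasOuterNeighbors) {y u : V} (hy : G.IsAlmostSimplicial y)
    (hyu : G.Adj y u) (hcom : ∀ z, G.Adj y z → ¬ G.Adj u z) :
    (∃ z, G.Adj y z ∧ z ≠ u ∧ ∀ z', G.Adj y z' → z' = u ∨ z' = z) ∨
      ∃ z z', G.Adj y z ∧ G.Adj y z' ∧ G.Adj z z' ∧ z ≠ u ∧ z' ≠ u := by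
  obtain ⟨z, hyz, hzu, -⟩ := hN u y hyu.symm
  by_cases h : ∀ z', G.Adj y z' → z' = u ∨ z' = z
  · exact Or.inl ⟨z, hyz, hzu, h⟩
  · push Not at h
    obtain ⟨z', hyz', hz'u, hz'z⟩ := h
    refine Or.inr ⟨z, z', hyz, hyz', ?_, hzu, hz'u⟩
    obtain ⟨e, -, he⟩ := hy
    have heu : e = u := by
      by_contra heu
      by_cases h : e = z
      · exact hcom z' hyz' (he u z' hyu hyz' (Ne.symm heu) (fun h' => hz'z (h'.trans h))
          hz'u.symm)
      · exact hcom z hyz (he u z hyu hyz (Ne.symm heu) (Ne.symm h) hzu.symm)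
    subst heu
    exact he z z' hyz hyz' hzu hz'u (Ne.symm hz'z)

/-- A triangle `u i` with each `u i` having exactly one neighbour `y i` outside the triangle. -/
structure IsTriangleWithLegs (G : SimpleGraph V) (u y : Fin 3 → V) : Prop where
  adj : ∀ i j, i ≠ j → G.Adj (u i) (u j)
  adj_leg : ∀ i, G.Adj (u i) (y i)
  nbr : ∀ i z, G.Adj (u i) z → z = y i ∨ ∃ j, j ≠ i ∧ z = u j
  ne : ∀ i j, y i ≠ u j
  not_adj : ∀ i j, i ≠ j → ¬ G.Adj (y i) (u j)

namespace IsTriangleWithLegs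

variable {u y : Fin 3 → V} (H : G.IsTriangleWithLegs u y)
include H

theorem leg_ne {i j : Fin 3} (hij : i ≠ j) : y i ≠ y j := fun h =>
  H.not_adj j i hij.symm (h ▸ (H.adj_leg i).symm)

theorem legs_not_adj (h4 : G.FourCycleFree) {i j : Fin 3} (hij : i ≠ j) :
    ¬ G.Adj (y i) (y j) := fun h =>
  h4 (y i) (u i) (u j) (y j) (H.adj_leg i).symm (H.adj i j hij) (H.adj_leg j) h.symm (H.ne i j)
    (H.ne j i).symm

theorem legs_no_common (h5 : G.FiveCycleFree) {i j : Fin 3} (hij : i ≠ j)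
    {z : V} (hi : G.Adj (y i) z) (hj : G.Adj (y j) z) : False := by
  refine h5 (y i) (u i) (u j) (y j) z (H.adj_leg i).symm (H.adj i j hij) (H.adj_leg j) hj hi.symm
    (H.ne i j) (H.leg_ne hij) (H.ne j i).symm ?_ ?_
  · rintro rfl
    exact H.not_adj j i hij.symm hj
  · rintro rfl
    exact H.not_adj i j hij hi

theorem leg_no_common_nbr {i : Fin 3} {z : V} (hz : G.Adj (y i) z) : ¬ G.Adj (u i) z := fun h => by
  rcases H.nbr i z h with rfl | ⟨j, hj, rfl⟩
  · exact G.irrefl hz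
  · exact H.not_adj i j hj.symm hz

variable [Finite V] (hG : G.WellCovered) (h4 : G.FourCycleFree) (h5 : G.FiveCycleFree)
  (hN : G.HasOuterNeighbors)
include hG h4 h5 hN

/-- On the path `y i - u i - u j` the forced vertex `q` can only be `y j`. -/
theorem adj_of_leg_two {i j : Fin 3} (hij : i ≠ j) {z : V} (hyz : G.Adj (y i) z) (hzu : z ≠ u i)
    (hz : ∀ z', G.Adj (y i) z' → z' = u i ∨ z' = z) {s : V} (hzs : G.Adj z s) (hs : s ≠ y i)
    {r : V} (hr : G.Adj (y j) r) (hru : r ≠ u j) : G.Adj r s := by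
  have hyu : ∀ r, G.Adj (y j) r → ¬ G.Adj (u j) r := fun r => H.leg_no_common_nbr
  obtain ⟨q, huq, hqu, hq, -, hall, -⟩ :=
    hG.exists_dominated_one h4 h5 hN (x := y i) (y := u i) (p := u j) (z := z) (s := s)
    (H.adj_leg i).symm (H.adj i j hij) (H.ne i j) (H.not_adj i j hij)
    (fun a ha h _ => (hz a ha).resolve_left h) hyz hzu (H.leg_no_common_nbr hyz) hzs hs
    (fun h => by
      rcases hz s h with rfl | rfl
      · exact H.leg_no_common_nbr hyz hzs.symm
      · exact G.irrefl hzs)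
  rcases H.nbr j q huq with rfl | ⟨k, hk, rfl⟩
  · exact hall r hr hru (hyu r hr)
  · by_cases hki : i = k
    · exact absurd (hki ▸ rfl) hqu
    · exact absurd (H.adj i k hki) hq

theorem nbr_of_leg_two {i j : Fin 3} (hij : i ≠ j) {z : V} (hyz : G.Adj (y i) z) (hzu : z ≠ u i)
    (hz : ∀ z', G.Adj (y i) z' → z' = u i ∨ z' = z) {s : V} (hzs : G.Adj z s) (hs : s ≠ y i) :
    ∃ r, G.Adj (y j) r ∧ r ≠ u j ∧ ∀ r', G.Adj (y j) r' → r' = u j ∨ r' = r := by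
  obtain ⟨r, hr, hru, -⟩ := hN (u j) (y j) (H.adj_leg j)
  refine ⟨r, hr, hru, fun r' hr' => ?_⟩
  by_contra! hcon
  have h1 := H.adj_of_leg_two hG h4 h5 hN hij hyz hzu hz hzs hs hr hru
  have h2 := H.adj_of_leg_two hG h4 h5 hN hij hyz hzu hz hzs hs hr' hcon.1
  refine h4 (y j) r s r' hr h1 h2.symm hr'.symm ?_ hcon.2.symm
  rintro rfl
  exact H.legs_no_common h5 hij hyz hzs.symm

/-- The other legs then also have degree two, and the vertices beyond the three legs are pairwise
nonadjacent neighbours of `s`, which is almost simplicial. -/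
theorem not_leg_two (hA : ∀ w, G.IsAlmostSimplicial w) {i : Fin 3} {z : V} (hyz : G.Adj (y i) z)
    (hzu : z ≠ u i) (hz : ∀ z', G.Adj (y i) z' → z' = u i ∨ z' = z) : False := by
  obtain ⟨j, k, hij, hik, hjk, -⟩ := Fin.exists_others_three i
  obtain ⟨s, hzs, hs, -⟩ := hN (y i) z hyz
  have hadj := fun l (hl : i ≠ l) s hzs hs r =>
    H.adj_of_leg_two hG h4 h5 hN hl hyz hzu hz (s := s) hzs hs (r := r)
  obtain ⟨r, hr, hru, hr'⟩ := H.nbr_of_leg_two hG h4 h5 hN hij hyz hzu hz hzs hs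
  obtain ⟨t, ht, htu, ht'⟩ := H.nbr_of_leg_two hG h4 h5 hN hik hyz hzu hz hzs hs
  have hrs := hadj j hij s hzs hs r hr hru
  have hts := hadj k hik s hzs hs t ht htu
  have hzr : z ≠ r := by
    rintro rfl
    exact H.legs_no_common h5 hij hyz hr
  have hzt : z ≠ t := by
    rintro rfl
    exact H.legs_no_common h5 hik hyz ht
  have hrt : r ≠ t := by
    rintro rfl
    exact H.legs_no_common h5 hjk hr ht
  have nzr : ¬ G.Adj z r := fun h => G.irrefl (hadj j hij r h
    (fun h => H.legs_not_adj h4 hij (h ▸ hr.symm)) r hr hru)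
  have nzt : ¬ G.Adj z t := fun h => G.irrefl (hadj k hik t h
    (fun h => H.legs_not_adj h4 hik (h ▸ ht.symm)) t ht htu)
  have nrt : ¬ G.Adj r t := fun h => G.irrefl (H.adj_of_leg_two hG h4 h5 hN hjk hr hru hr' h
    (fun h => H.legs_not_adj h4 hjk (h ▸ ht.symm)) ht htu)
  rcases (hA s).adj_of_three hzs.symm hrs.symm hts.symm hzr hzt hrt with h | h | h
  exacts [nzr h, nzt h, nrt h]

/-- Every leg ends in a triangle. The neighbour `s` of `p 0` outside its triangle is adjacent to a
vertex of each of the other two, which again gives three pairwise nonadjacent neighbours of `s`. -/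
theorem false_of_almostSimplicial (hA : ∀ w, G.IsAlmostSimplicial w) : False := by
  have key : ∀ i, ∃ p p', G.Adj (y i) p ∧ G.Adj (y i) p' ∧ G.Adj p p' ∧ p ≠ u i ∧ p' ≠ u i ∧
      ∀ z, G.Adj (y i) z → z = u i ∨ z = p ∨ z = p' := by
    intro i
    rcases (hA (y i)).nbr_of_no_common hN (H.adj_leg i).symm
      (fun z hz => H.leg_no_common_nbr hz) with ⟨z, h1, h2, h3⟩ | ⟨z, z', h1, h2, h3, h4', h5'⟩
    · exact (H.not_leg_two hG h4 h5 hN hA h1 h2 h3).elim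
    · obtain ⟨w, -, -, -, -, -, hw⟩ := (hA (y i)).nbr_of_triangle h4 hN h1 h2 h3
      have := hw (u i) (H.adj_leg i).symm
      refine ⟨z, z', h1, h2, h3, h4', h5', fun a ha => ?_⟩
      have := hw a ha
      grind
  choose p p' hp hp' hpp hpu hpu' hall using key
  have hs : ∀ w w', G.Adj (y 0) w → G.Adj (y 0) w' → G.Adj w w' →
      ∃ s, G.Adj w s ∧ s ≠ y 0 ∧ ¬ G.Adj (y 0) s ∧
        ∀ b, G.Adj w b → b = s ∨ b = y 0 ∨ b = w' := by
    intro w w' hw hw' hww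
    obtain ⟨s, h1, h2, -, h3, -, h6⟩ := (hA w).nbr_of_triangle h4 hN hw.symm hww hw'
    exact ⟨s, h1, h2, fun h => h3 h.symm, h6⟩
  obtain ⟨s, hps, hsy, hys, hsn⟩ := hs _ _ (hp 0) (hp' 0) (hpp 0)
  obtain ⟨s', hps', hsy', hys', -⟩ := hs _ _ (hp' 0) (hp 0) (hpp 0).symm
  have hleg : ∀ j, 0 ≠ j → ∃ r, G.Adj (y j) r ∧ r ≠ u j ∧ G.Adj r s := by
    intro j hj
    obtain ⟨q, huq, hqu, hq, -, -, hdom, -⟩ :=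
      hG.exists_dominated_two h4 h5 hN (x := y 0) (y := u 0) (p := u j) (z₁ := p 0) (z₂ := p' 0)
      (s₁ := s) (s₂ := s') (H.adj_leg 0).symm (H.adj 0 j hj) (H.ne 0 j) (H.not_adj 0 j hj)
      (fun z hz h => (hall 0 z hz).resolve_left h) (hpp 0).ne
      ⟨hp 0, hpu 0, H.leg_no_common_nbr (hp 0), hps, hsy, hys⟩
      ⟨hp' 0, hpu' 0, H.leg_no_common_nbr (hp' 0), hps', hsy', hys'⟩
    have hqy : q = y j := by
      rcases H.nbr j q huq with h | ⟨k, hk, rfl⟩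
      · exact h
      · by_cases hk0 : 0 = k
        · exact absurd (hk0 ▸ rfl) hqu
        · exact absurd (H.adj 0 k hk0) hq
    subst hqy
    -- If `s` misses both `p j` and `p' j`, then `s'` is adjacent to both, which closes a 4-cycle
    -- through `y j`.
    by_contra! hcon
    have h1 := (hdom (p j) (hp j) (hpu j) (H.leg_no_common_nbr (hp j))).resolve_left
      (hcon _ (hp j) (hpu j))
    have h2 := (hdom (p' j) (hp' j) (hpu' j) (H.leg_no_common_nbr (hp' j))).resolve_left
      (hcon _ (hp' j) (hpu' j))
    refine h4 (y j) (p j) s' (p' j) (hp j) h1 h2.symm (hp' j).symm ?_ (hpp j).ne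
    rintro rfl
    exact H.legs_no_common h5 hj (hp' 0) hps'.symm
  obtain ⟨r, hr, hru, hrs⟩ := hleg 1 (by decide)
  obtain ⟨t, ht, htu, hts⟩ := hleg 2 (by decide)
  have hpr : ∀ j r, 0 ≠ j → G.Adj (y j) r → G.Adj r s → p 0 ≠ r ∧ ¬ G.Adj (p 0) r := by
    intro j r hj hr hrs
    refine ⟨fun h => H.legs_no_common h5 hj (hp 0) (h ▸ hr), fun h => ?_⟩
    rcases hsn r h with rfl | rfl | rfl
    · exact G.irrefl hrs
    · exact H.legs_not_adj h4 hj hr.symm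
    · exact H.legs_no_common h5 hj (hp' 0) hr
  have hrt : r ≠ t := by
    rintro rfl
    exact H.legs_no_common h5 (by decide : (1 : Fin 3) ≠ 2) hr ht
  obtain ⟨hpt1, hpt2⟩ := hpr 2 t (by decide) ht hts
  have h12 : (1 : Fin 3) ≠ 2 := by decide
  have h01 : (0 : Fin 3) ≠ 1 := by decide
  have hsy1 : ¬ G.Adj s (y 1) := by
    intro h
    have h1 : p 0 ≠ y 1 := fun h' => H.legs_not_adj h4 h01 (h' ▸ hp 0)
    have h2 : y 1 ≠ t := fun h' => H.legs_not_adj h4 h12 (h' ▸ ht.symm)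
    rcases (hA s).adj_of_three hps.symm h hts.symm h1 hpt1 h2 with h | h | h
    · exact H.legs_no_common h5 h01 (hp 0) h.symm
    · exact hpt2 h
    · exact H.legs_no_common h5 h12 h ht
  have nrt : ¬ G.Adj r t := by
    intro h
    obtain ⟨r', hr1, hrr'⟩ : ∃ r', G.Adj (y 1) r' ∧ G.Adj r r' := by
      rcases hall 1 r hr with h | h | h
      · exact absurd h hru
      · exact ⟨p' 1, hp' 1, h ▸ hpp 1⟩
      · exact ⟨p 1, hp 1, h ▸ (hpp 1).symm⟩
    have h1 : s ≠ y 1 := by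
      rintro rfl
      exact H.legs_no_common h5 h01 (hp 0) hps.symm
    have h2 : t ≠ y 1 := by
      rintro rfl
      exact H.legs_not_adj h4 h12.symm ht
    obtain ⟨e, -, -, -, -, -, he⟩ := (hA r).nbr_of_triangle h4 hN hr.symm hrr' hr1
    have h3 : t ≠ r' := fun h' => H.legs_no_common h5 h12 (h' ▸ hr1) ht
    have h4' : s ≠ r' := fun h' => hsy1 (h' ▸ hr1.symm)
    have h5' := ((he s hrs).resolve_right (by tauto))
    have h6 := ((he t h).resolve_right (by tauto))
    exact hts.ne (h6.trans h5'.symm)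
  obtain ⟨hpr1, hpr2⟩ := hpr 1 r (by decide) hr hrs
  rcases (hA s).adj_of_three hps.symm hrs.symm hts.symm hpr1 hpt1 hrt with h | h | h
  exacts [hpr2 h, hpt2 h, nrt h]

end IsTriangleWithLegs

section

variable [Finite V] (hG : G.WellCovered) (h4 : G.FourCycleFree) (h5 : G.FiveCycleFree)
  (hN : G.HasOuterNeighbors) (hA : ∀ w, G.IsAlmostSimplicial w)
include hG h4 h5 hN hA

theorem WellCovered.triangle_free {a b c : V} (hab : G.Adj a b) (hbc : G.Adj b c)
    (hca : G.Adj c a) : False := by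
  obtain ⟨y0, a1, a2, a3, a4, a5, a6⟩ := (hA a).nbr_of_triangle h4 hN hab hca.symm hbc
  obtain ⟨y1, b1, b2, b3, b4, b5, b6⟩ := (hA b).nbr_of_triangle h4 hN hbc hab.symm hca
  obtain ⟨y2, c1, c2, c3, c4, c5, c6⟩ := (hA c).nbr_of_triangle h4 hN hca hbc.symm hab
  have H : G.IsTriangleWithLegs ![a, b, c] ![y0, y1, y2] := by
    have hba := hab.symm; have hcb := hbc.symm; have hac := hca.symm
    have := a1.ne'; have := b1.ne'; have := c1.ne'
    constructor
    · intro i j hij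
      fin_cases i <;> fin_cases j <;> simp at hij ⊢ <;> assumption
    · intro i
      fin_cases i <;> simpa
    · intro i z h
      fin_cases i <;> simp [Fin.exists_fin_succ] at h ⊢ <;> grind
    · intro i j
      fin_cases i <;> fin_cases j <;> simp <;> assumption
    · intro i j hij
      fin_cases i <;> fin_cases j <;> simp at hij ⊢ <;> assumption
  exact H.false_of_almostSimplicial hG h4 h5 hN hA

/-- Without triangles every vertex has degree two, and the forced vertices `q` and `r` join the two
arms that leave `w`. -/
theorem WellCovered.exists_cycle_seven (w : V) :
    ∃ x : Fin 7 → V, IsComponentCopy (cycleGraph 7) G x ∧ w ∈ Set.range x := by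
  have h3 : ∀ a b c, G.Adj a b → G.Adj b c → G.Adj c a → False := fun a b c =>
    hG.triangle_free h4 h5 hN hA
  have hdeg : ∀ w a, G.Adj w a → ∃ b, G.Adj w b ∧ b ≠ a ∧ ∀ c, G.Adj w c → c = a ∨ c = b := by
    intro w a hwa
    rcases (hA w).nbr_of_no_common hN hwa (fun z hz h => h3 w a z hwa h hz.symm) with
      h | ⟨z, z', h1, h2, h, -⟩
    · exact h
    · exact (h3 _ _ _ h1 h h2.symm).elim
  obtain ⟨y, hwy, -⟩ := hA w
  obtain ⟨z, hwz, hzy, hwn⟩ := hdeg w y hwy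
  obtain ⟨p, hyp, hpw, hyn⟩ := hdeg y w hwy.symm
  obtain ⟨s, hzs, hsw, hzn⟩ := hdeg z w hwz.symm
  have hnwp : ¬ G.Adj w p := fun h => h3 w y p hwy hyp h.symm
  have hnws : ¬ G.Adj w s := fun h => h3 w z s hwz hzs h.symm
  have hnyz : ¬ G.Adj y z := fun h => h3 w y z hwy h hwz.symm
  obtain ⟨q, hpq, hqy, hnyq, hnqs, -, r, hqr, hrp, hnpr, hrs⟩ :=
    hG.exists_dominated_one h4 h5 hN hwy hyp hpw.symm hnwp
    (fun a ha h _ => (hwn a ha).resolve_left h) hwz hzy hnyz hzs hsw hnws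
  obtain ⟨q', -, -, hpn⟩ := hdeg p y hyp.symm
  obtain ⟨r', -, -, hqn⟩ := hdeg q p hpq.symm
  obtain ⟨s', -, -, hrn⟩ := hdeg r q hqr.symm
  obtain ⟨z', -, -, hsn⟩ := hdeg s r hrs.symm
  have hqs : q ≠ s := by
    rintro rfl
    exact h5 y w z q p hwy.symm hwz hzs hpq.symm hyp.symm hzy.symm hqy.symm hsw.symm hpw.symm
      (fun h => hnwp (h ▸ hwz))
  have hrz : r ≠ z := by
    rintro rfl
    exact h5 w y p q r hwy hyp hpq hqr hwz.symm hpw.symm (fun h => hnwp (h ▸ hpq.symm)) hqy.symm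
      hzy.symm hrp.symm
  have hyqs : ∀ a b, G.Adj a b → G.Adj b a := fun a b h => h.symm
  have hqw : q ≠ w := fun h => hnwp (h ▸ hpq.symm)
  have hrw : r ≠ w := by
    rintro rfl
    exact h4 r y p q hwy hyp hpq hqr hpw.symm hqy.symm
  have hry : r ≠ y := by rintro rfl; exact hnyq hqr.symm
  have hys : y ≠ s := by rintro rfl; exact hnyz hzs.symm
  have hps : p ≠ s := by
    rintro rfl
    exact h4 w y p z hwy hyp hzs.symm hwz.symm hpw.symm hzy.symm
  have hpz : p ≠ z := by rintro rfl; exact hnwp hwz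
  have hqz : q ≠ z := by
    rintro rfl
    exact h4 w y p q hwy hyp hpq hwz.symm hpw.symm hqy.symm
  have hne : ∀ a b, G.Adj a b → a ≠ b := fun a b h => h.ne
  refine ⟨![w, y, p, q, r, s, z], isComponentCopy_cycleGraph_seven ?_ ?_ ?_, 0, rfl⟩
  · have h1 := hne _ _ hwy; have h2 := hne _ _ hyp; have h3 := hne _ _ hpq; have h4 := hne _ _ hqr
    have h5 := hne _ _ hrs; have h6 := hne _ _ hzs; have h7 := hne _ _ hwz
    intro i j hij
    fin_cases i <;> fin_cases j <;> simp at hij ⊢ <;> grind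
  · intro i
    fin_cases i <;> simp <;> grind
  · have e1 := hpn q hpq; have e2 := hqn r hqr; have e3 := hrn s hrs; have e4 := hsn z hzs.symm
    intro i u hu
    fin_cases i
    · exact hwn u hu
    · exact (hyn u hu).symm
    · have : u = q ∨ u = y := by have := hpn u hu; grind
      exact this
    · have : u = r ∨ u = p := by have := hqn u hu; grind
      exact this
    · have : u = s ∨ u = q := by have := hrn u hu; grind
      exact this
    · have : u = z ∨ u = r := by have := hsn u hu; grind
      exact this
    · exact hzn u hu

end

end SimpleGraph

/-! ### The structure theorem for well-covered graphs without 4- and 5-cycles -/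

theorem graphT10_adj (i j : Fin 10) : graphT10.Adj i j ↔
    s(i, j) ∈ ({s(0, 1), s(0, 2), s(0, 3), s(1, 4), s(2, 5), s(3, 6), s(4, 7), s(5, 8), s(6, 9),
      s(7, 8), s(8, 9), s(7, 9)} : Finset (Sym2 (Fin 10))) := by
  rw [graphT10, SimpleGraph.fromEdgeSet_adj]
  simp only [Finset.mem_insert, Finset.mem_singleton, Set.mem_insert_iff, Set.mem_singleton_iff]
  refine ⟨fun h => h.1, fun h => ⟨h, ?_⟩⟩
  rintro rfl
  revert h
  revert i
  decide

instance : DecidableRel graphT10.Adj := fun i j => decidable_of_iff _ (graphT10_adj i j).symm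

/-- The neighbours of a vertex of `T₁₀`. -/
def nbrsT10 : Fin 10 → List (Fin 10) :=
  ![[1, 2, 3], [0, 4], [0, 5], [0, 6], [1, 7], [2, 8], [3, 9], [4, 8, 9], [5, 7, 9], [6, 7, 8]]

theorem graphT10_adj_iff_mem_nbrsT10 : ∀ i j, graphT10.Adj i j ↔ j ∈ nbrsT10 i := by
  decide

namespace SimpleGraph

variable {V : Type u} {G : SimpleGraph V}

/-- The neighbours of `t` are pairwise adjacent. -/
def IsSimplicialVertex (G : SimpleGraph V) (t : V) : Prop :=
  ∀ a b, G.Adj t a → G.Adj t b → a ≠ b → G.Adj a b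

/-- `w` lies in the closed neighbourhood of a simplicial vertex. -/
def InSimplex (G : SimpleGraph V) (w : V) : Prop :=
  ∃ t, G.IsSimplicialVertex t ∧ (t = w ∨ G.Adj t w)

theorem Reachable.mem_of_closed {P : Set V} (hP : ∀ a ∈ P, ∀ b, G.Adj a b → b ∈ P) {a b : V}
    (h : G.Reachable a b) (ha : a ∈ P) : b ∈ P := by
  obtain ⟨p⟩ := h
  induction p with
  | nil => exact ha
  | cons hadj p ih => exact ih (hP _ ha _ hadj)

/-- If all neighbours of `y` lay in `N[x]`, at most one besides `x` could exist without a 4-cycle.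
Then `y` would be simplicial, with `x` in its simplex. -/
theorem FourCycleFree.exists_outer_of_not_inSimplex (h4 : G.FourCycleFree) {x y : V}
    (hx : ¬ G.InSimplex x) (hxy : G.Adj x y) : ∃ z, G.Adj y z ∧ z ≠ x ∧ ¬ G.Adj x z := by
  by_contra! h
  refine hx ⟨y, fun a b ha hb hab => ?_, Or.inr hxy.symm⟩
  by_cases hax : a = x
  · subst hax
    exact h b hb hab.symm
  by_cases hbx : b = x
  · subst hbx
    exact (h a ha hab).symm
  exact (h4 a x b y (h a ha hax).symm (h b hb hbx) hb.symm ha hab hxy.ne).elim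

/-- On the path `x - y - t` the forced vertex `q` is a neighbour of the simplicial vertex `t` not
adjacent to `y`. -/
theorem WellCovered.not_inSimplex_of_adj [Finite V] (hG : G.WellCovered) (h4 : G.FourCycleFree)
    (h5 : G.FiveCycleFree) {x y : V} (hx : ¬ G.InSimplex x) (hxy : G.Adj x y) :
    ¬ G.InSimplex y := by
  rintro ⟨t, ht, rfl | hty⟩
  · exact hx ⟨t, ht, Or.inr hxy.symm⟩
  · have hxt : x ≠ t := fun h => hx ⟨t, ht, Or.inl h.symm⟩
    have hnxt : ¬ G.Adj x t := fun h => hx ⟨t, ht, Or.inr h.symm⟩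
    have hs := fun z (hz : G.Adj x z) => h4.exists_outer_of_not_inSimplex hx hz
    choose! s hs using hs
    obtain ⟨q, hq, hqy, hyq, -⟩ := hG.exists_dominated h4 h5 hxy hty.symm hxt hnxt s
      (fun z hz _ _ => hs z hz)
    exact hyq (ht y q hty hq hqy.symm)

/-- Adding `S` makes a maximal stable set of the induced graph maximal in `G` and shifts all sizes
equally. -/
theorem WellCovered.induce [Finite V] (hG : G.WellCovered) {S U : Set V}
    (hS : ∀ a ∈ S, ∀ b ∈ S, ¬ G.Adj a b) (hU : ∀ u, u ∈ U ↔ u ∉ S ∧ ∀ s ∈ S, ¬ G.Adj s u) :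
    (G.induce U).WellCovered := by
  have key : ∀ A : Set U, (G.induce U).IsMaxStable A →
      G.IsMaxStable (Subtype.val '' A ∪ S) ∧
        (Subtype.val '' A ∪ S).ncard = A.ncard + S.ncard := by
    intro A hA
    refine ⟨⟨?_, fun x hx => ?_⟩, ?_⟩
    · rintro _ (⟨a, ha, rfl⟩ | ha) _ (⟨b, hb, rfl⟩ | hb)
      · exact hA.1 a ha b hb
      · exact fun h => ((hU a).1 a.2).2 _ hb h.symm
      · exact fun h => ((hU b).1 b.2).2 _ ha h
      · exact hS _ ha _ hb
    · by_cases hxU : x ∈ U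
      · obtain ⟨a, ha, h⟩ := hA.2 ⟨x, hxU⟩ fun h => hx (Or.inl ⟨_, h, rfl⟩)
        exact ⟨a, Or.inl ⟨a, ha, rfl⟩, h⟩
      · rw [hU] at hxU
        push Not at hxU
        obtain ⟨s, hs, h⟩ := hxU fun h => hx (Or.inr h)
        exact ⟨s, Or.inr hs, h.symm⟩
    · rw [Set.ncard_union_eq ?_ (Set.toFinite _) (Set.toFinite _),
        Set.ncard_image_of_injective _ Subtype.val_injective]
      rw [Set.disjoint_left]
      rintro _ ⟨a, -, rfl⟩ h
      exact ((hU a).1 a.2).1 h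
  intro A B hA hB
  obtain ⟨hA1, hA2⟩ := key A hA
  obtain ⟨hB1, hB2⟩ := key B hB
  have := hG _ _ hA1 hB1
  omega

theorem FourCycleFree.induce (h4 : G.FourCycleFree) (U : Set V) : (G.induce U).FourCycleFree :=
  fun a b c d h1 h2 h3 h4' hac hbd => h4 a b c d h1 h2 h3 h4' (fun h => hac (Subtype.ext h))
    (fun h => hbd (Subtype.ext h))

theorem FiveCycleFree.induce (h5 : G.FiveCycleFree) (U : Set V) : (G.induce U).FiveCycleFree :=
  fun a b c d e h1 h2 h3 h4 h5' n1 n2 n3 n4 n5 => h5 a b c d e h1 h2 h3 h4 h5'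
    (fun h => n1 (Subtype.ext h)) (fun h => n2 (Subtype.ext h)) (fun h => n3 (Subtype.ext h))
    (fun h => n4 (Subtype.ext h)) (fun h => n5 (Subtype.ext h))

/-- The vertices at distance at least two from `v`. -/
def farSet (G : SimpleGraph V) (v : V) : Set V := {u | u ≠ v ∧ ¬ G.Adj v u}

theorem IsComponentCopy.adj_iff {n : ℕ} {H : SimpleGraph (Fin n)} {f : Fin n → V}
    (hf : IsComponentCopy H G f) (i j : Fin n) : G.Adj (f i) (f j) ↔ H.Adj i j := by
  rw [hf.2]
  exact ⟨fun ⟨k, hk, h⟩ => hf.1 h ▸ hk, fun h => ⟨j, h, rfl⟩⟩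

theorem isComponentCopy_graphT10 {f : Fin 10 → V} (hf : Function.Injective f)
    (h : ∀ i u, G.Adj (f i) u ↔ ∃ j ∈ nbrsT10 i, u = f j) : IsComponentCopy graphT10 G f :=
  ⟨hf, fun i u => by simp only [graphT10_adj_iff_mem_nbrsT10, h]⟩

theorem IsC7Outside.exists_graphT10_copy [Finite V] {v : V} {x : Fin 7 → V}
    (H : G.IsC7Outside v x) (hG : G.WellCovered) (h4 : G.FourCycleFree) (h5 : G.FiveCycleFree)
    (hN : G.HasOuterNeighbors) {y : V} (hvy : G.Adj v y) (h0 : G.Adj (x 0) y)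
    (h1 : ¬ G.Adj (x 1) y) (h6 : ¬ G.Adj (x 6) y) :
    ∃ f : Fin 10 → V, IsComponentCopy graphT10 G f := by
  obtain ⟨z, hzy, hzv, hyv, hxy, hxz, n0, n1, n2, n3, n4, n5, n6, ny, nv, nz⟩ :=
    H.exists_nbr_eq hG h4 h5 hN hvy h0 h1 h6
  -- The centre is `x 0`; its arms run through `x 1`, `x 6`, `y` and then `x 2`, `x 5`, `v` to the
  -- triangle `x 3`, `x 4`, `z`.
  refine ⟨![x 0, x 1, x 6, y, x 2, x 5, v, x 3, x 4, z], isComponentCopy_graphT10 ?_ ?_⟩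
  · have hxv := H.ne
    have hx : ∀ i j, x i = x j ↔ i = j := fun i j => H.inj.eq_iff
    have hyx : ∀ i, y ≠ x i := fun i => (hxy i).symm
    have hzx : ∀ i, z ≠ x i := fun i => (hxz i).symm
    have hvx : ∀ i, v ≠ x i := fun i => (hxv i).symm
    intro i j hij
    fin_cases i <;> fin_cases j <;>
      simp [hx, hxy, hxz, hxv, hyx, hzx, hvx, hzy, hzy.symm, hzv, hzv.symm, hyv, hyv.symm]
        at hij ⊢
  · intro i u
    fin_cases i <;> simp [nbrsT10, n0, n1, n2, n3, n4, n5, n6, ny, nv, nz]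

theorem cycleGraph_seven_nbr :
    ∀ i₀ i l : Fin 7, (cycleGraph 7).Adj (i + i₀) l → l = i + 1 + i₀ ∨ l = i - 1 + i₀ := by
  decide

/-- The shift by `i₀` rotates a prescribed vertex to position zero. -/
theorem isC7Outside_of_copy {v : V} {f : Fin 7 → G.farSet v}
    (hf : IsComponentCopy (cycleGraph 7) (G.induce (G.farSet v)) f) (i₀ : Fin 7) :
    G.IsC7Outside v (fun i => (f (i + i₀) : V)) where
  adj i j hij := by
    have : ∀ i : Fin 7, (cycleGraph 7).Adj (i + i₀) (i + 1 + i₀) := by revert i₀; decide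
    subst hij
    exact (hf.adj_iff _ _).2 (this i)
  nbr i j k hj hk u h := by
    by_cases hu : u ∈ G.farSet v
    · obtain ⟨l, hl, hul⟩ := (hf.2 (i + i₀) ⟨u, hu⟩).1 h
      have hul' : u = f l := congrArg Subtype.val hul
      subst hj hk
      rcases cycleGraph_seven_nbr i₀ i l hl with rfl | rfl
      · exact Or.inl hul'
      · exact Or.inr (Or.inl hul')
    · simp only [farSet, Set.mem_ofPred_eq] at hu
      push Not at hu
      refine Or.inr (Or.inr (hu ?_))
      rintro rfl
      exact (f (i + i₀)).2.2 h.symm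
  not_adj i := (f _).2.2
  ne i := (f _).2.1
  inj i j h := add_right_cancel (hf.1 (Subtype.ext h))

theorem isT10Outside_of_copy {v : V} {f : Fin 10 → G.farSet v}
    (hf : IsComponentCopy graphT10 (G.induce (G.farSet v)) f) :
    G.IsT10Outside v (f 0) (fun i => f (![1, 2, 3] i)) (fun i => f (![4, 5, 6] i))
      (fun i => f (![7, 8, 9] i)) := by
  have hadj : ∀ i j, graphT10.Adj i j → G.Adj (f i) (f j) := fun i j h => (hf.adj_iff i j).2 h
  have hnbr : ∀ i u, G.Adj (f i) u → (∃ j ∈ nbrsT10 i, u = f j) ∨ G.Adj v u := by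
    intro i u h
    by_cases hu : u ∈ G.farSet v
    · obtain ⟨l, hl, hul⟩ := (hf.2 i ⟨u, hu⟩).1 h
      exact Or.inl ⟨l, (graphT10_adj_iff_mem_nbrsT10 i l).1 hl, congrArg Subtype.val hul⟩
    · simp only [farSet, Set.mem_ofPred_eq] at hu
      push Not at hu
      refine Or.inr (hu ?_)
      rintro rfl
      exact (f i).2.2 h.symm
  have hinj : ∀ i j, (f i : V) = f j → i = j := fun i j h => hf.1 (Subtype.ext h)
  have hne : ∀ i j, i ≠ j → (f i : V) ≠ f j := fun i j h h' => h (hinj i j h')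
  constructor
  · exact fun i => hadj _ _ (by revert i; decide)
  · exact fun i => hadj _ _ (by revert i; decide)
  · exact fun i => hadj _ _ (by revert i; decide)
  · exact fun i j hij => hadj _ _ (by revert i j; decide)
  · intro u h
    have := hnbr _ u h
    simpa [nbrsT10, Fin.exists_fin_succ] using this
  · intro i u h
    have := hnbr _ u h
    fin_cases i <;> simpa [nbrsT10, or_assoc] using this
  · intro i u h
    have := hnbr _ u h
    fin_cases i <;> simpa [nbrsT10, or_assoc] using this
  · intro i u h
    have := hnbr _ u h
    fin_cases i <;> simp [nbrsT10, Fin.exists_fin_succ] at this ⊢ <;> tauto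
  · exact ⟨(f 0).2.2, (f 0).2.1⟩
  · exact fun i => ⟨(f _).2.2, (f _).2.1⟩
  · exact fun i => ⟨(f _).2.2, (f _).2.1⟩
  · exact fun i => ⟨(f _).2.2, (f _).2.1⟩
  · intro i j h
    have := hinj _ _ h
    clear h
    revert i j; decide
  · intro i j h
    have := hinj _ _ h
    clear h
    revert i j; decide
  · intro i j h
    have := hinj _ _ h
    clear h
    revert i j; decide
  · exact fun i => hne _ _ (by revert i; decide)
  · exact fun i => hne _ _ (by revert i; decide)
  · exact fun i j => hne _ _ (by revert i j; decide)
  · exact fun i j => hne _ _ (by revert i j; decide)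
  · exact fun i j => hne _ _ (by revert i j; decide)

/-- Every vertex lies in a simplex, or in a component which is a seven-cycle or `T₁₀`. -/
def SimplexOrExceptional (G : SimpleGraph V) (w : V) : Prop :=
  G.InSimplex w ∨
    (∃ f : Fin 7 → V, IsComponentCopy (cycleGraph 7) G f ∧ w ∈ Set.range f) ∨
      ∃ f : Fin 10 → V, IsComponentCopy graphT10 G f ∧ w ∈ Set.range f

/-- If `w` is not almost simplicial, take an induced path `w - y - v` and delete `N[v]`. A simplex
containing `w` would make `w` almost simplicial or leave it without outer neighbours; a `T₁₀` could
not be adjacent to `y`. So `w` lies on a `C₇`, and this extends to `T₁₀`. -/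
theorem WellCovered.exists_copy [Finite V] [Nonempty V] (hG : G.WellCovered)
    (h4 : G.FourCycleFree) (h5 : G.FiveCycleFree) (hN : G.HasOuterNeighbors)
    (hnb : ∀ w, ∃ y, G.Adj w y)
    (IH : ∀ v, ∀ w : G.farSet v, (G.induce (G.farSet v)).SimplexOrExceptional w) :
    (∃ f : Fin 7 → V, IsComponentCopy (cycleGraph 7) G f) ∨
      ∃ f : Fin 10 → V, IsComponentCopy graphT10 G f := by
  by_cases hA : ∀ w, G.IsAlmostSimplicial w
  · obtain ⟨w⟩ := ‹Nonempty V›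
    obtain ⟨f, hf, -⟩ := hG.exists_cycle_seven h4 h5 hN hA w
    exact Or.inl ⟨f, hf⟩
  right
  push Not at hA
  obtain ⟨w, hw⟩ := hA
  obtain ⟨y, hwy⟩ := hnb w
  obtain ⟨v, hyv, hvw, hwv⟩ := hN w y hwy
  have hwU : w ∈ G.farSet v := ⟨hvw.symm, fun h => hwv h.symm⟩
  have hfar : ∀ u, u ∉ G.farSet v → u = v ∨ G.Adj v u := by
    intro u hu
    simp only [farSet, Set.mem_ofPred_eq] at hu
    tauto
  rcases IH v ⟨w, hwU⟩ with ⟨⟨t, htU⟩, ht, htw⟩ | ⟨f, hf, i₀, hi₀⟩ | ⟨f, hf, i₀, hi₀⟩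
  · exfalso
    have ht' : ∀ a b, a ∈ G.farSet v → b ∈ G.farSet v → G.Adj t a → G.Adj t b → a ≠ b →
        G.Adj a b := fun a b ha hb hta htb hab =>
      ht ⟨a, ha⟩ ⟨b, hb⟩ hta htb (fun h => hab (congrArg Subtype.val h))
    rcases htw with htw | htw
    · have htw' : t = w := congrArg Subtype.val htw
      subst htw'
      refine hw ⟨y, hwy, fun a b ha hb hay hby hab => ?_⟩
      have hmem : ∀ a, G.Adj t a → a ≠ y → a ∈ G.farSet v := by
        intro a ha hay
        by_contra hau
        rcases hfar a hau with rfl | h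
        · exact htU.2 ha.symm
        · exact hay (h4.parent_unique htU.1 h hyv.symm ha hwy)
      exact ht' a b (hmem a ha hay) (hmem b hb hby) ha hb hab
    · have htw' : G.Adj t w := htw
      have hmem : ∀ a, G.Adj t a → a ∈ G.farSet v ∨ a = y := by
        intro a ha
        by_contra! hau
        rcases hfar a hau.1 with rfl | h
        · exact htU.2 ha.symm
        · exact hau.2 (h5.parent_unique htU.1 hwU.1 htU.2 hwU.2 htw' h hyv.symm ha hwy)
      have hyt : ∀ b, G.Adj t y → G.Adj t b → b ∈ G.farSet v → G.Adj y b := by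
        intro b hty htb hb
        by_cases hbw : b = w
        · exact hbw ▸ hwy.symm
        · exact (h4 y w b t hwy.symm (ht' w b hwU hb htw' htb (Ne.symm hbw)) htb.symm hty
            (fun h => hb.2 (h ▸ hyv.symm)) htw'.ne').elim
      obtain ⟨z, htz, hzw, hwz⟩ := hN w t htw'.symm
      rcases hmem z htz with hz | rfl
      · exact hwz (ht' w z hwU hz htw' htz hzw.symm)
      · exact hwz hwy
  · have H := isC7Outside_of_copy hf i₀
    have h0 : (f (0 + i₀) : V) = w := by rw [zero_add, hi₀]
    have hwn : ∀ a, G.Adj w a → a = f (1 + i₀) ∨ a = f (6 + i₀) ∨ a = y := by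
      intro a ha
      rcases H.nbr 0 1 6 rfl rfl a (by rw [h0]; exact ha) with h | h | h
      · exact Or.inl h
      · exact Or.inr (Or.inl h)
      · exact Or.inr (Or.inr (h4.parent_unique hwU.1 h hyv.symm ha hwy))
    have h01 : G.Adj w (f (1 + i₀)) := h0 ▸ H.adj 0 1 rfl
    have h06 : G.Adj w (f (6 + i₀)) := h0 ▸ (H.adj 6 0 rfl).symm
    -- If `y` is adjacent to a cycle neighbour of `w`, the other cycle neighbour is the only
    -- exception and `w` is almost simplicial.
    refine H.exists_graphT10_copy hG h4 h5 hN hyv.symm (h0.symm ▸ hwy) (fun h => hw ?_)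
      (fun h => hw ?_)
    · refine ⟨_, h06, fun a b ha hb ha6 hb6 hab => ?_⟩
      have h' : G.Adj y (f (1 + i₀)) := h.symm
      rcases hwn a ha with rfl | rfl | rfl <;> rcases hwn b hb with rfl | rfl | rfl <;>
        first | exact absurd rfl ha6 | exact absurd rfl hb6 | exact absurd rfl hab | exact h |
          exact h'
    · refine ⟨_, h01, fun a b ha hb ha6 hb6 hab => ?_⟩
      have h' : G.Adj y (f (6 + i₀)) := h.symm
      rcases hwn a ha with rfl | rfl | rfl <;> rcases hwn b hb with rfl | rfl | rfl <;>
        first | exact absurd rfl ha6 | exact absurd rfl hb6 | exact absurd rfl hab | exact h |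
          exact h'
  · exfalso
    have H := isT10Outside_of_copy hf
    have hi : (f i₀ : V) = w := congrArg Subtype.val hi₀
    have ht := H.not_attached_t hG h4 h5 hN hyv.symm
    have ha := fun i => H.not_attached_a hG h4 h5 hN i hyv.symm
    have hb := fun i => H.not_attached_b hG h4 h5 hN i hyv.symm
    have hc := fun i => H.not_attached_c hG h4 h5 hN i hyv.symm
    rw [← hi] at hwy
    fin_cases i₀
    exacts [ht hwy, ha 0 hwy, ha 1 hwy, ha 2 hwy, hb 0 hwy, hb 1 hwy, hb 2 hwy, hc 0 hwy, hc 1 hwy,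
      hc 2 hwy]

theorem IsComponentCopy.map_val {n : ℕ} {H : SimpleGraph (Fin n)} {U : Set V} {f : Fin n → U}
    (hf : IsComponentCopy H (G.induce U) f) (hU : ∀ a ∈ U, ∀ b, G.Adj a b → b ∈ U) :
    IsComponentCopy H G (fun i => (f i : V)) := by
  refine ⟨Subtype.val_injective.comp hf.1, fun i u => ⟨fun h => ?_, ?_⟩⟩
  · obtain ⟨j, hj, hu⟩ := (hf.2 i ⟨u, hU _ (f i).2 _ h⟩).1 h
    exact ⟨j, hj, congrArg Subtype.val hu⟩
  · rintro ⟨j, hj, rfl⟩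
    exact (hf.2 i (f j)).2 ⟨j, hj, rfl⟩

theorem IsComponentCopy.mem_range_of_reachable {n : ℕ} {H : SimpleGraph (Fin n)} {f : Fin n → V}
    (hf : IsComponentCopy H G f) {i : Fin n} {w : V} (h : G.Reachable (f i) w) :
    w ∈ Set.range f := by
  refine h.mem_of_closed (P := Set.range f) ?_ ⟨i, rfl⟩
  rintro _ ⟨j, rfl⟩ b hb
  obtain ⟨k, -, rfl⟩ := (hf.2 j b).1 hb
  exact ⟨k, rfl⟩

/-- A vertex of a well-covered graph without cycles of length four or five lies in a simplex or in
a component which is a seven-cycle or `T₁₀` (Finbow, Hartnell and Nowakowski). -/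
theorem WellCovered.simplexOrExceptional : ∀ (n : ℕ) (V : Type u) [Finite V] (G : SimpleGraph V),
    Nat.card V = n → G.WellCovered → G.FourCycleFree → G.FiveCycleFree →
      ∀ w, G.SimplexOrExceptional w := by
  intro n
  induction n using Nat.strong_induction_on with
  | _ n ih =>
  intro V _ G hn hG h4 h5 w
  by_cases hw : G.InSimplex w
  · exact Or.inl hw
  right
  let U : Set V := {x | G.Reachable w x}
  have hwU : w ∈ U := Reachable.refl w
  have hUc : ∀ a ∈ U, ∀ b, G.Adj a b → b ∈ U := fun a ha b hab =>
    Reachable.trans ha hab.reachable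
  -- Lying in no simplex spreads along edges to the whole component.
  have hbad : ∀ x ∈ U, ¬ G.InSimplex x := fun x hx =>
    (Reachable.mem_of_closed (P := {x | ¬ G.InSimplex x})
      (fun a ha b hab => hG.not_inSimplex_of_adj h4 h5 ha hab) hx hw)
  obtain ⟨S, -, hSU, hS, hS'⟩ := G.exists_maximal_stable_within (A := ∅) (U := Uᶜ)
    (Set.empty_subset _) (by simp)
  have hGU : (G.induce U).WellCovered := hG.induce hS fun u => by
    constructor
    · exact fun hu => ⟨fun h => hSU h hu, fun s hs h => hSU hs (hUc u hu s h.symm)⟩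
    · rintro ⟨h1, h2⟩
      by_contra hu
      obtain ⟨b, hb, h⟩ := hS' u hu h1
      exact h2 b hb h.symm
  have hNU : (G.induce U).HasOuterNeighbors := by
    intro x y hxy
    obtain ⟨z, h1, h2, h3⟩ := h4.exists_outer_of_not_inSimplex (hbad x x.2) hxy
    exact ⟨⟨z, hUc y y.2 z h1⟩, h1, fun h => h2 (congrArg Subtype.val h), h3⟩
  have hnb : ∀ x, ∃ y, (G.induce U).Adj x y := by
    intro x
    by_contra! hx
    refine hbad x x.2 ⟨x, fun a b ha => ?_, Or.inl rfl⟩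
    exact absurd ha (hx ⟨a, hUc x x.2 a ha⟩)
  have : Nonempty U := ⟨⟨w, hwU⟩⟩
  have IH : ∀ v, ∀ x : (G.induce U).farSet v,
      ((G.induce U).induce ((G.induce U).farSet v)).SimplexOrExceptional x := by
    intro v
    refine ih _ ?_ _ _ rfl (hGU.induce (S := {v}) ?_ ?_) ((h4.induce U).induce _)
      ((h5.induce U).induce _)
    · have h1 : Nat.card ((G.induce U).farSet v) < Nat.card U :=
        Finite.card_subtype_lt (x := v) (fun h => h.1 rfl)
      have h2 : Nat.card U ≤ Nat.card V := Finite.card_subtype_le _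
      omega
    · simp
    · simp [farSet]
  rcases hGU.exists_copy (h4.induce U) (h5.induce U) hNU hnb IH with ⟨f, hf⟩ | ⟨f, hf⟩
  · exact Or.inl ⟨_, hf.map_val hUc, (hf.map_val hUc).mem_range_of_reachable (f 0).2.symm⟩
  · exact Or.inr ⟨_, hf.map_val hUc, (hf.map_val hUc).mem_range_of_reachable (f 0).2.symm⟩

theorem IsComponentCopy.nonempty_iso {n : ℕ} {H : SimpleGraph (Fin n)} {f : Fin n → V}
    (hf : IsComponentCopy H G f) (hc : G.Connected) {i : Fin n} : Nonempty (G ≃g H) := by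
  have hsurj : Function.Surjective f := fun w => hf.mem_range_of_reachable (hc.preconnected (f i) w)
  exact ⟨(RelIso.mk (Equiv.ofBijective f ⟨hf.1, hsurj⟩) (fun {a b} => hf.adj_iff a b)).symm⟩

theorem WellCovered.inSimplex_or_iso [Finite V] (hG : G.WellCovered) (hc : G.Connected)
    (h4 : G.FourCycleFree) (h5 : G.FiveCycleFree) :
    (∀ w, G.InSimplex w) ∨ Nonempty (G ≃g cycleGraph 7) ∨ Nonempty (G ≃g graphT10) := by
  by_contra! hcon
  obtain ⟨⟨w, hw⟩, h7, h10⟩ := hcon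
  rcases WellCovered.simplexOrExceptional _ V G rfl hG h4 h5 w with h | ⟨f, hf, i, -⟩ | ⟨f, hf, i, -⟩
  · exact hw h
  · exact not_isEmpty_iff.2 (hf.nonempty_iso hc (i := i)) h7
  · exact not_isEmpty_iff.2 (hf.nonempty_iso hc (i := i)) h10

end SimpleGraph

/-! ### Finite checks on `C₇` and `T₁₀` -/

namespace SimpleGraph

variable {V : Type u} {G : SimpleGraph V}

theorem IsMaxStable.image {W : Type*} {H : SimpleGraph W} {A : Set V} (hA : G.IsMaxStable A)
    (e : G ≃g H) : H.IsMaxStable (e '' A) := by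
  refine ⟨?_, fun x hx => ?_⟩
  · rintro _ ⟨a, ha, rfl⟩ _ ⟨b, hb, rfl⟩ h
    exact hA.1 a ha b hb (e.map_adj_iff.1 h)
  · obtain ⟨x, rfl⟩ := e.surjective x
    obtain ⟨a, ha, h⟩ := hA.2 x fun h => hx ⟨x, h, rfl⟩
    exact ⟨e a, ⟨a, ha, rfl⟩, e.map_adj_iff.2 h⟩

theorem WellCovered.of_iso {W : Type*} {H : SimpleGraph W} (hH : H.WellCovered) (e : G ≃g H) :
    G.WellCovered := by
  intro A B hA hB
  have := hH _ _ (hA.image e) (hB.image e)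
  rwa [Set.ncard_image_of_injective _ e.injective, Set.ncard_image_of_injective _ e.injective]
    at this

/-- The Booleans encode membership: the premises are stability and domination, and `decide` runs
through all subsets. -/
theorem wellCovered_cycleGraph_seven_bool : ∀ b₀ b₁ b₂ b₃ b₄ b₅ b₆ : Bool,
    (!(b₀ && b₁) && !(b₁ && b₂) && !(b₂ && b₃) && !(b₃ && b₄) && !(b₄ && b₅) && !(b₅ && b₆) &&
      !(b₆ && b₀)) = true →
    ((b₀ || b₁ || b₆) && (b₁ || b₂ || b₀) && (b₂ || b₃ || b₁) && (b₃ || b₄ || b₂) &&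
      (b₄ || b₅ || b₃) && (b₅ || b₆ || b₄) && (b₆ || b₀ || b₅)) = true →
    b₀.toNat + b₁.toNat + b₂.toNat + b₃.toNat + b₄.toNat + b₅.toNat + b₆.toNat = 3 := by
  decide

theorem wellCovered_graphT10_bool : ∀ v a₁ a₂ a₃ b₁ b₂ b₃ c₁ c₂ c₃ : Bool,
    (!(v && a₁) && !(v && a₂) && !(v && a₃) && !(a₁ && b₁) && !(a₂ && b₂) && !(a₃ && b₃) &&
      !(b₁ && c₁) && !(b₂ && c₂) && !(b₃ && c₃) && !(c₁ && c₂) && !(c₂ && c₃) &&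
      !(c₁ && c₃)) = true →
    ((v || a₁ || a₂ || a₃) && (a₁ || v || b₁) && (a₂ || v || b₂) && (a₃ || v || b₃) &&
      (b₁ || a₁ || c₁) && (b₂ || a₂ || c₂) && (b₃ || a₃ || c₃) && (c₁ || b₁ || c₂ || c₃) &&
      (c₂ || b₂ || c₁ || c₃) && (c₃ || b₃ || c₁ || c₂)) = true →
    v.toNat + a₁.toNat + a₂.toNat + a₃.toNat + b₁.toNat + b₂.toNat + b₃.toNat + c₁.toNat +
      c₂.toNat + c₃.toNat = 4 := by
  decide

open Classical in
theorem ncard_eq_sum_toNat {n : ℕ} (A : Set (Fin n)) :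
    A.ncard = ∑ i, (decide (i ∈ A)).toNat := by
  have : A.toFinset = Finset.univ.filter (· ∈ A) := by ext; simp
  rw [Set.ncard_eq_toFinset_card', this, Finset.card_filter]
  refine Finset.sum_congr rfl fun i _ => ?_
  by_cases hi : i ∈ A <;> simp [hi]

theorem wellCovered_cycleGraph_seven : (cycleGraph 7).WellCovered := by
  classical
  suffices h : ∀ A, (cycleGraph 7).IsMaxStable A → A.ncard = 3 from
    fun A B hA hB => (h A hA).trans (h B hB).symm
  intro A hA
  have h0 : ∀ i j, (cycleGraph 7).Adj i j → i ∉ A ∨ j ∉ A := fun i j hij => by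
    by_contra! h
    exact hA.1 _ h.1 _ h.2 hij
  have hnbr : ∀ i a : Fin 7, (cycleGraph 7).Adj i a → a = i + 1 ∨ a = i - 1 := by decide
  have h1 : ∀ i j k, j = i + 1 → k = i - 1 → i ∈ A ∨ j ∈ A ∨ k ∈ A := fun i j k hj hk => by
    by_contra! h
    obtain ⟨a, ha, hia⟩ := hA.2 i h.1
    rcases hnbr i a hia with rfl | rfl
    · exact h.2.1 (hj ▸ ha)
    · exact h.2.2 (hk ▸ ha)
  rw [ncard_eq_sum_toNat]
  have := wellCovered_cycleGraph_seven_bool (decide (0 ∈ A)) (decide (1 ∈ A)) (decide (2 ∈ A))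
    (decide (3 ∈ A)) (decide (4 ∈ A)) (decide (5 ∈ A)) (decide (6 ∈ A))
  simp only [Fin.sum_univ_seven]
  apply this
  · simp only [Bool.and_eq_true, Bool.not_eq_true', Bool.and_eq_false_iff, decide_eq_false_iff_not]
    refine ⟨⟨⟨⟨⟨⟨?_, ?_⟩, ?_⟩, ?_⟩, ?_⟩, ?_⟩, ?_⟩ <;> exact h0 _ _ (by decide)
  · simp only [Bool.and_eq_true, Bool.or_eq_true, decide_eq_true_eq, or_assoc]
    refine ⟨⟨⟨⟨⟨⟨?_, ?_⟩, ?_⟩, ?_⟩, ?_⟩, ?_⟩, ?_⟩ <;> exact h1 _ _ _ (by decide) (by decide)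

theorem wellCovered_graphT10 : graphT10.WellCovered := by
  classical
  suffices h : ∀ A, graphT10.IsMaxStable A → A.ncard = 4 from
    fun A B hA hB => (h A hA).trans (h B hB).symm
  intro A hA
  have h0 : ∀ i j, graphT10.Adj i j → i ∉ A ∨ j ∉ A := fun i j hij => by
    by_contra! h
    exact hA.1 _ h.1 _ h.2 hij
  have h1 : ∀ i, i ∈ A ∨ ∃ j ∈ nbrsT10 i, j ∈ A := fun i => by
    by_contra! h
    obtain ⟨a, ha, hia⟩ := hA.2 i h.1
    exact h.2 a ((graphT10_adj_iff_mem_nbrsT10 i a).1 hia) ha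
  rw [ncard_eq_sum_toNat]
  have := wellCovered_graphT10_bool (decide (0 ∈ A)) (decide (1 ∈ A)) (decide (2 ∈ A))
    (decide (3 ∈ A)) (decide (4 ∈ A)) (decide (5 ∈ A)) (decide (6 ∈ A)) (decide (7 ∈ A))
    (decide (8 ∈ A)) (decide (9 ∈ A))
  simp only [Fin.sum_univ_succ, Fin.sum_univ_zero]
  simp only [← add_assoc] at this ⊢
  apply this
  · simp only [Bool.and_eq_true, Bool.not_eq_true', Bool.and_eq_false_iff, decide_eq_false_iff_not]
    refine ⟨⟨⟨⟨⟨⟨⟨⟨⟨⟨⟨?_, ?_⟩, ?_⟩, ?_⟩, ?_⟩, ?_⟩, ?_⟩, ?_⟩, ?_⟩, ?_⟩, ?_⟩, ?_⟩ <;>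
      exact h0 _ _ (by decide)
  · simp only [Bool.and_eq_true, Bool.or_eq_true, decide_eq_true_eq, or_assoc]
    refine ⟨⟨⟨⟨⟨⟨⟨⟨⟨?_, ?_⟩, ?_⟩, ?_⟩, ?_⟩, ?_⟩, ?_⟩, ?_⟩, ?_⟩, ?_⟩
    · simpa [nbrsT10] using h1 0
    · simpa [nbrsT10] using h1 1
    · simpa [nbrsT10] using h1 2
    · simpa [nbrsT10] using h1 3
    · simpa [nbrsT10] using h1 4
    · simpa [nbrsT10] using h1 5
    · simpa [nbrsT10] using h1 6
    · simpa [nbrsT10] using h1 7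
    · simpa [nbrsT10] using h1 8
    · simpa [nbrsT10] using h1 9

/-- For every induced path `z - y - x` there are `s` and `s'` such that `{z, s, s'}` is a stable set
without neighbours of `y` other than `z`, which avoids the closed neighbourhood of `x` and dominates
its neighbours other than `y`; and a triangle at `y` leaves a neighbour of `y` without neighbours in
the triangle other than `y`. -/
def HasPathDominators (G : SimpleGraph V) : Prop :=
  (∀ y z, G.Adj y z → ∀ x, G.Adj y x → z ≠ x → ¬ G.Adj z x → ∃ s, ∃ s',
    (¬ G.Adj z s ∧ ¬ G.Adj y s ∧ ¬ G.Adj x s ∧ s ≠ x) ∧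
    (¬ G.Adj z s' ∧ ¬ G.Adj y s' ∧ ¬ G.Adj x s' ∧ s' ≠ x) ∧ ¬ G.Adj s s' ∧
    ∀ u, G.Adj x u → u = y ∨ G.Adj z u ∨ G.Adj s u ∨ G.Adj s' u) ∧
  ∀ y z, G.Adj y z → ∀ x, G.Adj y x → G.Adj z x →
    ∃ b, G.Adj y b ∧ b ≠ z ∧ b ≠ x ∧ ¬ G.Adj b z ∧ ¬ G.Adj b x

set_option synthInstance.maxSize 2000 in
set_option synthInstance.maxHeartbeats 400000 in
theorem hasPathDominators_cycleGraph_seven : (cycleGraph 7).HasPathDominators := by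
  constructor <;> decide

set_option synthInstance.maxSize 2000 in
set_option synthInstance.maxHeartbeats 400000 in
set_option maxRecDepth 4000 in
theorem hasPathDominators_graphT10 : graphT10.HasPathDominators := by
  constructor
  · decide +kernel
  · decide

theorem HasPathDominators.of_iso {W : Type*} {H : SimpleGraph W} (hH : H.HasPathDominators)
    (e : G ≃g H) : G.HasPathDominators := by
  refine ⟨fun y z hyz x hyx hzx hnzx => ?_, fun y z hyz x hyx hzx => ?_⟩
  · obtain ⟨s, s', h⟩ := hH.1 (e y) (e z) (e.map_adj_iff.2 hyz) (e x) (e.map_adj_iff.2 hyx)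
      (fun h => hzx (e.injective h)) (fun h => hnzx (e.map_adj_iff.1 h))
    obtain ⟨s, rfl⟩ := e.surjective s
    obtain ⟨s', rfl⟩ := e.surjective s'
    refine ⟨s, s', ?_⟩
    simpa only [e.map_adj_iff, ne_eq, e.injective.eq_iff, e.surjective.forall] using h
  · obtain ⟨b, h⟩ := hH.2 (e y) (e z) (e.map_adj_iff.2 hyz) (e x) (e.map_adj_iff.2 hyx)
      (e.map_adj_iff.2 hzx)
    obtain ⟨b, rfl⟩ := e.surjective b
    refine ⟨b, ?_⟩
    simpa only [e.map_adj_iff, ne_eq, e.injective.eq_iff] using h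

end SimpleGraph

/-! ### Strong covers, maximal stable sets and simplexes -/

namespace WeightedOrientedGraph

variable {V : Type u} {D : WeightedOrientedGraph V}

/-- The extra condition is vacuous, since every vertex of the cover has a neighbour outside it. -/
theorem isStrongCover_compl {A : Set V} (hA : D.graph.IsMaxStable A) : D.IsStrongCover Aᶜ := by
  refine ⟨fun x y h => ?_, fun x hx h => ?_⟩
  · by_contra! hxy
    simp only [Set.mem_compl_iff, not_not] at hxy
    exact hA.1 x hxy.1 y hxy.2 (D.adj_of_arc h)
  · obtain ⟨a, ha, hxa⟩ := hA.2 x hx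
    exact (h a hxa ha).elim

theorem IsStrongCover.stable_compl {C : Set V} (hC : D.IsStrongCover C) :
    ∀ a ∈ Cᶜ, ∀ b ∈ Cᶜ, ¬ D.graph.Adj a b := by
  intro a ha b hb hab
  rcases (D.adj_iff a b).1 hab with h | h
  · exact (hC.1 a b h).elim ha hb
  · exact (hC.1 b a h).elim hb ha

/-- The complement of a strong cover extends to a maximal stable set, whose complement is again a
strong cover; equal sizes leave nothing to add. -/
theorem strongCovers_ncard_eq_iff [Finite V] :
    (∀ C C', D.IsStrongCover C → D.IsStrongCover C' → C.ncard = C'.ncard) ↔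
      D.graph.WellCovered ∧ ∀ C, D.IsStrongCover C → D.graph.IsMaxStable Cᶜ := by
  have hcard : ∀ A : Set V, A.ncard + Aᶜ.ncard = Nat.card V := fun A =>
    Set.ncard_add_ncard_compl A
  constructor
  · intro h
    refine ⟨fun A B hA hB => ?_, fun C hC => ?_⟩
    · have := h _ _ (isStrongCover_compl hA) (isStrongCover_compl hB)
      have := hcard A
      have := hcard B
      omega
    · obtain ⟨M, hCM, hM⟩ := SimpleGraph.exists_isMaxStable_superset hC.stable_compl
      have h1 := h _ _ hC (isStrongCover_compl hM)
      have h2 := hcard C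
      have h3 := hcard M
      rwa [Set.eq_of_subset_of_ncard_le hCM (by omega) (Set.toFinite _)]
  · rintro ⟨hG, h⟩ C C' hC hC'
    have h1 := hG _ _ (h C hC) (h C' hC')
    have h2 := hcard C
    have h3 := hcard C'
    omega

theorem IsStrongCover.isMaxStable_compl_of_isSink {C : Set V} (hC : D.IsStrongCover C)
    (h : ∀ x ∈ D.vPlus, D.IsSink x) : D.graph.IsMaxStable Cᶜ := by
  refine ⟨hC.stable_compl, fun x hx => ?_⟩
  by_contra! hx'
  obtain ⟨y, hyx, hy, -⟩ := hC.2 x (by simpa using hx) (fun y hxy => by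
    by_contra hyC
    exact hx' y hyC hxy)
  exact (Set.eq_empty_iff_forall_notMem.1 (h y hy)) x hyx

/-- A vertex of weight greater than one with an out-neighbour `x` may yield a strong cover which
contains the closed neighbourhood of `x`. -/
theorem exists_isStrongCover_not_isMaxStable [Finite V] {A : Set V} {x y z : V}
    (hy : y ∈ D.vPlus) (hyx : D.arc y x) (hzA : z ∈ A) (hyz : D.graph.Adj y z)
    (hA : ∀ a ∈ A, ∀ b ∈ A, ¬ D.graph.Adj a b) (hAy : ∀ a ∈ A, ¬ D.arc y a)
    (hAx : ∀ u, D.graph.Adj x u → u ≠ y → ∃ a ∈ A, D.graph.Adj a u) :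
    ∃ C, D.IsStrongCover C ∧ ¬ D.graph.IsMaxStable Cᶜ := by
  obtain ⟨B, hAB, hBU, hB, hB'⟩ := D.graph.exists_maximal_stable_within
    (U := {u | ¬ D.arc y u}) hAy hA
  have hyB : y ∉ B := fun h => hB y h z (hAB hzA) hyz
  refine ⟨Bᶜ, ⟨fun u w h => ?_, fun u hu hN => ?_⟩, fun h => ?_⟩
  · by_contra! huw
    simp only [Set.mem_compl_iff, not_not] at huw
    exact hB u huw.1 w huw.2 (D.adj_of_arc h)
  · by_cases hyu : D.arc y u
    · exact ⟨y, hyu, hy, fun w hyw hw => hBU hw hyw⟩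
    · obtain ⟨b, hb, h⟩ := hB' u hyu hu
      exact (hN b h hb).elim
  · rw [compl_compl] at h
    obtain ⟨b, hb, hxb⟩ := h.2 x (fun hxB => hBU hxB hyx)
    by_cases hby : b = y
    · exact hyB (hby ▸ hb)
    obtain ⟨a, ha, hab⟩ := hAx b hxb hby
    exact hB a (hAB ha) b hb hab

/-- A vertex `y` of `V⁺` is not a source, so if it is no sink it lies between an in-neighbour `z`
and an out-neighbour `x`. The stable set `{z, s, s'}` then produces a strong cover containing
`N[x]`. -/
theorem isSink_of_hasPathDominators [Finite V] (hG : D.graph.HasPathDominators)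
    (hsource : ∀ x, D.IsSource x → D.weight x = 1)
    (h : ∀ C, D.IsStrongCover C → D.graph.IsMaxStable Cᶜ) : ∀ x ∈ D.vPlus, D.IsSink x := by
  intro y hy
  by_contra hne
  obtain ⟨x, hyx⟩ := Set.nonempty_iff_ne_empty.2 hne
  have hns : ¬ D.IsSource y := fun hs => by
    have := hsource y hs
    simp only [vPlus, Set.mem_ofPred_eq] at hy
    omega
  obtain ⟨z, hzy⟩ := Set.nonempty_iff_ne_empty.2 hns
  have key : ∀ x z, D.arc y x → D.arc z y → ¬ D.graph.Adj z x → False := by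
    intro x z hyx hzy hzx
    obtain ⟨s, s', ⟨h1, h2, h3, h4⟩, ⟨h5, h6, h7, h8⟩, h9, h10⟩ := hG.1 y z (D.adj_of_arc' hzy) x
      (D.adj_of_arc hyx) (by rintro rfl; exact D.arc_asymm _ _ hyx hzy) hzx
    have hstable : ∀ a ∈ ({z, s, s'} : Set V), ∀ b ∈ ({z, s, s'} : Set V),
        ¬ D.graph.Adj a b := by
      have := D.graph.adj_comm
      have hirr : ∀ u, ¬ D.graph.Adj u u := fun u => D.graph.irrefl
      intro a ha b hb
      simp only [Set.mem_insert_iff, Set.mem_singleton_iff] at ha hb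
      grind
    have hout : ∀ a ∈ ({z, s, s'} : Set V), ¬ D.arc y a := by
      rintro a (rfl | rfl | rfl) ha
      · exact D.arc_asymm _ _ ha hzy
      · exact h2 (D.adj_of_arc ha)
      · exact h6 (D.adj_of_arc ha)
    obtain ⟨C, hC, hC'⟩ := exists_isStrongCover_not_isMaxStable (z := z) hy hyx (by simp)
      (D.adj_of_arc' hzy) hstable hout fun u hu huy => by
        rcases h10 u hu with h | h | h | h
        · exact (huy h).elim
        · exact ⟨z, by simp, h⟩
        · exact ⟨s, by simp, h⟩
        · exact ⟨s', by simp, h⟩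
    exact hC' (h C hC)
  -- In a triangle, `b` takes the place of `x` or of `z`, depending on the direction of its edge
  -- with `y`.
  by_cases hzx : D.graph.Adj z x
  · obtain ⟨b, hyb, -, -, hbz, hbx⟩ := hG.2 y z (D.adj_of_arc' hzy) x (D.adj_of_arc hyx) hzx
    rcases (D.adj_iff y b).1 hyb with h | h
    · exact key b z h hzy fun h => hbz h.symm
    · exact key x b hyx h hbx
  · exact key x z hyx hzy hzx

theorem isSimplicial_iff {x : V} : D.IsSimplicial x ↔ D.graph.IsSimplicialVertex x := by
  refine ⟨fun h a b ha hb hab => h (Or.inr ha) (Or.inr hb) hab, fun h => ?_⟩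
  rintro a (rfl | ha) b (rfl | hb) hab
  · exact (hab rfl).elim
  · exact hb
  · exact ha.symm
  · exact h a b ha hb hab

theorem IsSimplex.isClique {S : D.Subgraph} (hS : D.IsSimplex S) : D.graph.IsClique S.verts := by
  obtain ⟨t, ht, rfl⟩ := hS
  exact ht

theorem IsSimplex.exists_mem {S : D.Subgraph} (hS : D.IsSimplex S) {A : Set V}
    (hA : D.graph.IsMaxStable A) : ∃ a ∈ A, a ∈ S.verts := by
  obtain ⟨t, ht, rfl⟩ := hS
  by_cases h : t ∈ A
  · exact ⟨t, h, Or.inl rfl⟩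
  · obtain ⟨a, ha, hta⟩ := hA.2 t h
    exact ⟨a, ha, Or.inr hta⟩

/-- If `s` and `t` are distinct and nonadjacent, the path `s - x - t` leaves nothing to dominate, so
the empty set contradicts `no_dominating`. -/
theorem closedNbhd_eq_of_isSimplicial [Finite V] (hG : D.graph.WellCovered) {s t x : V}
    (hs : D.graph.IsSimplicialVertex s) (ht : D.graph.IsSimplicialVertex t)
    (hxs : x ∈ D.closedNbhd s) (hxt : x ∈ D.closedNbhd t) :
    D.closedNbhd s = D.closedNbhd t := by
  by_cases hst : s = t
  · rw [hst]
  by_cases hadj : D.graph.Adj s t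
  · have key : ∀ s t, D.graph.IsSimplicialVertex s → D.graph.Adj s t →
        D.closedNbhd s ⊆ D.closedNbhd t := by
      rintro s t hs hadj u (rfl | hu)
      · exact Or.inr hadj.symm
      · by_cases htu : t = u
        · exact Or.inl htu.symm
        · exact Or.inr (hs t u hadj hu htu)
    exact (key s t hs hadj).antisymm (key t s ht hadj.symm)
  exfalso
  rcases hxs with rfl | hxs <;> rcases hxt with hxt | hxt
  · exact hst hxt
  · exact hadj (hxt.symm)
  · exact hadj (hxt ▸ hxs)
  · refine hG.no_dominating hxs (hxt.symm) hst hadj (J := ∅) (by simp) (by simp) ?_ ?_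
    · exact fun z hz hzx hxz => (hxz (hs x z hxs hz hzx.symm)).elim
    · exact fun z hz hzx hxz => (hxz (ht x z hxt hz hzx.symm)).elim

theorem existsUnique_isSimplex [Finite V] (hG : D.graph.WellCovered) {x : V}
    (hx : D.graph.InSimplex x) : ∃! S : D.Subgraph, D.IsSimplex S ∧ x ∈ S.verts := by
  obtain ⟨t, ht, hxt⟩ := hx
  have hxt' : x ∈ D.closedNbhd t := hxt.imp Eq.symm id
  refine ⟨D.induce (D.closedNbhd t), ⟨⟨t, isSimplicial_iff.2 ht, rfl⟩, hxt'⟩, ?_⟩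
  rintro _ ⟨⟨s, hs, rfl⟩, hxs⟩
  rw [closedNbhd_eq_of_isSimplicial hG (isSimplicial_iff.1 hs) ht hxs hxt']

/-- The complement of a cover meets each simplex at most once, so it injects into the set of
simplexes; the map is onto unless the cover contains a simplex. -/
theorem strongCovers_ncard_eq_iff_of_isSimplex [Finite V]
    (hP : ∀ x : V, ∃! S : D.Subgraph, D.IsSimplex S ∧ x ∈ S.verts) :
    (∀ C C', D.IsStrongCover C → D.IsStrongCover C' → C.ncard = C'.ncard) ↔
      ∀ S : D.Subgraph, D.IsSimplex S → ¬ ∃ C, D.IsStrongCover C ∧ S.verts ⊆ C := by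
  constructor
  · rintro h S hS ⟨C, hC, hSC⟩
    obtain ⟨a, ha, haS⟩ := hS.exists_mem ((strongCovers_ncard_eq_iff.1 h).2 C hC)
    exact ha (hSC haS)
  · intro h
    choose σ hσ hσu using hP
    have hcard : ∀ C, D.IsStrongCover C → Cᶜ.ncard = Nat.card {S : D.Subgraph // D.IsSimplex S} := by
      intro C hC
      rw [← Nat.card_coe_set_eq]
      refine Nat.card_eq_of_bijective (fun x : ↥Cᶜ => ⟨σ x, (hσ x).1⟩) ⟨?_, ?_⟩
      · rintro ⟨a, ha⟩ ⟨b, hb⟩ hab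
        have hab' : σ a = σ b := congrArg Subtype.val hab
        by_contra hne
        exact hC.stable_compl a ha b hb ((hσ a).1.isClique (hσ a).2 (hab' ▸ (hσ b).2)
          fun h => hne (Subtype.ext h))
      · rintro ⟨S, hS⟩
        by_contra! hx
        refine h S hS ⟨C, hC, fun x hxS => ?_⟩
        by_contra hxC
        exact hx ⟨x, hxC⟩ (Subtype.ext (hσu x S ⟨hS, hxS⟩).symm)
    intro C C' hC hC'
    have h1 := hcard C hC
    have h2 := hcard C' hC'
    have h3 := Set.ncard_add_ncard_compl C
    have h4 := Set.ncard_add_ncard_compl C'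
    omega

end WeightedOrientedGraph

/-! ### Cycles in functional graphs -/

namespace SimpleGraph

variable {V : Type u} {Γ : SimpleGraph V} {N : Set V} {f : V → V}

/-- Every edge joins a vertex of `N` to its image under `f`. -/
def IsFunctional (Γ : SimpleGraph V) (N : Set V) (f : V → V) : Prop :=
  ∀ a b, Γ.Adj a b → a ∈ N ∧ b = f a ∨ b ∈ N ∧ a = f b

/-- A cycle has as many vertices as edges, and sending an edge `{x, f x}` to `x` is injective; hence
every vertex of the cycle is hit. -/
theorem IsFunctional.mem_edges_of_isCycle (h : Γ.IsFunctional N f) {z : V} {c : Γ.Walk z z}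
    (hc : c.IsCycle) : ∀ x ∈ c.support, x ∈ N ∧ s(x, f x) ∈ c.edges := by
  classical
  have hch : ∀ e ∈ c.edges, ∃ x, x ∈ N ∧ e = s(x, f x) := by
    intro e he
    have hadj := c.edges_subset_edgeSet he
    induction e with
    | _ a b =>
      rcases h a b hadj with ⟨ha, rfl⟩ | ⟨hb, rfl⟩
      · exact ⟨a, ha, rfl⟩
      · exact ⟨b, hb, Sym2.eq_swap⟩
  have : Nonempty V := ⟨z⟩
  choose! g hgN hg using hch
  have hsup : ∀ x ∈ c.support, x ∈ c.support.tail := fun x hx =>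
    ((Walk.mem_support_iff c).1 hx).elim (fun h => h ▸ Walk.end_mem_tail_support hc.not_nil) id
  have hsurj : Set.SurjOn g (c.edges.toFinset : Set (Sym2 V)) (c.support.tail.toFinset : Set V) := by
    refine Finset.surjOn_of_injOn_of_card_le g ?_ ?_ ?_
    · intro e he
      simp only [List.coe_toFinset, Set.mem_ofPred_eq] at he ⊢
      refine hsup _ (c.fst_mem_support_of_mem_edges (u := f (g e)) (t := g e) ?_)
      rw [← hg e he]
      exact he
    · intro e he e' he' hee'
      simp only [List.coe_toFinset, Set.mem_ofPred_eq] at he he'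
      rw [hg e he, hg e' he', hee']
    · rw [List.toFinset_card_of_nodup hc.edges_nodup, List.toFinset_card_of_nodup hc.support_nodup]
      simp
  intro x hx
  obtain ⟨e, he, rfl⟩ := hsurj (by simpa using hsup x hx)
  simp only [List.coe_toFinset, Set.mem_ofPred_eq] at he
  exact ⟨hgN e he, hg e he ▸ he⟩

theorem IsFunctional.apply_mem_support (h : Γ.IsFunctional N f) {z : V} {c : Γ.Walk z z}
    (hc : c.IsCycle) {x : V} (hx : x ∈ c.support) : f x ∈ c.support :=
  c.snd_mem_support_of_mem_edges (h.mem_edges_of_isCycle hc x hx).2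

theorem IsFunctional.iterate_mem_support (h : Γ.IsFunctional N f) {z : V} {c : Γ.Walk z z}
    (hc : c.IsCycle) {x : V} (hx : x ∈ c.support) (n : ℕ) : f^[n] x ∈ c.support := by
  induction n with
  | zero => exact hx
  | succ n ih =>
    rw [Function.iterate_succ_apply']
    exact h.apply_mem_support hc ih

theorem IsFunctional.exists_apply_eq (h : Γ.IsFunctional N f) {z : V} {c : Γ.Walk z z}
    (hc : c.IsCycle) {x : V} (hx : x ∈ c.support) : ∃ y ∈ c.support, f y = x := by
  by_contra! hne
  have hsub : c.toSubgraph.neighborSet x ⊆ {f x} := by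
    intro y hy
    have hys : y ∈ c.support := by
      rw [← Walk.mem_verts_toSubgraph]
      exact c.toSubgraph.edge_vert hy.symm
    rcases h x y (c.toSubgraph.adj_sub hy) with ⟨-, h⟩ | ⟨-, h⟩
    · exact h
    · exact (hne y hys h.symm).elim
  have := Set.ncard_le_ncard hsub
  rw [hc.ncard_neighborSet_toSubgraph_eq_two hx, Set.ncard_singleton] at this
  omega

theorem IsFunctional.mem_periodicPts_of_isCycle [Finite V] (h : Γ.IsFunctional N f) {z : V}
    {c : Γ.Walk z z} (hc : c.IsCycle) {x : V} (hx : x ∈ c.support) :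
    x ∈ Function.periodicPts f := by
  let g : {x // x ∈ c.support} → {x // x ∈ c.support} := fun x =>
    ⟨f x, h.apply_mem_support hc x.2⟩
  have hg : Function.Surjective g := by
    rintro ⟨x, hx⟩
    obtain ⟨y, hy, hyx⟩ := h.exists_apply_eq hc hx
    exact ⟨⟨y, hy⟩, Subtype.ext hyx⟩
  obtain ⟨n, hn, hn'⟩ := (Finite.injective_iff_surjective.2 hg).mem_periodicPts ⟨x, hx⟩
  have hsemi : Function.Semiconj Subtype.val g f := fun _ => rfl
  exact ⟨n, hn, hn'.map hsemi⟩

theorem _root_.Function.exists_iterate_iterate_eq {f : V → V} {x : V}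
    (hx : x ∈ Function.periodicPts f) (m : ℕ) : ∃ k, f^[k] (f^[m] x) = x := by
  obtain ⟨p, hp, hpx⟩ := hx
  refine ⟨p * m - m, ?_⟩
  rw [← Function.iterate_add_apply, Nat.sub_add_cancel (Nat.le_mul_of_pos_left m hp)]
  exact hpx.mul_const m

/-- Vertices of cycles are periodic, so a common iterate leads back to each of them; the vertex sets
agree, and `f` determines the edges. -/
theorem IsFunctional.toSubgraph_eq [Finite V] (h : Γ.IsFunctional N f) {z z' : V}
    {c : Γ.Walk z z} {c' : Γ.Walk z' z'} (hc : c.IsCycle) (hc' : c'.IsCycle)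
    (hrel : ∀ x ∈ c.support, ∀ y ∈ c'.support, ∃ m n, f^[m] x = f^[n] y) :
    c.toSubgraph = c'.toSubgraph := by
  have hsupp : ∀ x, x ∈ c.support ↔ x ∈ c'.support := by
    intro x
    constructor
    · intro hx
      obtain ⟨m, n, hmn⟩ := hrel x hx z' c'.start_mem_support
      obtain ⟨k, hk⟩ := Function.exists_iterate_iterate_eq (h.mem_periodicPts_of_isCycle hc hx) m
      rw [← hk, hmn]
      exact h.iterate_mem_support hc' (h.iterate_mem_support hc' c'.start_mem_support n) k
    · intro hx
      obtain ⟨m, n, hmn⟩ := hrel z c.start_mem_support x hx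
      obtain ⟨k, hk⟩ := Function.exists_iterate_iterate_eq (h.mem_periodicPts_of_isCycle hc' hx) n
      rw [← hk, ← hmn]
      exact h.iterate_mem_support hc (h.iterate_mem_support hc c.start_mem_support m) k
  have hadj : ∀ {z z' : V} {c : Γ.Walk z z} {c' : Γ.Walk z' z'}, c.IsCycle → c'.IsCycle →
      (∀ x, x ∈ c.support ↔ x ∈ c'.support) → ∀ a b, s(a, b) ∈ c.edges → s(a, b) ∈ c'.edges := by
    intro z z' c c' _ hc' hs a b hab
    have ha := (hs a).1 (c.fst_mem_support_of_mem_edges hab)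
    have hb := (hs b).1 (c.snd_mem_support_of_mem_edges hab)
    rcases h a b (c.adj_of_mem_edges hab) with ⟨-, rfl⟩ | ⟨-, rfl⟩
    · exact (h.mem_edges_of_isCycle hc' a ha).2
    · rw [Sym2.eq_swap]
      exact (h.mem_edges_of_isCycle hc' b hb).2
  ext a b
  · simpa using hsupp a
  · rw [Walk.adj_toSubgraph_iff_mem_edges, Walk.adj_toSubgraph_iff_mem_edges]
    exact ⟨hadj hc hc' hsupp a b, hadj hc' hc (fun x => (hsupp x).symm) a b⟩

/-- The path starts at the last iterate so that its darts point from parent to child. -/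
theorem exists_isPath_iterate {z : V} (hadj : ∀ i, Γ.Adj (f^[i + 1] z) (f^[i] z)) (n : ℕ)
    (hinj : ∀ i ≤ n, ∀ j ≤ n, f^[i] z = f^[j] z → i = j) :
    ∃ p : Γ.Walk (f^[n] z) z, p.IsPath ∧ p.length = n ∧ (∀ x ∈ p.support, ∃ i ≤ n, x = f^[i] z) ∧
      ∀ d ∈ p.darts, d.fst = f d.snd := by
  induction n with
  | zero => exact ⟨.nil, by simp, rfl, by simp, by simp⟩
  | succ n ih =>
    obtain ⟨p, hp, hl, hs, hd⟩ := ih fun i hi j hj => hinj i (by omega) j (by omega)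
    refine ⟨.cons (hadj n) p, ?_, congrArg (· + 1) hl, ?_, ?_⟩
    · rw [Walk.cons_isPath_iff]
      refine ⟨hp, fun hmem => ?_⟩
      obtain ⟨i, hi, h⟩ := hs _ hmem
      have := hinj (n + 1) le_rfl i (by omega) h
      omega
    · intro x hx
      rw [Walk.support_cons, List.mem_cons] at hx
      rcases hx with rfl | hx
      · exact ⟨n + 1, le_rfl, rfl⟩
      · obtain ⟨i, hi, h⟩ := hs x hx
        exact ⟨i, by omega, h⟩
    · intro d hdm
      rw [Walk.darts_cons, List.mem_cons] at hdm
      rcases hdm with rfl | hdm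
      · exact Function.iterate_succ_apply' f n z
      · exact hd d hdm

/-- The condition on `f (f z)` excludes periods one and two, which would not give a cycle in a
simple graph. -/
theorem exists_isCycle_of_mem_periodicPts {z : V} (hz : z ∈ Function.periodicPts f)
    (hadj : ∀ i, Γ.Adj (f^[i + 1] z) (f^[i] z)) (hff : f (f z) ≠ z) :
    ∃ c : Γ.Walk z z, c.IsCycle ∧ ∀ d ∈ c.darts, d.fst = f d.snd := by
  have hpos := Function.minimalPeriod_pos_of_mem_periodicPts hz
  have h1 : Function.minimalPeriod f z ≠ 1 := fun h => by
    have := Function.minimalPeriod_eq_one_iff_isFixedPt.1 h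
    exact hff (by rw [this.eq, this.eq])
  have h2 : Function.minimalPeriod f z ≠ 2 := fun h => by
    have := Function.isPeriodicPt_minimalPeriod f z
    rw [h] at this
    exact hff this
  obtain ⟨n, hn⟩ : ∃ n, Function.minimalPeriod f z = n + 1 := ⟨_, (Nat.succ_pred hpos.ne').symm⟩
  have hfz : f^[n + 1] z = z := hn ▸ Function.isPeriodicPt_minimalPeriod f z
  obtain ⟨p, hp, hl, -, hd⟩ := exists_isPath_iterate hadj n fun i hi j hj h =>
    (Function.iterate_eq_iterate_iff_of_lt_minimalPeriod (by omega) (by omega)).1 h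
  have hlast : Γ.Adj z (f^[n] z) := by
    have := hadj n
    rwa [hfz] at this
  refine ⟨.cons hlast p, ?_, ?_⟩
  · rw [Walk.isCycle_iff_isPath_tail_and_le_length]
    refine ⟨by simpa using hp, ?_⟩
    rw [Walk.length_cons, hl]
    omega
  · intro d hdm
    rw [Walk.darts_cons, List.mem_cons] at hdm
    rcases hdm with rfl | hdm
    · change z = f (f^[n] z)
      rw [← Function.iterate_succ_apply' f n z, hfz]
    · exact hd d hdm

end SimpleGraph

/-! ### From star-semi-forests to strong covers -/

namespace WeightedOrientedGraph

variable {V : Type u} {D : WeightedOrientedGraph V}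

namespace Subgraph

theorem hasOrientedPath_iff {H : D.Subgraph} {x y : V} :
    H.HasOrientedPath x y ↔ Relation.ReflTransGen H.arc x y := by
  classical
  constructor
  · rintro ⟨p, -, hp⟩
    induction p with
    | nil => exact .refl
    | cons h p ih =>
      refine .head (hp ⟨(_, _), h⟩ (by simp)) (ih fun d hd => hp d ?_)
      rw [SimpleGraph.Walk.darts_cons]
      exact List.mem_cons_of_mem _ hd
  · intro h
    suffices hw : ∃ p : H.graph.Walk x y, H.IsOrientedWalk p by
      obtain ⟨p, hp⟩ := hw
      exact ⟨p.bypass, p.bypass_isPath, fun d hd => hp d (p.darts_bypass_subset_darts hd)⟩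
    induction h using Relation.ReflTransGen.head_induction_on with
    | refl => exact ⟨.nil, fun d hd => by simp at hd⟩
    | head hab _ ih =>
      obtain ⟨p, hp⟩ := ih
      have hadj : H.graph.Adj _ _ := Or.inl hab
      refine ⟨.cons hadj p, fun d hd => ?_⟩
      rw [SimpleGraph.Walk.darts_cons, List.mem_cons] at hd
      rcases hd with rfl | hd
      · exact hab
      · exact hp d hd

theorem two_le_deg [Finite V] {H : D.Subgraph} {x y z : V} (hxy : H.arc x y) (hyz : H.arc y z) :
    2 ≤ H.deg y := by
  have hne : x ≠ z := by
    rintro rfl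
    exact D.arc_asymm _ _ (H.arc_sub _ _ hxy) (H.arc_sub _ _ hyz)
  rw [deg, ← Set.ncard_pair hne]
  refine Set.ncard_le_ncard ?_ (Set.toFinite _)
  rintro u (rfl | rfl)
  · exact Or.inr hxy
  · exact Or.inl hyz

theorem deg_pos [Finite V] {H : D.Subgraph} {x y : V} (hxy : H.arc x y) : 0 < H.deg x :=
  (Set.ncard_pos (Set.toFinite _)).2 ⟨y, Or.inl hxy⟩

/-- A vertex of a root oriented tree other than the parent has an in-neighbour, which is the parent
or has itself an in-neighbour. -/
theorem IsRootOrientedTree.exists_arc {T : D.Subgraph} {v x : V} (hT : T.IsRootOrientedTree v)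
    (hx : x ∈ T.verts) (hxv : x ≠ v) : ∃ y, T.arc y x ∧ (y = v ∨ ∃ u, T.arc u y) := by
  have h := hasOrientedPath_iff.1 (hT.2.2.1 x hx hxv)
  rcases Relation.ReflTransGen.cases_tail h with h | ⟨y, hy, hyx⟩
  · exact (hxv h).elim
  · refine ⟨y, hyx, ?_⟩
    rcases Relation.ReflTransGen.cases_tail hy with h | ⟨u, -, huy⟩
    · exact Or.inl h
    · exact Or.inr ⟨u, huy⟩

/-- Vertices on the cycle and those reached from it have an in-neighbour of the same kind. The
second step back shows that the in-neighbour has degree at least two. -/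
theorem IsUnicycle.exists_arc {B : D.Subgraph} {x : V} (hB : B.IsUnicycle) (hx : x ∈ B.verts) :
    ∃ y, B.arc y x ∧ ∃ u, B.arc u y := by
  obtain ⟨⟨z, c, hc, -, ho, hreach⟩, -⟩ := hB
  have hcyc : ∀ x ∈ c.support, ∃ y ∈ c.support, B.arc y x := by
    intro x hx
    have hx' : x ∈ c.support.tail := ((SimpleGraph.Walk.mem_support_iff c).1 hx).elim
      (fun h => h ▸ SimpleGraph.Walk.end_mem_tail_support hc.not_nil) id
    rw [← SimpleGraph.Walk.map_snd_darts, List.mem_map] at hx'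
    obtain ⟨d, hd, rfl⟩ := hx'
    exact ⟨d.fst, c.dart_fst_mem_support_of_mem_darts hd, ho d hd⟩
  have hin : ∀ x, x ∈ c.support ∨ (∃ y ∈ c.support, Relation.ReflTransGen B.arc y x) →
      ∃ y, B.arc y x ∧ (y ∈ c.support ∨ ∃ y' ∈ c.support, Relation.ReflTransGen B.arc y' y) := by
    rintro x (h | ⟨y, hy, h⟩)
    · obtain ⟨y, hy, hyx⟩ := hcyc x h
      exact ⟨y, hyx, Or.inl hy⟩
    · rcases Relation.ReflTransGen.cases_tail h with rfl | ⟨u, hu, hux⟩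
      · obtain ⟨y', hy', hyx⟩ := hcyc x hy
        exact ⟨y', hyx, Or.inl hy'⟩
      · exact ⟨u, hux, Or.inr ⟨y, hy, hu⟩⟩
  have h0 : x ∈ c.support ∨ ∃ y ∈ c.support, Relation.ReflTransGen B.arc y x := by
    by_cases h : x ∈ c.support
    · exact Or.inl h
    · obtain ⟨y, hy, hyx⟩ := hreach x hx h
      exact Or.inr ⟨y, hy, hasOrientedPath_iff.1 hyx⟩
  obtain ⟨y, hyx, hy⟩ := hin x h0
  obtain ⟨u, huy, -⟩ := hin y hy
  exact ⟨y, hyx, u, huy⟩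

theorem deg_iUnion {ι : Type*} {F : ι → D.Subgraph}
    (hF : ∀ k l, k ≠ l → Disjoint (F k).verts (F l).verts) {k : ι} {x : V}
    (hx : x ∈ (F k).verts) : (iUnion F).deg x = (F k).deg x := by
  have hk : ∀ l, x ∈ (F l).verts → l = k := fun l hl => by
    by_contra h
    exact Set.disjoint_left.1 (hF l k h) hl hx
  have : (iUnion F).graph.neighborSet x = (F k).graph.neighborSet x := by
    ext y
    constructor
    · rintro (⟨l, h⟩ | ⟨l, h⟩)
      · exact Or.inl (hk l ((F l).fst_mem _ _ h) ▸ h)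
      · exact Or.inr (hk l ((F l).snd_mem _ _ h) ▸ h)
    · rintro (h | h)
      · exact Or.inl ⟨k, h⟩
      · exact Or.inr ⟨k, h⟩
  rw [deg, deg, this]

theorem deg_eq_zero_of_verts_eq_singleton {T : D.Subgraph} {v : V} (h : T.verts = {v}) :
    T.deg v = 0 := by
  have : T.graph.neighborSet v = ∅ := by
    rw [Set.eq_empty_iff_forall_notMem]
    rintro y (hy | hy)
    · have hyv : y = v := by simpa [h] using T.snd_mem _ _ hy
      subst hyv
      exact D.arc_asymm _ _ (T.arc_sub _ _ hy) (T.arc_sub _ _ hy)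
    · have hyv : y = v := by simpa [h] using T.fst_mem _ _ hy
      subst hyv
      exact D.arc_asymm _ _ (T.arc_sub _ _ hy) (T.arc_sub _ _ hy)
  rw [deg, this, Set.ncard_empty]

/-- The vertices of a star-semi-forest are contained in a strong cover. -/
theorem IsStarSemiForest.exists_isStrongCover [Finite V] {H : D.Subgraph}
    (hH : H.IsStarSemiForest) : ∃ C, D.IsStrongCover C ∧ H.verts ⊆ C := by
  obtain ⟨r, s, T, p, B, hT, hB, rfl, hdisj, w, hw, W₁, W₂, hW, -, hW₁, hW₂, hW₂p, htilde⟩ := hH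
  set F := Sum.elim T B with hFdef
  -- The in-neighbour lies in `H̃` because it is a parent with an out-neighbour or has degree at
  -- least two.
  have harc : ∀ x ∈ (iUnion F).verts, (∃ i, x = p i) ∨
      ∃ y, (iUnion F).arc y x ∧ y ∈ (iUnion F).tilde p := by
    intro x hx
    obtain ⟨k, hk⟩ := Set.mem_iUnion.1 hx
    by_cases hxp : ∃ i, x = p i
    · exact Or.inl hxp
    right
    push Not at hxp
    obtain ⟨y, hyx, hy⟩ : ∃ y, (F k).arc y x ∧ ((∃ i, y = p i) ∨ ∃ u, (F k).arc u y) := by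
      cases k with
      | inl i =>
        obtain ⟨y, hyx, hy⟩ := (hT i).exists_arc hk (hxp i)
        exact ⟨y, hyx, hy.imp_left fun h => ⟨i, h⟩⟩
      | inr j =>
        obtain ⟨y, hyx, hy⟩ := (hB j).exists_arc hk
        exact ⟨y, hyx, Or.inr hy⟩
    refine ⟨y, ⟨k, hyx⟩, ?_⟩
    rcases hy with ⟨i, rfl⟩ | ⟨u, hu⟩
    · have h1 : 0 < (iUnion F).deg (p i) := deg_pos ⟨k, hyx⟩
      by_cases h2 : (iUnion F).deg (p i) = 1
      · exact Or.inr ⟨i, rfl, h2⟩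
      · exact Or.inl ⟨Set.mem_iUnion.2 ⟨k, (F k).fst_mem _ _ hyx⟩, by omega⟩
    · exact Or.inl ⟨Set.mem_iUnion.2 ⟨k, (F k).fst_mem _ _ hyx⟩, two_le_deg ⟨k, hu⟩ ⟨k, hyx⟩⟩
  -- A vertex of weight one has degree at most one in `H`, and degree zero if it is a parent `p i`,
  -- so it is not in `H̃`.
  have hweight : W₂ ∪ (iUnion F).tilde p ⊆ D.vPlus := by
    rintro x (hx | hx)
    · exact hW₂ hx
    by_contra hwt
    have hwt1 : D.weight x = 1 := by
      have := D.weight_pos x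
      simp only [vPlus, Set.mem_ofPred_eq] at hwt
      omega
    have hroot : ∀ i x, x ∈ (T i).verts → D.weight x = 1 →
        (iUnion F).deg x = 1 ∧ x ≠ p i ∨ (iUnion F).deg x = 0 := by
      intro i x hx hwt
      rw [deg_iUnion hdisj (k := Sum.inl i) hx]
      refine ((hT i).2.2.2 x hx hwt).imp_right ?_
      rintro ⟨h, rfl⟩
      exact deg_eq_zero_of_verts_eq_singleton h
    rcases hx with ⟨hx, hdeg⟩ | ⟨i, rfl, hdeg⟩
    · obtain ⟨k, hk⟩ := Set.mem_iUnion.1 hx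
      cases k with
      | inl i =>
        rcases hroot i x hk hwt1 with h | h <;> omega
      | inr j =>
        have := (hB j).2 x hk hwt1
        rw [deg_iUnion hdisj hk] at hdeg
        change 2 ≤ (B j).deg x at hdeg
        omega
    · rcases hroot i (p i) (hT i).1 hwt1 with h | h
      · exact h.2 rfl
      · omega
  set Y := W₂ ∪ (iUnion F).tilde p with hY
  have hW₁U : W₁ ⊆ {x | x ∉ (iUnion F).verts ∧ x ∉ D.outNbhdSet Y} := by
    intro x hx
    refine ⟨?_, fun h => Set.eq_empty_iff_forall_notMem.1 htilde x ⟨h, hx⟩⟩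
    have : x ∈ Set.range w := hW ▸ Or.inl hx
    obtain ⟨i, rfl⟩ := this
    exact (hw i).1
  have hW₁s : ∀ a ∈ W₁, ∀ b ∈ W₁, ¬ D.graph.Adj a b := fun a ha b hb hab =>
    hW₁ ha hb hab.ne hab
  -- The cover is the complement of a stable set containing `W₁`, maximal among those avoiding `H`
  -- and `N⁺(W₂ ∪ H̃)`.
  obtain ⟨A, hWA, hAU, hA, hA'⟩ := D.graph.exists_maximal_stable_within hW₁U hW₁s
  refine ⟨Aᶜ, ⟨fun x y h => ?_, fun x hx hN => ?_⟩, fun x hx hxA => (hAU hxA).1 hx⟩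
  · by_contra! hxy
    simp only [Set.mem_compl_iff, not_not] at hxy
    exact hA x hxy.1 y hxy.2 (D.adj_of_arc h)
  have hout : ∀ y ∈ Y, D.arc y x → ∃ y, D.arc y x ∧ y ∈ D.vPlus ∧ ∀ z, D.arc y z → z ∈ Aᶜ :=
    fun y hy hyx => ⟨y, hyx, hweight hy, fun z hyz hz => (hAU hz).2 ⟨y, hy, hyz⟩⟩
  by_cases hxY : x ∈ D.outNbhdSet Y
  · obtain ⟨y, hy, hyx⟩ := hxY
    exact hout y hy hyx
  by_cases hxH : x ∈ (iUnion F).verts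
  · rcases harc x hxH with ⟨i, rfl⟩ | ⟨y, hyx, hy⟩
    · have hwi : w i ∈ W₁ ∪ W₂ := hW ▸ ⟨i, rfl⟩
      rcases hwi with h | h
      · exact (hN (w i) (hw i).2.symm (hWA h)).elim
      · exact hout (w i) (Or.inl h) (hW₂p i h)
    · exact hout y (Or.inr hy) ((iUnion F).arc_sub _ _ hyx)
  · obtain ⟨a, ha, hxa⟩ := hA' x ⟨hxH, hxY⟩ hx
    exact (hN a hxa ha).elim

end Subgraph

end WeightedOrientedGraph

/-! ### From strong covers to star-semi-forests -/

namespace WeightedOrientedGraph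

variable {V : Type u} {D : WeightedOrientedGraph V}

/-- A partial parent function on a set `U` of vertices: every vertex of `dom` has an in-neighbour
`par x` in `U`, and the vertices outside of `dom` are fixed. -/
structure ParentFunction (D : WeightedOrientedGraph V) (U : Set V) where
  dom : Set V
  par : V → V
  dom_subset : dom ⊆ U
  par_mem : ∀ x ∈ dom, par x ∈ U
  arc_par : ∀ x ∈ dom, D.arc (par x) x
  par_eq : ∀ x ∉ dom, par x = x

namespace ParentFunction

variable {U : Set V} (F : ParentFunction D U)

/-- Two vertices are equivalent if they have a common iterated parent. -/
def setoid : Setoid V where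
  r x y := ∃ m n, F.par^[m] x = F.par^[n] y
  iseqv :=
    { refl := fun _ => ⟨0, 0, rfl⟩
      symm := fun ⟨m, n, h⟩ => ⟨n, m, h.symm⟩
      trans := by
        rintro x y z ⟨m, n, h⟩ ⟨k, l, h'⟩
        refine ⟨k + m, n + l, ?_⟩
        rw [Function.iterate_add_apply, h, ← Function.iterate_add_apply, add_comm k n,
          Function.iterate_add_apply, h', ← Function.iterate_add_apply] }

/-- The class of a vertex. -/
def cls (x : V) : Quotient F.setoid := Quotient.mk F.setoid x

theorem cls_eq_iff {x y : V} : F.cls x = F.cls y ↔ ∃ m n, F.par^[m] x = F.par^[n] y :=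
  Quotient.eq (r := F.setoid)

theorem cls_par (x : V) : F.cls (F.par x) = F.cls x :=
  F.cls_eq_iff.2 ⟨0, 1, rfl⟩

theorem cls_iterate (x : V) (n : ℕ) : F.cls (F.par^[n] x) = F.cls x :=
  F.cls_eq_iff.2 ⟨0, n, rfl⟩

theorem par_mem_of_mem {x : V} (hx : x ∈ U) : F.par x ∈ U := by
  by_cases h : x ∈ F.dom
  · exact F.par_mem x h
  · rwa [F.par_eq x h]

theorem iterate_mem {x : V} (hx : x ∈ U) (n : ℕ) : F.par^[n] x ∈ U := by
  induction n with
  | zero => exact hx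
  | succ n ih =>
    rw [Function.iterate_succ_apply']
    exact F.par_mem_of_mem ih

theorem par_ne {x : V} (hx : x ∈ F.dom) : F.par x ≠ x := fun h => by
  have := F.arc_par x hx
  rw [h] at this
  exact D.arc_asymm _ _ this this

theorem par_par_ne {x : V} (hx : x ∈ F.dom) : F.par (F.par x) ≠ x := fun h => by
  by_cases hp : F.par x ∈ F.dom
  · have := F.arc_par _ hp
    rw [h] at this
    exact D.arc_asymm _ _ this (F.arc_par x hx)
  · rw [F.par_eq _ hp] at h
    exact F.par_ne hx h

theorem iterate_eq {x : V} (hx : x ∉ F.dom) (n : ℕ) : F.par^[n] x = x :=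
  Function.iterate_fixed (F.par_eq x hx) n

theorem eq_of_cls_eq {x y : V} (hx : x ∉ F.dom) (hy : y ∉ F.dom) (h : F.cls x = F.cls y) :
    x = y := by
  obtain ⟨m, n, h⟩ := F.cls_eq_iff.1 h
  rwa [F.iterate_eq hx, F.iterate_eq hy] at h

/-- The subgraph of all edges from a parent to its child. -/
def subgraph : D.Subgraph where
  verts := U
  arc u x := x ∈ F.dom ∧ u = F.par x
  arc_sub := by rintro _ x ⟨hx, rfl⟩; exact F.arc_par x hx
  fst_mem := by rintro _ x ⟨hx, rfl⟩; exact F.par_mem x hx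
  snd_mem := by rintro _ x ⟨hx, rfl⟩; exact F.dom_subset hx

/-- The part of the subgraph on one class. -/
def component (q : Quotient F.setoid) : D.Subgraph where
  verts := {x | x ∈ U ∧ F.cls x = q}
  arc u x := x ∈ F.dom ∧ u = F.par x ∧ F.cls x = q
  arc_sub := by rintro _ x ⟨hx, rfl, -⟩; exact F.arc_par x hx
  fst_mem := by rintro _ x ⟨hx, rfl, h⟩; exact ⟨F.par_mem x hx, (F.cls_par x).trans h⟩
  snd_mem := by rintro _ x ⟨hx, rfl, h⟩; exact ⟨F.dom_subset hx, h⟩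

theorem isFunctional_component (q : Quotient F.setoid) :
    (F.component q).graph.IsFunctional F.dom F.par := by
  rintro a b (⟨h, h', -⟩ | ⟨h, h', -⟩)
  · exact Or.inr ⟨h, h'⟩
  · exact Or.inl ⟨h, h'⟩

theorem cls_eq_of_mem_support {q : Quotient F.setoid} {z : V} {c : (F.component q).graph.Walk z z}
    (hc : c.IsCycle) {x : V} (hx : x ∈ c.support) : F.cls x = q := by
  have h := ((F.isFunctional_component q).mem_edges_of_isCycle hc x hx).2
  rcases c.adj_of_mem_edges h with h | h
  · exact ((F.component q).fst_mem _ _ h).2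
  · exact ((F.component q).snd_mem _ _ h).2

theorem reflTransGen_iterate {q : Quotient F.setoid} {x : V} (hx : F.cls x = q) (n : ℕ) :
    Relation.ReflTransGen (F.component q).arc (F.par^[n] x) x := by
  induction n with
  | zero => exact .refl
  | succ n ih =>
    rw [Function.iterate_succ_apply']
    by_cases h : F.par^[n] x ∈ F.dom
    · exact .head ⟨h, rfl, (F.cls_iterate x n).trans hx⟩ ih
    · rwa [F.par_eq _ h]

theorem deg_component_eq_one {q : Quotient F.setoid} (hF : ∀ x ∈ F.dom, F.par x ∈ D.vPlus)
    {x : V} (hx : x ∈ F.dom) (hq : F.cls x = q) (hw : D.weight x = 1) :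
    (F.component q).deg x = 1 := by
  have : (F.component q).graph.neighborSet x = {F.par x} := by
    ext y
    constructor
    · rintro (⟨hy, rfl, -⟩ | ⟨-, rfl, -⟩)
      · have := hF y hy
        simp only [vPlus, Set.mem_ofPred_eq] at this
        omega
      · rfl
    · rintro rfl
      exact Or.inr ⟨hx, rfl, hq⟩
  rw [Subgraph.deg, this, Set.ncard_singleton]

/-- Iterated parents end at `v`. A cycle is closed under taking parents, so it would contain `v`,
which has none. If `v` has weight one it is nobody's parent, hence alone in its class. -/
theorem isRootOrientedTree_component (hF : ∀ x ∈ F.dom, F.par x ∈ D.vPlus) {v : V} (hv : v ∈ U)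
    (hvd : v ∉ F.dom) : (F.component (F.cls v)).IsRootOrientedTree v := by
  have hreach : ∀ x, F.cls x = F.cls v → ∃ m, F.par^[m] x = v := fun x hx => by
    obtain ⟨m, n, h⟩ := F.cls_eq_iff.1 hx
    exact ⟨m, h.trans (F.iterate_eq hvd n)⟩
  have hpath : ∀ x, F.cls x = F.cls v →
      Relation.ReflTransGen (F.component (F.cls v)).arc v x := fun x hx => by
    obtain ⟨m, hm⟩ := hreach x hx
    have := F.reflTransGen_iterate hx m
    rwa [hm] at this
  refine ⟨⟨hv, rfl⟩, fun z c hc => ?_, fun x hx hxv => ?_, fun x hx hw => ?_⟩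
  · have hfun := F.isFunctional_component (F.cls v)
    obtain ⟨m, hm⟩ := hreach z (F.cls_eq_of_mem_support hc c.start_mem_support)
    have := hfun.iterate_mem_support hc c.start_mem_support m
    rw [hm] at this
    exact hvd (hfun.mem_edges_of_isCycle hc v this).1
  · exact Subgraph.hasOrientedPath_iff.2 (hpath x hx.2)
  · by_cases hxd : x ∈ F.dom
    · exact Or.inl ⟨F.deg_component_eq_one hF hxd hx.2 hw, fun h => hvd (h ▸ hxd)⟩
    · have hxv := F.eq_of_cls_eq hxd hvd hx.2
      refine Or.inr ⟨Set.eq_singleton_iff_unique_mem.2 ⟨⟨hv, rfl⟩, fun y hy => ?_⟩, hxv⟩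
      rcases Relation.ReflTransGen.cases_head (hpath y hy.2) with h | ⟨y', ⟨hy', hvy, -⟩, -⟩
      · exact h.symm
      · have := hF y' hy'
        rw [← hvy, ← hxv] at this
        simp only [vPlus, Set.mem_ofPred_eq] at this
        omega

theorem exists_iterate_mem_periodicPts [Finite V] (f : V → V) (x : V) :
    ∃ n, f^[n] x ∈ Function.periodicPts f := by
  obtain ⟨m, n, hne, h⟩ : ∃ m n, m ≠ n ∧ f^[m] x = f^[n] x := by
    by_contra! hcon
    refine not_injective_infinite_finite (fun n => f^[n] x) fun m n h => ?_
    by_contra hmn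
    exact hcon m n hmn h
  wlog hmn : m < n generalizing m n
  · exact this n m hne.symm h.symm (by omega)
  refine ⟨m, n - m, by omega, ?_⟩
  rw [Function.IsPeriodicPt, Function.IsFixedPt, ← Function.iterate_add_apply,
    Nat.sub_add_cancel hmn.le, h]

/-- Without a root, iterated parents end in a periodic orbit, which is the cycle. All vertices of a
class share iterates, so the cycle is unique and reaches every vertex. -/
theorem isUnicycle_component [Finite V] (hF : ∀ x ∈ F.dom, F.par x ∈ D.vPlus)
    {q : Quotient F.setoid} (hq : ∃ x ∈ U, F.cls x = q) (hq' : ∀ x ∈ U, F.cls x = q → x ∈ F.dom) :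
    (F.component q).IsUnicycle := by
  obtain ⟨x₀, hx₀, hx₀q⟩ := hq
  have hfun := F.isFunctional_component q
  obtain ⟨n, hz⟩ := exists_iterate_mem_periodicPts F.par x₀
  have hzU : F.par^[n] x₀ ∈ U := F.iterate_mem hx₀ n
  have hzq : F.cls (F.par^[n] x₀) = q := (F.cls_iterate x₀ n).trans hx₀q
  generalize F.par^[n] x₀ = z at hz hzU hzq
  have hdom : ∀ i, F.par^[i] z ∈ F.dom := fun i =>
    hq' _ (F.iterate_mem hzU i) ((F.cls_iterate z i).trans hzq)
  obtain ⟨c, hc, hd⟩ := SimpleGraph.exists_isCycle_of_mem_periodicPts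
    (Γ := (F.component q).graph) hz
    (fun i => Or.inl ⟨hdom i, Function.iterate_succ_apply' _ _ _,
      (F.cls_iterate z i).trans hzq⟩) (F.par_par_ne (hdom 0))
  refine ⟨⟨z, c, hc, fun z' c' hc' => ?_, fun d hdm => ?_, fun y hy _ => ?_⟩, fun x hx hw => ?_⟩
  · refine hfun.toSubgraph_eq hc' hc fun x hx y hy => F.cls_eq_iff.1 ?_
    rw [F.cls_eq_of_mem_support hc' hx, F.cls_eq_of_mem_support hc hy]
  · have hs := c.dart_snd_mem_support_of_mem_darts hdm
    exact ⟨(hfun.mem_edges_of_isCycle hc _ hs).1, hd d hdm, F.cls_eq_of_mem_support hc hs⟩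
  · obtain ⟨m, k, h⟩ := F.cls_eq_iff.1 (hy.2.trans hzq.symm)
    refine ⟨F.par^[m] y, ?_, Subgraph.hasOrientedPath_iff.2 (F.reflTransGen_iterate hy.2 m)⟩
    rw [h]
    exact hfun.iterate_mem_support hc c.start_mem_support k
  · exact F.deg_component_eq_one hF (hq' x hx.1 hx.2) hx.2 hw

/-- A vertex of `H̃` has an edge besides the one from its own parent, so it has a child. -/
theorem tilde_subgraph_subset [Finite V] {r : ℕ} {p : Fin r → V} (hp : ∀ i, p i ∉ F.dom) :
    F.subgraph.tilde p ⊆ {y | ∃ x ∈ F.dom, y = F.par x} := by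
  rintro y (⟨-, hdeg⟩ | ⟨i, rfl, hdeg⟩)
  · by_contra hy
    have hsub : F.subgraph.graph.neighborSet y ⊆ {F.par y} := by
      rintro u (⟨hu, h⟩ | ⟨-, h⟩)
      · exact (hy ⟨u, hu, h⟩).elim
      · exact h
    have := Set.ncard_le_ncard hsub
    rw [Set.ncard_singleton] at this
    exact absurd (hdeg.trans this) (by norm_num)
  · have hpos : 0 < (F.subgraph.graph.neighborSet (p i)).ncard :=
      lt_of_lt_of_eq one_pos hdeg.symm
    obtain ⟨u, ⟨hu, h⟩ | ⟨hpi, -⟩⟩ := (Set.ncard_pos (Set.toFinite _)).1 hpos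
    · exact ⟨u, hu, h⟩
    · exact (hp i hpi).elim

theorem isStarSemiForest_subgraph [Finite V] (hF : ∀ x ∈ F.dom, F.par x ∈ D.vPlus) {C : Set V}
    (hC : D.IsStrongCover C) (hFC : ∀ x ∈ F.dom, ∀ z, D.arc (F.par x) z → z ∈ C)
    (ω : V → V) (hω : ∀ x ∈ U, x ∉ F.dom → ω x ∉ U ∧ D.graph.Adj (ω x) x)
    (hωC : ∀ x ∈ U, x ∉ F.dom → ω x ∈ C →
      D.arc (ω x) x ∧ ω x ∈ D.vPlus ∧ ∀ z, D.arc (ω x) z → z ∈ C) :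
    F.subgraph.IsStarSemiForest := by
  let R := {x // x ∈ U ∧ x ∉ F.dom}
  let J := {q : Quotient F.setoid // (∃ x ∈ U, F.cls x = q) ∧ ∀ x ∈ U, F.cls x = q → x ∈ F.dom}
  let eR := Finite.equivFin R
  let eJ := Finite.equivFin J
  let p : Fin (Nat.card R) → V := fun i => (eR.symm i).1
  have hp : ∀ i, p i ∈ U ∧ p i ∉ F.dom := fun i => (eR.symm i).2
  -- The classes meeting `U` are enumerated without repetition: those with a root, which become
  -- trees, and the rootless ones, which become unicycles.
  let κ : Fin (Nat.card R) ⊕ Fin (Nat.card J) → Quotient F.setoid :=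
    Sum.elim (fun i => F.cls (p i)) fun j => (eJ.symm j).1
  have hκ : Function.Injective κ := by
    have hne : ∀ i j, F.cls (p i) ≠ (eJ.symm j).1 := fun i j h =>
      (hp i).2 ((eJ.symm j).2.2 (p i) (hp i).1 h)
    rintro (i | i) (j | j) h
    · exact congrArg Sum.inl (eR.symm.injective
        (Subtype.ext (F.eq_of_cls_eq (hp i).2 (hp j).2 h)))
    · exact (hne i j h).elim
    · exact (hne j i h.symm).elim
    · exact congrArg Sum.inr (eJ.symm.injective (Subtype.ext h))
  have hκs : ∀ x ∈ U, ∃ k, F.cls x = κ k := by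
    intro x hx
    by_cases h : ∀ y ∈ U, F.cls y = F.cls x → y ∈ F.dom
    · refine ⟨Sum.inr (eJ ⟨F.cls x, ⟨x, hx, rfl⟩, h⟩), ?_⟩
      simp [κ]
    · push Not at h
      obtain ⟨y, hy, hyx, hyd⟩ := h
      refine ⟨Sum.inl (eR ⟨y, hy, hyd⟩), ?_⟩
      simp [κ, p, hyx]
  let T := fun i => F.component (F.cls (p i))
  let B := fun j : Fin (Nat.card J) => F.component (eJ.symm j).1
  have hTB : ∀ k, Sum.elim T B k = F.component (κ k) := by
    rintro (i | j) <;> rfl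
  let w : Fin (Nat.card R) → V := fun i => ω (p i)
  refine ⟨Nat.card R, Nat.card J, T, p, B,
    fun i => F.isRootOrientedTree_component hF (hp i).1 (hp i).2,
    fun j => F.isUnicycle_component hF (eJ.symm j).2.1 (eJ.symm j).2.2, ?_, ?_, w,
    fun i => hω (p i) (hp i).1 (hp i).2, Set.range w ∩ Cᶜ, Set.range w ∩ C, ?_, ?_, ?_, ?_, ?_, ?_⟩
  · ext x y
    · constructor
      · intro hx
        obtain ⟨k, hk⟩ := hκs x hx
        refine Set.mem_iUnion.2 ⟨k, ?_⟩
        rw [hTB]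
        exact ⟨hx, hk⟩
      · intro hx
        obtain ⟨k, hk⟩ := Set.mem_iUnion.1 hx
        rw [hTB] at hk
        exact hk.1
    · constructor
      · rintro ⟨hy, rfl⟩
        obtain ⟨k, hk⟩ := hκs y (F.dom_subset hy)
        refine ⟨k, ?_⟩
        rw [hTB]
        exact ⟨hy, rfl, hk⟩
      · rintro ⟨k, hk⟩
        rw [hTB] at hk
        exact ⟨hk.1, hk.2.1⟩
  · intro k l hkl
    rw [hTB, hTB, Set.disjoint_left]
    exact fun x hk hl => hkl (hκ (hk.2.symm.trans hl.2))
  · rw [← Set.inter_union_distrib_left, Set.compl_union_self, Set.inter_univ]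
  · rw [Set.disjoint_left]
    exact fun x h h' => h.2 h'.2
  · exact fun a ha b hb _ => hC.stable_compl a ha.2 b hb.2
  · rintro _ ⟨⟨i, rfl⟩, h⟩
    exact (hωC (p i) (hp i).1 (hp i).2 h).2.1
  · rintro i ⟨-, h⟩
    exact (hωC (p i) (hp i).1 (hp i).2 h).1
  · rw [Set.eq_empty_iff_forall_notMem]
    rintro z ⟨⟨y, hy | hy, hyz⟩, -, hz⟩
    · obtain ⟨⟨i, rfl⟩, h⟩ := hy
      exact hz ((hωC (p i) (hp i).1 (hp i).2 h).2.2 z hyz)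
    · obtain ⟨x, hx, rfl⟩ := F.tilde_subgraph_subset (fun i => (hp i).2) hy
      exact hz (hFC x hx z hyz)

end ParentFunction

/-- Each vertex of `U` gets a witness `g x`: a neighbour outside `C`, or the in-neighbour that
strength provides. Witnesses inside `U` become parents; those outside become the `w i`, put in `W₁`
or `W₂` according to membership in `C`. -/
theorem IsStrongCover.exists_isStarSemiForest [Finite V] {C U : Set V} (hC : D.IsStrongCover C)
    (hUC : U ⊆ C) : ∃ H : D.Subgraph, H.IsStarSemiForest ∧ U = H.verts := by
  classical
  have h : ∀ x ∈ U, ∃ y, D.graph.Adj y x ∧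
      (y ∈ C → D.arc y x ∧ y ∈ D.vPlus ∧ ∀ z, D.arc y z → z ∈ C) := by
    intro x hx
    by_cases hN : ∀ y, D.graph.Adj x y → y ∈ C
    · obtain ⟨y, hyx, hy, hyC⟩ := hC.2 x (hUC hx) hN
      exact ⟨y, D.adj_of_arc hyx, fun _ => ⟨hyx, hy, hyC⟩⟩
    · push Not at hN
      obtain ⟨y, hxy, hy⟩ := hN
      exact ⟨y, hxy.symm, fun h => (hy h).elim⟩
  choose! g hg hgC using h
  let F : ParentFunction D U :=
    { dom := {x | x ∈ U ∧ g x ∈ U}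
      par := fun x => if x ∈ U ∧ g x ∈ U then g x else x
      dom_subset := fun x hx => hx.1
      par_mem := fun x hx => by
        rw [if_pos (show x ∈ U ∧ g x ∈ U from hx)]
        exact hx.2
      arc_par := fun x hx => by
        rw [if_pos (show x ∈ U ∧ g x ∈ U from hx)]
        exact (hgC x hx.1 (hUC hx.2)).1
      par_eq := fun x hx => if_neg hx }
  have hpar : ∀ x ∈ F.dom, F.par x = g x := fun x hx => if_pos hx
  refine ⟨F.subgraph, F.isStarSemiForest_subgraph ?_ hC ?_ g ?_ ?_, rfl⟩
  · intro x hx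
    rw [hpar x hx]
    exact (hgC x hx.1 (hUC hx.2)).2.1
  · intro x hx
    rw [hpar x hx]
    exact (hgC x hx.1 (hUC hx.2)).2.2
  · exact fun x hx hxd => ⟨fun h => hxd ⟨hx, h⟩, hg x hx⟩
  · exact fun x hx _ h => hgC x hx h

theorem Subgraph.hasGeneratingStarSemiForest_iff [Finite V] {S : D.Subgraph} :
    S.HasGeneratingStarSemiForest ↔ ∃ C, D.IsStrongCover C ∧ S.verts ⊆ C := by
  constructor
  · rintro ⟨H, hH, h⟩
    rw [h]
    exact hH.exists_isStrongCover
  · rintro ⟨C, hC, h⟩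
    exact hC.exists_isStarSemiForest h

end WeightedOrientedGraph

/-! ### The characterization of unmixedness -/

namespace WeightedOrientedGraph

theorem isUnmixedIdeal_edgeIdeal_iff_of_connected {V : Type u} [Finite V] (K : Type v) [Field K]
    (D : WeightedOrientedGraph V) (hsource : ∀ x, D.IsSource x → D.weight x = 1)
    (hconn : D.graph.Connected)
    (h4 : D.graph.HasNoCycle 4) (h5 : D.graph.HasNoCycle 5) :
    IsUnmixedIdeal (D.edgeIdeal K) ↔
      ((Nonempty (D.graph ≃g SimpleGraph.cycleGraph 7) ∨ Nonempty (D.graph ≃g graphT10)) ∧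
          ∀ x ∈ D.vPlus, D.IsSink x) ∨
        ((∀ x : V, ∃! S : D.Subgraph, D.IsSimplex S ∧ x ∈ S.verts) ∧
          ∀ S : D.Subgraph, D.IsSimplex S → ¬ S.HasGeneratingStarSemiForest) := by
  rw [D.isUnmixedIdeal_edgeIdeal_iff K]
  simp only [Subgraph.hasGeneratingStarSemiForest_iff]
  constructor
  · intro h
    obtain ⟨hG, hC⟩ := strongCovers_ncard_eq_iff.1 h
    rcases hG.inSimplex_or_iso hconn h4.fourCycleFree h5.fiveCycleFree with hS | ⟨⟨e⟩⟩ | ⟨⟨e⟩⟩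
    · have hP := fun x => existsUnique_isSimplex hG (hS x)
      exact Or.inr ⟨hP, (strongCovers_ncard_eq_iff_of_isSimplex hP).1 h⟩
    · exact Or.inl ⟨Or.inl ⟨e⟩, isSink_of_hasPathDominators
        (SimpleGraph.hasPathDominators_cycleGraph_seven.of_iso e) hsource hC⟩
    · exact Or.inl ⟨Or.inr ⟨e⟩, isSink_of_hasPathDominators
        (SimpleGraph.hasPathDominators_graphT10.of_iso e) hsource hC⟩
  · rintro (⟨hiso, hsink⟩ | ⟨hP, h⟩)
    · refine strongCovers_ncard_eq_iff.2 ⟨?_, fun C hC => hC.isMaxStable_compl_of_isSink hsink⟩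
      rcases hiso with ⟨⟨e⟩⟩ | ⟨⟨e⟩⟩
      · exact SimpleGraph.wellCovered_cycleGraph_seven.of_iso e
      · exact SimpleGraph.wellCovered_graphT10.of_iso e
    · exact (strongCovers_ncard_eq_iff_of_isSimplex hP).2 h

end WeightedOrientedGraph

theorem mainTheorem5 {V : Type u} [Finite V] (K : Type v) [Field K]
    (D : WeightedOrientedGraph V)
    (hsource : ∀ x, D.IsSource x → D.weight x = 1)
    (hconn : D.graph.Connected)
    (h4 : D.graph.HasNoCycle 4) (h5 : D.graph.HasNoCycle 5) :
    IsUnmixedIdeal (D.edgeIdeal K) ↔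
      ((Nonempty (D.graph ≃g SimpleGraph.cycleGraph 7) ∨ Nonempty (D.graph ≃g graphT10)) ∧
          ∀ x ∈ D.vPlus, D.IsSink x) ∨
        ((∀ x : V, ∃! S : D.Subgraph, D.IsSimplex S ∧ x ∈ S.verts) ∧
          ∀ S : D.Subgraph, D.IsSimplex S → ¬ S.HasGeneratingStarSemiForest) := by
  exact D.isUnmixedIdeal_edgeIdeal_iff_of_connected K hsource hconn h4 h5
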